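/- **Setting.** Let $\mathbb K=\mathbb R$ or $\mathbb C$. Let $\mathcal E$ be a first-countable topological $\mathbb K$-vector space and $\mathcal A$ a complete Hausdorff locally convex topological $\mathbb K$-algebra (unital, associative, with jointly continuous product), both $\mathbb Z$-graded with finitely many nonzero degrees and continuous projections onto them, $\mathcal A$ being graded commutative. (For a family of free theories over $\mathcal A$, $\mathcal E=\Gamma(M,E)$ is the nuclear Fréchet space of smooth sections of a graded vector bundle over a compact manifold, with $\mathcal A=C^\infty(\Delta^n)$, $\Omega^\bullet(\Delta^n)$ or another such algebra.) Koszul signs are used throughout. $\mathrm{Hom}(\mathcal E^{\hat\otimes n},\mathcal A)$ denotes the space of continuous $n$-linear maps $\mathcal E^n\to\mathcal A$; for nuclear Fréchet spaces this is $(\mathcal E^\dagger)^{\hat\otimes n}\hat\otimes\mathcal A$. **Functionals.** A commutative functional is a series $J=\sum_{p,q\ge0}\hbar^pJ_{pq}$ with $J_{pq}\in\mathrm{Hom}(\mathcal E^{\hat\otimes q},\mathcal A)_{S_q}$. It is an *interaction* if it has total degree $0$ and $J_{pq}=0$ whenever $2p+q<3$. Let $\mathcal K_+$ be the product over $n\ge1$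 of the cyclic coinvariants of order $n$. A noncommutative functional is a series $I=\sum_{i,j,k,l\ge0}\gamma^i\nu^jI_{ijkl}$, where $I_{ijkl}$ lies in the part of order $l$ of $[\mathcal K_+^{\hat\otimes k}]_{S_k}$ (with values in $\mathcal A$), i.e. it is a sum of products of $k$ cyclic words with $l$ letters altogether. It is an *interaction* if it has total degree $0$, $I_{i00l}=0$ for all $i,l$, and $I_{ijkl}=0$ whenever $2(2i+j+k-1)+l<3$. A *family of propagators* is a $P\in\mathcal E\hat\otimes\mathcal E\hat\otimes\mathcal A$ (completed projective tensor product) of total degree $0$ that is invariant under the signed flip of the two factors $\mathcal E$. **Graphs.** A *stable graph* $\Gamma$ has finite sets $H$ of half-edges and $V$ of vertices, a map $\rho:H\to V$, an involution $\kappa$ of $H$ (fixed points: legs $L$; two-element orbits: edges $E$) and loop numbers $l(v)\in\mathbb Z_{\ge0}$ with $2l(v)+|v|\ge3$, where $v$ also denotes $\rho^{-1}(v)$; $\ell(\Gamma)=b_1(\Gamma)+\sum_vl(v)$. A *stable ribbon graph* has, instead of $l$, a decomposition $C(v)$ of each set $v$ into cycles and integers $g(v),b(v)\ge0$ such that $|C(v)|+b(v)>0$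 and $2l(v)+|v|\ge3$ for $l(v):=2g(v)+b(v)+|C(v)|-1$. Let $c$ be the permutation of $H$ formed by all the cycles, $|C(\Gamma)|$ their number, and $\beta$ the number of cycles of $c\kappa$. Contracting all edges one after the other (an edge joining two cycles merges them, an edge with both ends in one cycle splits it, the two half-edges are deleted, empty cycles are dropped) leaves a cyclic decomposition of $L$, the canonical one, with $k(\Gamma)$ cycles. For connected $\Gamma$ put $$g(\Gamma)=1-|V|+\tfrac12\bigl(|E|+|C(\Gamma)|-\beta\bigr)+\sum_vg(v),\qquad b(\Gamma)=\beta+\sum_vb(v)-k(\Gamma).$$ The empty graph is not connected. **Flows.** For a stable graph (resp. stable ribbon graph), attach to each vertex $v$ the image $I(v)\in\mathrm{Hom}(\mathcal E^{\hat\otimes v},\mathcal A)$ of $I_{l(v)\,|v|}$ (resp. $I_{g(v)\,b(v)\,|C(v)|\,|v|}$) obtained by summing over all bijections from $\{1,\dots,|v|\}$ to $v$ (resp. over those compatible with the cyclic decompositions), and attach $P$ to each edge. Evaluating $\bigotimes_vI(v)$ on the legs and on the propagators, and multiplying all factors in $\mathcal A$, gives an element of $\mathrm{Hom}(\mathcal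 E^{\hat\otimes L},\mathcal A)$; its class in the $S_{|L|}$-coinvariants (resp. the product of cyclic words determined by the canonical cyclic decomposition of $L$) is the weight $w_\Gamma(I,P)$. The flows are $$W^{\mathrm{com}}(J,P)=\sum_\Gamma\frac{\hbar^{\ell(\Gamma)}}{|\mathrm{Aut}\,\Gamma|}w_\Gamma(J,P),\qquad W^{\mathrm{nc}}(I,P)=\sum_\Gamma\frac{\gamma^{g(\Gamma)}\nu^{b(\Gamma)}}{|\mathrm{Aut}\,\Gamma|}w_\Gamma(I,P),$$ over isomorphism classes of connected stable graphs, resp. connected stable ribbon graphs. **Theorem.** Let $\sigma_{\gamma,\nu}$ be the linear map from noncommutative to commutative functionals that passes from cyclic to symmetric coinvariants and acts componentwise, so that for cyclic words $x_1,\dots,x_k\in\mathcal K_+$ and $j+k\ge1$ $$\sigma_{\gamma,\nu}(\gamma^i\nu^jx_1\cdots x_k)=\hbar^{2i+j+k-1}\sigma(x_1)\cdots\sigma(x_k).$$ There are only finitely many isomorphism classes of connected stable graphs with given $\ell(\Gamma)$ and $|L|$, and of connected stable ribbon graphs with given $g(\Gamma)$, $b(\Gamma)$, $k(\Gamma)$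 and $|L|$, so both sums are finite in every multidegree; $\sigma_{\gamma,\nu}$ maps interactions to interactions; and for every family of propagators $P$ both $W^{\mathrm{nc}}(-,P)$ and $W^{\mathrm{com}}(-,P)$ map interactions to interactions, and $$\sigma_{\gamma,\nu}\bigl(W^{\mathrm{nc}}(I,P)\bigr)=W^{\mathrm{com}}\bigl(\sigma_{\gamma,\nu}(I),P\bigr)$$ for every noncommutative interaction $I$. -/

import Mathlib

open scoped TensorProduct
noncomputable section
set_option linter.unusedSectionVars false

namespace NCFlow

section Tensor
variable (𝕜 X Y Z : Type*) [RCLike 𝕜]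
  [AddCommGroup X] [Module 𝕜 X] [AddCommGroup Y] [Module 𝕜 Y] [AddCommGroup Z] [Module 𝕜 Z]

/-- The algebraic tensor product `X ⊗ Y ⊗ Z`, to be equipped with the projective topology. -/
def AlgTensor : Type _ := X ⊗[𝕜] (Y ⊗[𝕜] Z)

instance : AddCommGroup (AlgTensor 𝕜 X Y Z) := inferInstanceAs (AddCommGroup (X ⊗[𝕜] (Y ⊗[𝕜] Z)))
instance : Module 𝕜 (AlgTensor 𝕜 X Y Z) := inferInstanceAs (Module 𝕜 (X ⊗[𝕜] (Y ⊗[𝕜] Z)))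

variable {X Y Z}

/-- The elementary tensor `x ⊗ y ⊗ z`. -/
def pureTensor (x : X) (y : Y) (z : Z) : AlgTensor 𝕜 X Y Z := x ⊗ₜ[𝕜] (y ⊗ₜ[𝕜] z)

variable (X Y Z) [TopologicalSpace X] [TopologicalSpace Y] [TopologicalSpace Z]

/-- All seminorms `q` on `X ⊗ Y ⊗ Z` for which `(x, y, z) ↦ q (x ⊗ y ⊗ z)` is continuous. They
define the projective topology, the finest locally convex one making `⊗` continuous. -/
def projSeminorms : SeminormFamily 𝕜 (AlgTensor 𝕜 X Y Z)
    {q : Seminorm 𝕜 (AlgTensor 𝕜 X Y Z) //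
      Continuous fun p : X × Y × Z => q (pureTensor 𝕜 p.1 p.2.1 p.2.2)} :=
  fun q => q.1

instance : Nonempty {q : Seminorm 𝕜 (AlgTensor 𝕜 X Y Z) //
      Continuous fun p : X × Y × Z => q (pureTensor 𝕜 p.1 p.2.1 p.2.2)} :=
  ⟨⟨0, by simpa using continuous_const⟩⟩

instance : TopologicalSpace (AlgTensor 𝕜 X Y Z) :=
  (projSeminorms 𝕜 X Y Z).moduleFilterBasis.topology

theorem withSeminorms_projSeminorms : WithSeminorms (projSeminorms 𝕜 X Y Z) := ⟨rfl⟩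

instance : IsTopologicalAddGroup (AlgTensor 𝕜 X Y Z) :=
  (withSeminorms_projSeminorms 𝕜 X Y Z).topologicalAddGroup

instance : ContinuousSMul 𝕜 (AlgTensor 𝕜 X Y Z) :=
  (withSeminorms_projSeminorms 𝕜 X Y Z).continuousSMul

instance : UniformSpace (AlgTensor 𝕜 X Y Z) :=
  IsTopologicalAddGroup.rightUniformSpace (AlgTensor 𝕜 X Y Z)

instance : IsUniformAddGroup (AlgTensor 𝕜 X Y Z) := isUniformAddGroup_of_addCommGroup

instance : UniformContinuousConstSMul 𝕜 (AlgTensor 𝕜 X Y Z) :=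
  uniformContinuousConstSMul_of_continuousConstSMul 𝕜 _

/-- The completed projective tensor product of three topological vector spaces. -/
abbrev CTensor : Type _ := UniformSpace.Completion (AlgTensor 𝕜 X Y Z)

/-- The canonical dense map from the algebraic tensor product to its completion. -/
def toCTensor : AlgTensor 𝕜 X Y Z →L[𝕜] CTensor 𝕜 X Y Z where
  toFun := fun u => (u : UniformSpace.Completion (AlgTensor 𝕜 X Y Z))
  map_add' := fun a b => UniformSpace.Completion.coe_add a b
  map_smul' := fun c a => UniformSpace.Completion.coe_smul c a
  cont := UniformSpace.Completion.continuous_coe _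

variable {X Y Z}
variable {W : Type*} [AddCommGroup W] [Module 𝕜 W]

theorem continuous_of_continuous_pure [UniformSpace W] [IsUniformAddGroup W]
    [PolynormableSpace 𝕜 W] (L : AlgTensor 𝕜 X Y Z →ₗ[𝕜] W)
    (hL : Continuous fun p : X × Y × Z => L (pureTensor 𝕜 p.1 p.2.1 p.2.2)) : Continuous L := by
  have hW := PolynormableSpace.withSeminorms 𝕜 W
  refine hW.continuous_of_continuous_comp L fun p => ?_
  have hc : Continuous fun t : X × Y × Z => (p.1.comp L) (pureTensor 𝕜 t.1 t.2.1 t.2.2) :=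
    p.2.comp hL
  exact (withSeminorms_projSeminorms 𝕜 X Y Z).continuous_seminorm ⟨p.1.comp L, hc⟩

theorem pureTensor_sub_left (x x' : X) (y : Y) (z : Z) :
    pureTensor 𝕜 (x - x') y z = pureTensor 𝕜 x y z - pureTensor 𝕜 x' y z :=
  TensorProduct.sub_tmul _ _ _

theorem pureTensor_sub_mid (x : X) (y y' : Y) (z : Z) :
    pureTensor 𝕜 x (y - y') z = pureTensor 𝕜 x y z - pureTensor 𝕜 x y' z := by
  unfold pureTensor
  rw [TensorProduct.sub_tmul, TensorProduct.tmul_sub]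
  rfl

theorem pureTensor_sub_right (x : X) (y : Y) (z z' : Z) :
    pureTensor 𝕜 x y (z - z') = pureTensor 𝕜 x y z - pureTensor 𝕜 x y z' := by
  unfold pureTensor
  rw [TensorProduct.tmul_sub, TensorProduct.tmul_sub]
  rfl

theorem continuous_pureTensor [IsTopologicalAddGroup X] [IsTopologicalAddGroup Y]
    [IsTopologicalAddGroup Z] :
    Continuous fun p : X × Y × Z => pureTensor 𝕜 p.1 p.2.1 p.2.2 := by
  rw [continuous_iff_continuousAt]
  rintro ⟨x₀, y₀, z₀⟩
  have hw := withSeminorms_projSeminorms 𝕜 X Y Z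
  rw [ContinuousAt, hw.tendsto_nhds]
  intro q ε hε
  have hq := q.2
  have h1 : Filter.Tendsto (fun p : X × Y × Z =>
      q.1 (pureTensor 𝕜 (p.1 - x₀) p.2.1 p.2.2) + (q.1 (pureTensor 𝕜 x₀ (p.2.1 - y₀) p.2.2)
        + q.1 (pureTensor 𝕜 x₀ y₀ (p.2.2 - z₀)))) (nhds (x₀, y₀, z₀)) (nhds 0) := by
    have c1 : Continuous fun p : X × Y × Z => q.1 (pureTensor 𝕜 (p.1 - x₀) p.2.1 p.2.2) :=
      hq.comp (f := fun p : X × Y × Z => (p.1 - x₀, p.2.1, p.2.2)) (by fun_prop)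
    have c2 : Continuous fun p : X × Y × Z => q.1 (pureTensor 𝕜 x₀ (p.2.1 - y₀) p.2.2) :=
      hq.comp (f := fun p : X × Y × Z => (x₀, p.2.1 - y₀, p.2.2)) (by fun_prop)
    have c3 : Continuous fun p : X × Y × Z => q.1 (pureTensor 𝕜 x₀ y₀ (p.2.2 - z₀)) :=
      hq.comp (f := fun p : X × Y × Z => (x₀, y₀, p.2.2 - z₀)) (by fun_prop)
    refine ((c1.add (c2.add c3)).tendsto (x₀, y₀, z₀)).trans_eq ?_ |>.trans le_rfl
    simp [pureTensor_sub_left, pureTensor_sub_mid, pureTensor_sub_right]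
  filter_upwards [h1.eventually (gt_mem_nhds hε)] with p hp
  refine lt_of_le_of_lt ?_ hp
  have : pureTensor 𝕜 p.1 p.2.1 p.2.2 - pureTensor 𝕜 x₀ y₀ z₀ =
      pureTensor 𝕜 (p.1 - x₀) p.2.1 p.2.2 + (pureTensor 𝕜 x₀ (p.2.1 - y₀) p.2.2
        + pureTensor 𝕜 x₀ y₀ (p.2.2 - z₀)) := by
    rw [pureTensor_sub_left, pureTensor_sub_mid, pureTensor_sub_right]; abel
  change q.1 (_ - _) ≤ _
  rw [this]
  exact (map_add_le_add _ _ _).trans (by gcongr; exact map_add_le_add _ _ _)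

/-- The continuous linear map on the completed tensor product determined by a linear map `L` on the
algebraic one such that `(x, y, z) ↦ L (x ⊗ y ⊗ z)` is continuous. -/
def CTensor.lift [UniformSpace W] [IsUniformAddGroup W] [ContinuousConstSMul 𝕜 W]
    [PolynormableSpace 𝕜 W] [T0Space W] [CompleteSpace W] (L : AlgTensor 𝕜 X Y Z →ₗ[𝕜] W)
    (hL : Continuous fun p : X × Y × Z => L (pureTensor 𝕜 p.1 p.2.1 p.2.2)) :
    CTensor 𝕜 X Y Z →L[𝕜] W :=
  ContinuousLinearMap.extend ⟨L, continuous_of_continuous_pure 𝕜 L hL⟩ (toCTensor 𝕜 X Y Z)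

theorem CTensor.lift_coe [UniformSpace W] [IsUniformAddGroup W] [ContinuousConstSMul 𝕜 W]
    [PolynormableSpace 𝕜 W] [T0Space W] [CompleteSpace W] (L : AlgTensor 𝕜 X Y Z →ₗ[𝕜] W)
    (hL : Continuous fun p : X × Y × Z => L (pureTensor 𝕜 p.1 p.2.1 p.2.2))
    (u : AlgTensor 𝕜 X Y Z) : CTensor.lift 𝕜 L hL (toCTensor 𝕜 X Y Z u) = L u :=
  ContinuousLinearMap.extend_eq _ UniformSpace.Completion.denseRange_coe
    (UniformSpace.Completion.isUniformInducing_coe _) u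

section Maps
variable [IsTopologicalAddGroup X] [IsTopologicalAddGroup Y] [IsTopologicalAddGroup Z]

instance : PolynormableSpace 𝕜 (AlgTensor 𝕜 X Y Z) :=
  (withSeminorms_projSeminorms 𝕜 X Y Z).toPolynormableSpace

/-- The map `f ⊗ g ⊗ h` on completed tensor products. -/
def CTensor.map (f : X →L[𝕜] X) (g : Y →L[𝕜] Y) (h : Z →L[𝕜] Z) :
    CTensor 𝕜 X Y Z →L[𝕜] CTensor 𝕜 X Y Z :=
  ContinuousLinearMap.extend
    ((toCTensor 𝕜 X Y Z).comp
      (⟨TensorProduct.map f.toLinearMap (TensorProduct.map g.toLinearMap h.toLinearMap),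
        continuous_of_continuous_pure 𝕜 _
          ((continuous_pureTensor 𝕜).comp (f := fun p : X × Y × Z => (f p.1, g p.2.1, h p.2.2))
            (by fun_prop))⟩ : AlgTensor 𝕜 X Y Z →L[𝕜] AlgTensor 𝕜 X Y Z))
    (toCTensor 𝕜 X Y Z)

/-- The (unsigned) flip `x ⊗ y ⊗ z ↦ y ⊗ x ⊗ z` on completed tensor products. -/
def CTensor.flip : CTensor 𝕜 X X Z →L[𝕜] CTensor 𝕜 X X Z :=
  ContinuousLinearMap.extend
    ((toCTensor 𝕜 X X Z).comp
      (⟨(TensorProduct.leftComm 𝕜 X X Z).toLinearMap,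
        continuous_of_continuous_pure 𝕜 _
          ((continuous_pureTensor 𝕜).comp (f := fun p : X × X × Z => (p.2.1, p.1, p.2.2))
            (by fun_prop))⟩ : AlgTensor 𝕜 X X Z →L[𝕜] AlgTensor 𝕜 X X Z))
    (toCTensor 𝕜 X X Z)

theorem CTensor.map_pure (f : X →L[𝕜] X) (g : Y →L[𝕜] Y) (h : Z →L[𝕜] Z) (x : X) (y : Y) (z : Z) :
    CTensor.map 𝕜 f g h (toCTensor 𝕜 X Y Z (pureTensor 𝕜 x y z)) =
      toCTensor 𝕜 X Y Z (pureTensor 𝕜 (f x) (g y) (h z)) :=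
  ContinuousLinearMap.extend_eq _ UniformSpace.Completion.denseRange_coe
    (UniformSpace.Completion.isUniformInducing_coe _) _

theorem CTensor.flip_pure (x y : X) (z : Z) :
    CTensor.flip 𝕜 (toCTensor 𝕜 X X Z (pureTensor 𝕜 x y z)) =
      toCTensor 𝕜 X X Z (pureTensor 𝕜 y x z) :=
  ContinuousLinearMap.extend_eq _ UniformSpace.Completion.denseRange_coe
    (UniformSpace.Completion.isUniformInducing_coe _) _

end Maps

end Tensor

section Functionals
variable (𝕜 E A : Type*) [RCLike 𝕜]
  [AddCommGroup E] [Module 𝕜 E] [TopologicalSpace E]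
  [Ring A] [Algebra 𝕜 A] [UniformSpace A]

/-- The `A`-valued functionals `Hom(E^{⊗̂ n}, A)` of order `n = |ι|`, given through the universal property
of the completed projective tensor product; this is `(E†)^{⊗̂ n} ⊗̂ A` if `E` and `A` are nuclear
Fréchet spaces. -/
abbrev MultiFun (ι : Type*) : Type _ := ContinuousMultilinearMap 𝕜 (fun _ : ι => E) A

variable {𝕜 E A}

section Contraction
variable [IsTopologicalAddGroup E] [ContinuousSMul 𝕜 E]
  [IsUniformAddGroup A] [ContinuousSMul 𝕜 A] [ContinuousMul A]

/-- The functional `x ↦ f (x, s, t) · a`. -/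
def plug {n : ℕ} (f : MultiFun 𝕜 E A (Fin (n + 2))) (s t : E) (a : A) : MultiFun 𝕜 E A (Fin n) where
  toFun x := f (Fin.snoc (α := fun _ => E) (Fin.snoc (α := fun _ => E) x s) t) * a
  map_update_add' {inst} m i x y := by
    obtain rfl : inst = instDecidableEqFin n := Subsingleton.elim _ _
    simp [Fin.snoc_update, add_mul]
  map_update_smul' {inst} m i c x := by
    obtain rfl : inst = instDecidableEqFin n := Subsingleton.elim _ _
    simp [Fin.snoc_update]
  cont := by
    refine (f.cont.comp ?_).mul continuous_const
    fun_prop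

theorem plug_apply {n : ℕ} (f : MultiFun 𝕜 E A (Fin (n + 2))) (s t : E) (a : A) (x : Fin n → E) :
    plug f s t a x = f (Fin.snoc (α := fun _ => E) (Fin.snoc (α := fun _ => E) x s) t) * a := rfl

theorem continuous_plug_uncurried {n : ℕ} (f : MultiFun 𝕜 E A (Fin (n + 2))) :
    Continuous fun q : (E × E × A) × (Fin n → E) => plug f q.1.1 q.1.2.1 q.1.2.2 q.2 := by
  simp only [plug_apply]
  refine (f.cont.comp ?_).mul (by fun_prop)
  fun_prop

section PlugLinear
variable {n : ℕ} (f : MultiFun 𝕜 E A (Fin (n + 2)))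

theorem plug_add_left (s s' t : E) (a : A) : plug f (s + s') t a = plug f s t a + plug f s' t a := by
  ext x
  have h := f.map_update_add
    (Fin.snoc (α := fun _ => E) (Fin.snoc (α := fun _ => E) x (0 : E)) t) (Fin.last n).castSucc
  have h' := h s s'
  simp only [← Fin.snoc_update, Fin.update_snoc_last] at h'
  simp [plug_apply, h', add_mul]

theorem plug_smul_left (c : 𝕜) (s t : E) (a : A) : plug f (c • s) t a = c • plug f s t a := by
  ext x
  have h := f.map_update_smul
    (Fin.snoc (α := fun _ => E) (Fin.snoc (α := fun _ => E) x (0 : E)) t) (Fin.last n).castSucc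
  have h' := h c s
  simp only [← Fin.snoc_update, Fin.update_snoc_last] at h'
  simp [plug_apply, h']

theorem plug_add_mid (s t t' : E) (a : A) : plug f s (t + t') a = plug f s t a + plug f s t' a := by
  ext x
  have h := f.map_update_add
    (Fin.snoc (α := fun _ => E) (Fin.snoc (α := fun _ => E) x s) (0 : E)) (Fin.last (n + 1))
  have h' := h t t'
  simp only [Fin.update_snoc_last] at h'
  simp [plug_apply, h', add_mul]

theorem plug_smul_mid (c : 𝕜) (s t : E) (a : A) : plug f s (c • t) a = c • plug f s t a := by
  ext x
  have h := f.map_update_smul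
    (Fin.snoc (α := fun _ => E) (Fin.snoc (α := fun _ => E) x s) (0 : E)) (Fin.last (n + 1))
  have h' := h c t
  simp only [Fin.update_snoc_last] at h'
  simp [plug_apply, h']

theorem plug_add_right (s t : E) (a a' : A) : plug f s t (a + a') = plug f s t a + plug f s t a' := by
  ext x
  simp [plug_apply, mul_add]

theorem plug_smul_right (c : 𝕜) (s t : E) (a : A) : plug f s t (c • a) = c • plug f s t a := by
  ext x
  simp [plug_apply]

/-- The linear map `s ⊗ t ⊗ a ↦ f (-, s, t) · a`. -/
def plugLin : AlgTensor 𝕜 E E A →ₗ[𝕜] MultiFun 𝕜 E A (Fin n) :=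
  TensorProduct.lift
    { toFun := fun s => TensorProduct.lift
        (LinearMap.mk₂ 𝕜 (fun t a => plug f s t a) (plug_add_mid f s) (fun c => plug_smul_mid f c s)
          (plug_add_right f s) (fun c => plug_smul_right f c s))
      map_add' := fun s s' => TensorProduct.ext' fun t a => by simp [plug_add_left]
      map_smul' := fun c s => TensorProduct.ext' fun t a => by simp [plug_smul_left] }

theorem plugLin_pure (s t : E) (a : A) : plugLin f (pureTensor 𝕜 s t a) = plug f s t a := by
  rfl

end PlugLinear

theorem tendsto_plug_zero {n : ℕ} (f : MultiFun 𝕜 E A (Fin (n + 2))) {T : Type*} {l : Filter T}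
    (g : T → MultiFun 𝕜 E A (Fin n)) (z : E × E × A) (hz : plug f z.1 z.2.1 z.2.2 = 0)
    (φ : 𝕜 → T → E × E × A) (hφ : ∀ c, Filter.Tendsto (φ c) l (nhds z))
    (hg : ∀ c τ, c • g τ = plug f (φ c τ).1 (φ c τ).2.1 (φ c τ).2.2) :
    Filter.Tendsto g l (nhds 0) := by
  rw [ContinuousMultilinearMap.hasBasis_nhds_zero.tendsto_right_iff]
  rintro ⟨S, U⟩ ⟨hS, hU⟩
  have hc := (continuous_plug_uncurried f).tendsto (z, (0 : Fin n → E))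
  rw [hz] at hc
  have hev := hc.eventually hU
  rw [nhds_prod_eq, Filter.eventually_prod_iff] at hev
  obtain ⟨p, hp, q, hq, hpq⟩ := hev
  obtain ⟨c, hcS, hc0⟩ := ((hS hq).and (Bornology.eventually_ne_cobounded (0 : 𝕜))).exists
  filter_upwards [hφ (c ^ n) hp] with τ hτ x hx
  obtain ⟨y, hy, rfl⟩ := hcS hx
  have h := hpq hτ hy
  rw [← hg] at h
  have e : g τ (c • y) = (c ^ n • g τ) y := by
    have := (g τ).map_smul_univ (fun _ => c) y
    rw [Finset.prod_const, Finset.card_univ, Fintype.card_fin] at this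
    exact this
  change g τ (c • y) ∈ U
  rw [e]
  exact h

theorem continuous_plug {n : ℕ} (f : MultiFun 𝕜 E A (Fin (n + 2))) :
    Continuous fun p : E × E × A => plug f p.1 p.2.1 p.2.2 := by
  rw [continuous_iff_continuousAt]
  rintro ⟨s₀, t₀, a₀⟩
  have hs0 : ∀ t a, plug f 0 t a = 0 := fun t a =>
    (AddMonoidHom.mk' (fun s => plug f s t a) fun s s' => plug_add_left f s s' t a).map_zero
  have ht0 : ∀ s a, plug f s 0 a = 0 := fun s a =>
    (AddMonoidHom.mk' (fun t => plug f s t a) fun t t' => plug_add_mid f s t t' a).map_zero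
  have ha0 : ∀ s t, plug f s t 0 = 0 := fun s t =>
    (AddMonoidHom.mk' (fun a => plug f s t a) fun a a' => plug_add_right f s t a a').map_zero
  have h1 : Filter.Tendsto (fun p : E × E × A => plug f (p.1 - s₀) p.2.1 p.2.2)
      (nhds (s₀, t₀, a₀)) (nhds 0) := by
    refine tendsto_plug_zero f _ (0, t₀, a₀) (hs0 _ _) (fun c p => (c • (p.1 - s₀), p.2.1, p.2.2))
      (fun c => ?_) fun c τ => (plug_smul_left f c _ _ _).symm
    have : Continuous fun p : E × E × A => (c • (p.1 - s₀), p.2.1, p.2.2) := by fun_prop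
    simpa using this.tendsto (s₀, t₀, a₀)
  have h2 : Filter.Tendsto (fun p : E × E × A => plug f s₀ (p.2.1 - t₀) p.2.2)
      (nhds (s₀, t₀, a₀)) (nhds 0) := by
    refine tendsto_plug_zero f _ (s₀, 0, a₀) (ht0 _ _) (fun c p => (s₀, c • (p.2.1 - t₀), p.2.2))
      (fun c => ?_) fun c τ => (plug_smul_mid f c _ _ _).symm
    have : Continuous fun p : E × E × A => (s₀, c • (p.2.1 - t₀), p.2.2) := by fun_prop
    simpa using this.tendsto (s₀, t₀, a₀)
  have h3 : Filter.Tendsto (fun p : E × E × A => plug f s₀ t₀ (p.2.2 - a₀))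
      (nhds (s₀, t₀, a₀)) (nhds 0) := by
    refine tendsto_plug_zero f _ (s₀, t₀, 0) (ha0 _ _) (fun c p => (s₀, t₀, c • (p.2.2 - a₀)))
      (fun c => ?_) fun c τ => (plug_smul_right f c _ _ _).symm
    have : Continuous fun p : E × E × A => (s₀, t₀, c • (p.2.2 - a₀)) := by fun_prop
    simpa using this.tendsto (s₀, t₀, a₀)
  have h := ((h1.add h2).add h3).add_const (plug f s₀ t₀ a₀)
  rw [add_zero, add_zero, zero_add] at h
  refine h.congr fun p => ?_
  have e1 := plug_add_left f (p.1 - s₀) s₀ p.2.1 p.2.2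
  have e2 := plug_add_mid f s₀ (p.2.1 - t₀) t₀ p.2.2
  have e3 := plug_add_right f s₀ t₀ (p.2.2 - a₀) a₀
  rw [sub_add_cancel] at e1 e2 e3
  rw [e1, e2, e3]
  abel

open scoped ComplexOrder in
instance multiFun_polynormable [PolynormableSpace 𝕜 A] (n : ℕ) :
    PolynormableSpace 𝕜 (MultiFun 𝕜 E A (Fin n)) := by
  let : Module ℝ A := Module.compHom A (algebraMap ℝ 𝕜)
  have hr : ∀ (r : ℝ) (a : A), r • a = (algebraMap ℝ 𝕜 r) • a := fun _ _ => rfl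
  have : IsScalarTower ℝ 𝕜 A := ⟨fun r c a => by
    rw [hr, smul_smul, Algebra.smul_def r c]⟩
  have : SMulCommClass 𝕜 ℝ A := ⟨fun c r a => by rw [hr, hr, smul_comm]⟩
  have : LocallyConvexSpace ℝ A := (PolynormableSpace.withSeminorms 𝕜 A).toLocallyConvexSpace
  have : ContinuousSMul ℝ A := ⟨by
    have : Continuous fun p : ℝ × A => (algebraMap ℝ 𝕜 p.1) • p.2 := by
      have h := (RCLike.continuous_ofReal (K := 𝕜))
      exact (h.comp continuous_fst).smul continuous_snd
    exact this⟩
  have : IsScalarTower ℝ 𝕜 (MultiFun 𝕜 E A (Fin n)) := ⟨fun r c f => by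
    ext x
    simp⟩
  have : LocallyConvexSpace 𝕜 (MultiFun 𝕜 E A (Fin n)) := by
    refine LocallyConvexSpace.ofBasisZero _ _ _ _
      (ContinuousMultilinearMap.hasBasis_nhds_zero_of_basis
        (LocallyConvexSpace.convex_basis_zero ℝ A)) ?_
    rintro ⟨S, V⟩ ⟨_, _, hV⟩ f hf g hg a b ha hb hab x hx
    have hV' : Convex 𝕜 V := convex_of_nonneg_surjective_algebraMap _
        (fun _ => RCLike.nonneg_iff_exists_ofReal.mp) hV
    exact hV' (hf hx) (hg hx) ha hb hab
  have : ContinuousSMul ℝ (MultiFun 𝕜 E A (Fin n)) := IsScalarTower.continuousSMul 𝕜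
  exact LocallyConvexSpace.toPolynormableSpace

variable [FirstCountableTopology E] [PolynormableSpace 𝕜 A] [T2Space A] [CompleteSpace A]

/-- Contraction of the last two arguments of `f` with `P ∈ E ⊗̂ E ⊗̂ A`; for `P = s ⊗ t ⊗ a` the
result is `x ↦ f (x, s, t) · a`. -/
def contract {n : ℕ} (P : CTensor 𝕜 E E A) (f : MultiFun 𝕜 E A (Fin (n + 2))) :
    MultiFun 𝕜 E A (Fin n) :=
  CTensor.lift 𝕜 (plugLin f) (by simpa only [plugLin_pure] using continuous_plug f) P

theorem contract_pure {n : ℕ} (s t : E) (a : A) (f : MultiFun 𝕜 E A (Fin (n + 2))) :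
    contract (toCTensor 𝕜 E E A (pureTensor 𝕜 s t a)) f = plug f s t a := by
  rw [contract, CTensor.lift_coe, plugLin_pure]

end Contraction
end Functionals

section Grading

/-- A `ℤ`-grading of a topological vector space with finitely many nonzero homogeneous components,
given by the continuous projections onto these components. -/
structure FinGrading (𝕜 V : Type*) [RCLike 𝕜] [AddCommGroup V] [Module 𝕜 V]
    [TopologicalSpace V] where
  degs : Finset ℤ
  proj : ℤ → V →L[𝕜] V
  proj_proj : ∀ i j x, proj i (proj j x) = if i = j then proj j x else 0
  proj_of_notMem : ∀ i, i ∉ degs → ∀ x, proj i x = 0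
  sum_proj : ∀ x, ∑ i ∈ degs, proj i x = x

variable {𝕜 V : Type*} [RCLike 𝕜] [AddCommGroup V] [Module 𝕜 V] [TopologicalSpace V]

/-- `x` is homogeneous of degree `i`. -/
def FinGrading.IsHomog (g : FinGrading 𝕜 V) (i : ℤ) (x : V) : Prop := g.proj i x = x

variable [IsTopologicalAddGroup V]

/-- The projection onto the part of parity `ε`. -/
def FinGrading.par (g : FinGrading 𝕜 V) (ε : ZMod 2) : V →L[𝕜] V :=
  ∑ i ∈ g.degs.filter fun i : ℤ => (i : ZMod 2) = ε, g.proj i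

theorem FinGrading.par_par (g : FinGrading 𝕜 V) (ε ε' : ZMod 2) (x : V) :
    g.par ε (g.par ε' x) = if ε = ε' then g.par ε x else 0 := by
  simp only [FinGrading.par, sum_apply, map_sum, g.proj_proj]
  by_cases h : ε = ε'
  · subst h
    rw [if_pos rfl]
    refine Finset.sum_congr rfl fun i hi => ?_
    rw [Finset.sum_ite_eq']
    simp [hi]
  · rw [if_neg h]
    refine Finset.sum_eq_zero fun i hi => Finset.sum_eq_zero fun j hj => ?_
    rw [if_neg]
    rintro rfl
    simp only [Finset.mem_filter] at hi hj
    exact h (hi.2 ▸ hj.2 ▸ rfl)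

theorem FinGrading.sum_par (g : FinGrading 𝕜 V) (x : V) : ∑ ε, g.par ε x = x := by
  simp only [FinGrading.par, sum_apply]
  rw [Finset.sum_fiberwise (s := g.degs) (g := fun i : ℤ => (i : ZMod 2))
    (f := fun i => g.proj i x)]
  exact g.sum_proj x

/-- Compatibility of a grading with the algebra structure: `A` is a graded algebra that is
commutative in the graded sense, `a b = (-1)^(|a||b|) b a`. -/
structure FinGrading.IsGradedCommAlgebra {A : Type*} [Ring A] [Algebra 𝕜 A] [TopologicalSpace A]
    (g : FinGrading 𝕜 A) : Prop where
  one_homog : g.IsHomog 0 1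
  mul_homog : ∀ i j a b, g.IsHomog i a → g.IsHomog j b → g.IsHomog (i + j) (a * b)
  mul_comm : ∀ i j a b, g.IsHomog i a → g.IsHomog j b →
    a * b = ((i * j).negOnePow : ℤ) • (b * a)

end Grading

section Koszul

/-- The Koszul sign of moving homogeneous factors from the order of `ι` to the order of `κ` along
`e`: a factor `-1` for every inverted pair of odd factors. The parity of the factor with label
`k : κ` is `δ k`. -/
def koszulSign {ι κ : Type*} [Fintype ι] [LinearOrder ι] [LinearOrder κ] (e : ι ≃ κ)
    (δ : κ → ZMod 2) : ℤ :=
  ∏ i, ∏ j, if i < j ∧ e j < e i ∧ δ (e i) = 1 ∧ δ (e j) = 1 then -1 else 1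

theorem prod_pairs {ι : Type*} [Fintype ι] [LinearOrder ι] (C : ι → ι → ℤ) (h : ∀ i, C i i = 1) :
    ∏ i, ∏ j, C i j = ∏ i, ∏ j, if i < j then C i j * C j i else 1 := by
  have h1 : ∀ i j, (if i < j then C i j * C j i else 1) =
      (if i < j then C i j else 1) * (if i < j then C j i else 1) := by
    intro i j; split_ifs <;> simp
  simp only [h1, Finset.prod_mul_distrib]
  conv_rhs => rw [Finset.prod_comm (f := fun i j => if i < j then C j i else 1)]
  simp only [← Finset.prod_mul_distrib]
  refine Finset.prod_congr rfl fun i _ => Finset.prod_congr rfl fun j _ => ?_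
  rcases lt_trichotomy i j with hij | rfl | hij
  · simp [hij, hij.not_gt]
  · simp [h]
  · simp [hij, hij.not_gt]

theorem koszulSign_trans {ι κ μ : Type*} [Fintype ι] [LinearOrder ι] [Fintype κ] [LinearOrder κ]
    [LinearOrder μ] (e : ι ≃ κ) (e' : κ ≃ μ) (δ : μ → ZMod 2) :
    koszulSign (e.trans e') δ = koszulSign e' δ * koszulSign e (δ ∘ e') := by
  have h : koszulSign e' δ = ∏ i, ∏ j, if e i < e j ∧ e' (e j) < e' (e i) ∧
      δ (e' (e i)) = 1 ∧ δ (e' (e j)) = 1 then -1 else 1 := by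
    unfold koszulSign
    rw [← e.prod_comp]
    refine Finset.prod_congr rfl fun i _ => ?_
    rw [← e.prod_comp]
  rw [h, prod_pairs _ (by simp)]
  unfold koszulSign
  simp only [← Finset.prod_mul_distrib, Equiv.trans_apply, Function.comp]
  refine Finset.prod_congr rfl fun i _ => Finset.prod_congr rfl fun j _ => ?_
  by_cases hij : i < j
  · have h1 : e i ≠ e j := e.injective.ne hij.ne
    have h2 : e' (e i) ≠ e' (e j) := e'.injective.ne h1
    by_cases o1 : δ (e' (e i)) = 1 <;> by_cases o2 : δ (e' (e j)) = 1 <;>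
      rcases lt_or_gt_of_ne h1 with h1 | h1 <;> rcases lt_or_gt_of_ne h2 with h2 | h2 <;>
      simp [hij, o1, o2, h1, h2, h1.not_gt, h2.not_gt]
  · simp [hij]

variable {𝕜 E A : Type*} [RCLike 𝕜]
  [AddCommGroup E] [Module 𝕜 E] [TopologicalSpace E] [IsTopologicalAddGroup E]
  [Ring A] [Algebra 𝕜 A] [UniformSpace A] [IsUniformAddGroup A] [ContinuousSMul 𝕜 A]

/-- Transport of functionals along a bijection `e` of finite ordered sets, with Koszul signs: for
homogeneous arguments `(transport e f) (y) = ± f (y ∘ e)`. -/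
def transport (g : FinGrading 𝕜 E) {ι κ : Type*} [Fintype ι] [LinearOrder ι] [Fintype κ]
    [LinearOrder κ] (e : ι ≃ κ) : MultiFun 𝕜 E A ι →ₗ[𝕜] MultiFun 𝕜 E A κ where
  toFun f := ∑ δ : κ → ZMod 2, koszulSign e δ •
    (f.domDomCongr e).compContinuousLinearMap fun k => g.par (δ k)
  map_add' f f' := by
    ext x
    simp [Finset.sum_add_distrib]
  map_smul' c f := by
    ext x
    simp only [RingHom.id_apply, sum_apply, smul_apply,
      ContinuousMultilinearMap.compContinuousLinearMap_apply, Finset.smul_sum,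
      ContinuousMultilinearMap.domDomCongr_apply]
    exact Finset.sum_congr rfl fun δ _ => smul_comm _ _ _

theorem transport_apply (g : FinGrading 𝕜 E) {ι κ : Type*} [Fintype ι] [LinearOrder ι] [Fintype κ]
    [LinearOrder κ] (e : ι ≃ κ) (f : MultiFun 𝕜 E A ι) (y : κ → E) :
    transport g e f y =
      ∑ δ : κ → ZMod 2, koszulSign e δ • f fun i => g.par (δ (e i)) (y (e i)) := by
  simp [transport]

theorem transport_refl (g : FinGrading 𝕜 E) {ι : Type*} [Fintype ι] [LinearOrder ι]
    (f : MultiFun 𝕜 E A ι) : transport g (Equiv.refl ι) f = f := by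
  ext y
  rw [transport_apply]
  have h : ∀ δ : ι → ZMod 2, koszulSign (Equiv.refl ι) δ = 1 := fun δ => by
    unfold koszulSign
    refine Finset.prod_eq_one fun i _ => Finset.prod_eq_one fun j _ => ?_
    rw [if_neg]
    rintro ⟨h1, h2, _⟩
    exact absurd h1 (not_lt.mpr h2.le)
  simp only [h, one_smul, Equiv.refl_apply]
  rw [← f.map_sum (fun k ε => g.par ε (y k))]
  simp only [g.sum_par]

theorem transport_trans (g : FinGrading 𝕜 E) {ι κ μ : Type*} [Fintype ι] [LinearOrder ι]
    [Fintype κ] [LinearOrder κ] [Fintype μ] [LinearOrder μ] (e : ι ≃ κ) (e' : κ ≃ μ)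
    (f : MultiFun 𝕜 E A ι) : transport g (e.trans e') f = transport g e' (transport g e f) := by
  ext z
  simp only [transport_apply]
  refine Finset.sum_congr rfl fun δ _ => ?_
  rw [Finset.sum_eq_single (δ ∘ e')]
  · rw [koszulSign_trans, mul_smul]
    simp [g.par_par]
  · intro δ' _ hne
    obtain ⟨k, hk⟩ := Function.ne_iff.mp hne
    rw [f.map_coord_zero (e.symm k), smul_zero]
    rw [g.par_par, if_neg]
    simpa using hk
  · simp

end Koszul

section Spaces
variable {𝕜 E : Type*} [RCLike 𝕜]
  [AddCommGroup E] [Module 𝕜 E] [TopologicalSpace E] [IsTopologicalAddGroup E]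
  (g : FinGrading 𝕜 E) (A : Type*)
  [Ring A] [Algebra 𝕜 A] [UniformSpace A] [IsUniformAddGroup A] [ContinuousSMul 𝕜 A]

/-- The span of all `σ · f - f`, where the symmetric group acts with Koszul signs. -/
def symRel (n : ℕ) : Submodule 𝕜 (MultiFun 𝕜 E A (Fin n)) :=
  Submodule.span 𝕜 {w | ∃ (σ : Equiv.Perm (Fin n)) (f : _), w = transport g σ f - f}

/-- The coinvariants of the symmetric group `S_n` on functionals of order `n`. -/
abbrev SymFun (n : ℕ) : Type _ := MultiFun 𝕜 E A (Fin n) ⧸ symRel g A n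

/-- The number of cycles of a permutation, fixed points included. -/
def numCycles {α : Type*} (c : Equiv.Perm α) : ℕ :=
  Nat.card (Quotient (Equiv.Perm.SameCycle.setoid c))

/-- The cyclic decompositions of `{1, …, l}` into `k` cycles. -/
abbrev CycDecomp (k l : ℕ) : Type := {c : Equiv.Perm (Fin l) // numCycles c = k}

/-- The relations `(φ c φ⁻¹, φ · f) = (c, f)` for permutations `φ`. -/
def cycRel (k l : ℕ) : Submodule 𝕜 (CycDecomp k l → MultiFun 𝕜 E A (Fin l)) :=
  Submodule.span 𝕜 {w | ∃ (c c' : CycDecomp k l) (φ : Equiv.Perm (Fin l))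
    (f : MultiFun 𝕜 E A (Fin l)), φ.permCongr c.1 = c'.1 ∧
      w = Pi.single c' (transport g φ f) - Pi.single c f}

/-- Let `K₊` be the product over all `n ≥ 1` of the cyclic coinvariants of functionals of order `n`.
`CycFun gE A k l` is the part of order `l` of `[K₊^{⊗ k}]_{S_k}` (with values in `A`), spanned by the
products of `k` cyclic words with altogether `l` letters. It is described as the coinvariants of `S_l`
on pairs of a functional of order `l` and a decomposition of its arguments into `k` cycles. -/
abbrev CycFun (k l : ℕ) : Type _ := (CycDecomp k l → MultiFun 𝕜 E A (Fin l)) ⧸ cycRel g A k l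

variable {A}

/-- The class of a functional in the symmetric coinvariants. -/
def symClass {n : ℕ} (f : MultiFun 𝕜 E A (Fin n)) : SymFun g A n := (symRel g A n).mkQ f

/-- The product of cyclic words given by a functional of its arguments and a decomposition `c` of these
into cycles. -/
def cycClass {l : ℕ} (c : Equiv.Perm (Fin l)) (f : MultiFun 𝕜 E A (Fin l)) :
    CycFun g A (numCycles c) l :=
  (cycRel g A (numCycles c) l).mkQ (Pi.single ⟨c, rfl⟩ f)

/-- Attaching a symmetric functional to a set `X`: the class of `f` is sent to the sum of the transports
of `f` along all bijections `{1, …, n} ≃ X`; it is zero if there are none. -/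
def attachSym {X : Type*} [Fintype X] [LinearOrder X] (n : ℕ) :
    SymFun g A n →ₗ[𝕜] MultiFun 𝕜 E A X :=
  (symRel g A n).liftQ (∑ φ : Fin n ≃ X, transport g φ) <| by
    rw [symRel, Submodule.span_le]
    rintro _ ⟨σ, f, rfl⟩
    simp only [SetLike.mem_coe, LinearMap.mem_ker, map_sub, sub_eq_zero, LinearMap.sum_apply,
      ← transport_trans]
    exact (Equiv.equivCongr σ.symm (Equiv.refl X)).sum_comp (fun φ => transport g φ f)

open scoped Classical in
/-- Attaching a product of cyclic words to a set `X` with a cyclic decomposition `cX`: the class of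
`(c, f)` is sent to the sum of the transports of `f` along all bijections `{1, …, l} ≃ X` that carry
`c` to `cX`. -/
def attachCyc {X : Type*} [Fintype X] [LinearOrder X] (cX : Equiv.Perm X) (k l : ℕ) :
    CycFun g A k l →ₗ[𝕜] MultiFun 𝕜 E A X :=
  (cycRel g A k l).liftQ
    (∑ c : CycDecomp k l, ∑ φ : Fin l ≃ X,
      if φ.permCongr c.1 = cX then (transport g φ).comp (LinearMap.proj c) else 0) <| by
    rw [cycRel, Submodule.span_le]
    rintro _ ⟨c, c', φ, f, h, rfl⟩
    simp only [SetLike.mem_coe, LinearMap.mem_ker, map_sub, sub_eq_zero, LinearMap.sum_apply]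
    have key : ∀ (d : CycDecomp k l) (f : MultiFun 𝕜 E A (Fin l)),
        (∑ c : CycDecomp k l, ∑ φ : Fin l ≃ X,
          (if φ.permCongr c.1 = cX then (transport g φ).comp (LinearMap.proj c) else 0 :
            (CycDecomp k l → MultiFun 𝕜 E A (Fin l)) →ₗ[𝕜] MultiFun 𝕜 E A X) (Pi.single d f)) =
        ∑ φ : Fin l ≃ X, if φ.permCongr d.1 = cX then transport g φ f else 0 := by
      intro d f
      rw [Finset.sum_eq_single d]
      · refine Finset.sum_congr rfl fun φ _ => ?_
        split_ifs <;> simp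
      · intro c _ hc
        refine Finset.sum_eq_zero fun φ _ => ?_
        split_ifs <;> simp [Pi.single_eq_of_ne hc]
      · simp
    rw [key, key, ← (Equiv.equivCongr φ (Equiv.refl X)).sum_comp]
    refine Finset.sum_congr rfl fun ψ _ => ?_
    have e0 : φ.trans (Equiv.equivCongr φ (Equiv.refl X) ψ) = ψ := by
      ext x
      simp [Equiv.equivCongr]
    have e1 : (Equiv.equivCongr φ (Equiv.refl X) ψ).permCongr c'.1 = ψ.permCongr c.1 := by
      have e2 : ∀ ψ' : Fin l ≃ X, ψ'.permCongr (φ.permCongr c.1) = (φ.trans ψ').permCongr c.1 :=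
        fun ψ' => by ext x; simp [Equiv.permCongr_apply]
      rw [← h, e2, e0]
    have e2 : transport g (Equiv.equivCongr φ (Equiv.refl X) ψ) (transport g φ f) =
        transport g ψ f := by
      rw [← transport_trans, e0]
    rw [e1, e2]

/-- Passing from cyclic to symmetric coinvariants: products of cyclic words are sent to the products of
their symmetrizations. -/
def cycToSym (k l : ℕ) : CycFun g A k l →ₗ[𝕜] SymFun g A l :=
  (cycRel g A k l).liftQ ((symRel g A l).mkQ ∘ₗ ∑ c : CycDecomp k l, LinearMap.proj c) <| by
    rw [cycRel, Submodule.span_le]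
    rintro _ ⟨c, c', φ, f, -, rfl⟩
    have key : ∀ (d : CycDecomp k l) (f : MultiFun 𝕜 E A (Fin l)),
        (∑ c : CycDecomp k l, (LinearMap.proj c :
          (CycDecomp k l → MultiFun 𝕜 E A (Fin l)) →ₗ[𝕜] MultiFun 𝕜 E A (Fin l)))
          (Pi.single d f) = f := by
      intro d f
      simp [LinearMap.sum_apply]
    simp only [SetLike.mem_coe, LinearMap.mem_ker, LinearMap.comp_apply, map_sub]
    rw [key, key, ← map_sub, Submodule.mkQ_apply, Submodule.Quotient.mk_eq_zero]
    exact Submodule.subset_span ⟨φ, f, rfl⟩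

theorem cycToSym_cycClass {l : ℕ} (c : Equiv.Perm (Fin l)) (f : MultiFun 𝕜 E A (Fin l)) :
    cycToSym g (numCycles c) l (cycClass g c f) = symClass g f := by
  simp [cycToSym, cycClass, symClass]
end Spaces

section Combinatorics

/-- A finite graph with legs: half-edges `Fin n`, vertices `Fin m`, the incidence map `ρ` and the
involution `κ`, whose fixed points are the legs and whose two-element orbits are the edges. -/
structure HalfEdgeGraph where
  n : ℕ
  m : ℕ
  ρ : Fin n → Fin m
  κ : Equiv.Perm (Fin n)
  κ_κ : ∀ h, κ (κ h) = h

namespace HalfEdgeGraph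

variable (Γ : HalfEdgeGraph)

/-- The half-edges incident to the vertex `v`. -/
abbrev Fiber (v : Fin Γ.m) : Type := {h : Fin Γ.n // Γ.ρ h = v}

/-- The number of half-edges at `v`. -/
def valency (v : Fin Γ.m) : ℕ := Fintype.card (Γ.Fiber v)

/-- The legs: the fixed points of the involution. -/
abbrev Leg : Type := {h : Fin Γ.n // Γ.κ h = h}

/-- The edges; the edge `{h, κ h}` is represented by the smaller one of its half-edges. -/
abbrev Edge : Type := {h : Fin Γ.n // h < Γ.κ h}

/-- The number of legs. -/
def numLegs : ℕ := Fintype.card Γ.Leg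

/-- The number of edges. -/
def numEdges : ℕ := Fintype.card Γ.Edge

/-- The number of connected components. -/
def numComponents : ℕ :=
  Nat.card (Quot fun v w : Fin Γ.m => ∃ h, Γ.ρ h = v ∧ Γ.ρ (Γ.κ h) = w)

/-- A graph is connected if it has precisely one component; the empty graph is not connected. -/
def Connected : Prop := Γ.numComponents = 1

/-- The first Betti number. -/
def betti : ℤ := Γ.numEdges - Γ.m + Γ.numComponents

/-- The half-edges are the legs together with two half-edges `h`, `κ h` for every edge. -/
def halfEdgeEquiv : Γ.Leg ⊕ Γ.Edge × Fin 2 ≃ Fin Γ.n where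
  toFun := Sum.elim (fun ℓ => ℓ.1) fun e => if e.2 = 0 then e.1.1 else Γ.κ e.1.1
  invFun h :=
    if h0 : Γ.κ h = h then Sum.inl ⟨h, h0⟩
    else if h1 : h < Γ.κ h then Sum.inr (⟨h, h1⟩, 0)
    else Sum.inr (⟨Γ.κ h, by
      rw [Γ.κ_κ]; exact lt_of_le_of_ne (not_lt.mp h1) h0⟩, 1)
  left_inv x := by
    rcases x with ⟨h, hh⟩ | ⟨⟨h, hh⟩, i⟩
    · simp [hh]
    · fin_cases i
      · simp [hh, hh.ne']
      · simp [Γ.κ_κ, hh.ne, hh.not_gt]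
  right_inv h := by
    by_cases h0 : Γ.κ h = h
    · simp [h0]
    · by_cases h1 : h < Γ.κ h
      · simp [h0, h1]
      · simp [h0, h1, Γ.κ_κ]

/-- A numbering of the legs. -/
def legNumbering : Fin Γ.numLegs ≃ Γ.Leg := (Fintype.equivFin Γ.Leg).symm

/-- A numbering of the edges. -/
def edgeNumbering : Fin Γ.numEdges ≃ Γ.Edge := (Fintype.equivFin Γ.Edge).symm

/-- The numbering of all half-edges in which the legs come first, followed by the pairs of
half-edges that form the edges. -/
def numbering : Fin (Γ.numLegs + 2 * Γ.numEdges) ≃ Fin Γ.n :=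
  finSumFinEquiv.symm.trans <|
    (Equiv.sumCongr Γ.legNumbering <|
      (finCongr (Nat.mul_comm 2 Γ.numEdges)).trans <|
        finProdFinEquiv.symm.trans <| Equiv.prodCongr Γ.edgeNumbering (Equiv.refl (Fin 2))).trans
      Γ.halfEdgeEquiv

/-- The permutation of the half-edges at `v` induced by a permutation `c` that preserves the
vertices. -/
def vertexPerm (c : Equiv.Perm (Fin Γ.n)) (hc : ∀ h, Γ.ρ (c h) = Γ.ρ h) (v : Fin Γ.m) :
    Equiv.Perm (Γ.Fiber v) :=
  c.subtypePerm fun h => by rw [hc]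

end HalfEdgeGraph

/-- A stable graph: `loop v` is the loop number of the vertex `v`. -/
structure StableGraph extends HalfEdgeGraph where
  loop : Fin m → ℕ
  stable : ∀ v, 3 ≤ 2 * loop v + toHalfEdgeGraph.valency v

namespace StableGraph

/-- The loop number of a stable graph. -/
def loopNumber (Γ : StableGraph) : ℤ := Γ.betti + ∑ v, (Γ.loop v : ℤ)

/-- Isomorphisms of stable graphs. -/
@[ext]
structure Iso (Γ Γ' : StableGraph) where
  half : Fin Γ.n ≃ Fin Γ'.n
  vert : Fin Γ.m ≃ Fin Γ'.m
  map_ρ : ∀ h, Γ'.ρ (half h) = vert (Γ.ρ h)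
  map_κ : ∀ h, Γ'.κ (half h) = half (Γ.κ h)
  map_loop : ∀ v, Γ'.loop (vert v) = Γ.loop v

/-- The order of the automorphism group. -/
def numAut (Γ : StableGraph) : ℕ := Nat.card (Iso Γ Γ)

instance setoid : Setoid StableGraph where
  r Γ Γ' := Nonempty (Iso Γ Γ')
  iseqv :=
    { refl := fun Γ => ⟨⟨Equiv.refl _, Equiv.refl _, fun _ => rfl, fun _ => rfl, fun _ => rfl⟩⟩
      symm := fun ⟨f⟩ => ⟨⟨f.half.symm, f.vert.symm,
        fun h => by rw [Equiv.eq_symm_apply, ← f.map_ρ, Equiv.apply_symm_apply],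
        fun h => by rw [Equiv.eq_symm_apply, ← f.map_κ, Equiv.apply_symm_apply],
        fun v => by rw [← f.map_loop, Equiv.apply_symm_apply]⟩⟩
      trans := fun ⟨f⟩ ⟨f'⟩ => ⟨⟨f.half.trans f'.half, f.vert.trans f'.vert,
        fun h => by simp [f.map_ρ, f'.map_ρ], fun h => by simp [f.map_κ, f'.map_κ],
        fun v => by simp [f.map_loop, f'.map_loop]⟩⟩ }

end StableGraph

/-- Remove `h` from its cycle: `h` becomes a fixed point and its predecessor is sent to its
successor. -/
def spliceOut {α : Type*} [DecidableEq α] (π : Equiv.Perm α) (h : α) : Equiv.Perm α :=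
  Equiv.swap h (π h) * π

/-- The effect of contracting the edge `{h, h'}` on cyclic decompositions. If `h` and `h'` lie in
distinct cycles `(h a₁ … aᵣ)` and `(h' b₁ … bₛ)`, these are joined to `(b₁ … bₛ a₁ … aᵣ)`; if they
lie in the same cycle `(h a₁ … aᵣ h' b₁ … bₛ)`, it is split into `(a₁ … aᵣ)` and `(b₁ … bₛ)`. The
half-edges `h` and `h'` themselves become fixed points. -/
def contractPair {α : Type*} [DecidableEq α] (c : Equiv.Perm α) (h h' : α) : Equiv.Perm α :=
  spliceOut (spliceOut (c * Equiv.swap h h') h) h'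

theorem spliceOut_self {α : Type*} [DecidableEq α] (π : Equiv.Perm α) (h : α) :
    spliceOut π h h = h := by
  simp [spliceOut]

theorem spliceOut_of_fixed {α : Type*} [DecidableEq α] (π : Equiv.Perm α) (h : α) {x : α}
    (hx : π x = x) : spliceOut π h x = x := by
  rcases eq_or_ne x h with rfl | hne
  · exact spliceOut_self π x
  · rw [spliceOut, Equiv.Perm.mul_apply, hx]
    refine Equiv.swap_apply_of_ne_of_ne hne fun h' => hne ?_
    exact π.injective (hx.trans h')

theorem contractPair_fixed {α : Type*} [DecidableEq α] (c : Equiv.Perm α) (h h' : α) {x : α}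
    (hx : x = h ∨ x = h' ∨ c x = x) : contractPair c h h' x = x := by
  rcases hx with rfl | rfl | hx
  · exact spliceOut_of_fixed _ _ (spliceOut_self _ _)
  · exact spliceOut_self _ _
  · by_cases h1 : x = h
    · subst h1; exact spliceOut_of_fixed _ _ (spliceOut_self _ _)
    by_cases h2 : x = h'
    · subst h2; exact spliceOut_self _ _
    refine spliceOut_of_fixed _ _ (spliceOut_of_fixed _ _ ?_)
    rw [Equiv.Perm.mul_apply, Equiv.swap_apply_of_ne_of_ne h1 h2, hx]

/-- A stable ribbon graph: the cycles of the permutation `c` are the cyclically ordered sets of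
half-edges at the vertices, `gen v` and `bdry v` are the genus and the boundary of the vertex
`v`. -/
structure RibbonGraph extends HalfEdgeGraph where
  c : Equiv.Perm (Fin n)
  ρ_c : ∀ h, ρ (c h) = ρ h
  gen : Fin m → ℕ
  bdry : Fin m → ℕ
  pos : ∀ v, 0 < numCycles (toHalfEdgeGraph.vertexPerm c ρ_c v) + bdry v
  stable : ∀ v, (3 : ℤ) ≤ 2 * (2 * gen v + bdry v +
    numCycles (toHalfEdgeGraph.vertexPerm c ρ_c v) - 1) + toHalfEdgeGraph.valency v

namespace RibbonGraph

variable (Γ : RibbonGraph)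

/-- The cyclic decomposition of the half-edges at the vertex `v`. -/
def cyc (v : Fin Γ.m) : Equiv.Perm (Γ.Fiber v) := Γ.vertexPerm Γ.c Γ.ρ_c v

/-- The cyclic decomposition that results from contracting all edges of `Γ`, one after the other;
the half-edges that belong to edges have become fixed points. -/
def contractedPerm : Equiv.Perm (Fin Γ.n) :=
  ((List.finRange Γ.n).filter fun h => h < Γ.κ h).foldl (fun π h => contractPair π h (Γ.κ h)) Γ.c

theorem contractedPerm_fixed {h : Fin Γ.n} (hh : Γ.κ h ≠ h) : Γ.contractedPerm h = h := by
  have key : ∀ (L : List (Fin Γ.n)) (π : Equiv.Perm (Fin Γ.n)) (x : Fin Γ.n),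
      (π x = x ∨ x ∈ L ∨ Γ.κ x ∈ L) →
      L.foldl (fun π h => contractPair π h (Γ.κ h)) π x = x := by
    intro L
    induction L with
    | nil => intro π x hx; simpa using hx
    | cons a L ih =>
      intro π x hx
      rw [List.foldl_cons]
      apply ih
      rcases hx with hx | hx | hx
      · exact Or.inl (contractPair_fixed _ _ _ (Or.inr (Or.inr hx)))
      · rcases List.mem_cons.mp hx with rfl | hx
        · exact Or.inl (contractPair_fixed _ _ _ (Or.inl rfl))
        · exact Or.inr (Or.inl hx)
      · rcases List.mem_cons.mp hx with hx | hx
        · refine Or.inl (contractPair_fixed _ _ _ (Or.inr (Or.inl ?_)))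
          rw [← hx, Γ.κ_κ]
        · exact Or.inr (Or.inr hx)
  refine key _ _ _ (Or.inr ?_)
  simp only [List.mem_filter, List.mem_finRange, true_and, decide_eq_true_eq, Γ.κ_κ]
  exact lt_or_gt_of_ne hh.symm

/-- The canonical cyclic decomposition of the legs, arising from contracting all edges. -/
def legPerm : Equiv.Perm Γ.Leg :=
  Γ.contractedPerm.subtypePerm fun h => by
    constructor
    · intro h1
      by_contra h2
      rw [Γ.contractedPerm_fixed h2] at h1
      exact h2 h1
    · intro h1
      by_contra h2
      have h3 := Γ.contractedPerm.injective (Γ.contractedPerm_fixed h2)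
      rw [h3] at h2
      exact h2 h1

/-- The genus of a connected stable ribbon graph. -/
def genus : ℚ :=
  1 - Γ.m + (Γ.numEdges + numCycles Γ.c - numCycles (Γ.c * Γ.κ)) / 2 + ∑ v, (Γ.gen v : ℚ)

/-- The total number of boundary components of a connected stable ribbon graph. -/
def totalBoundary : ℕ := numCycles (Γ.c * Γ.κ) + ∑ v, Γ.bdry v

/-- The number of boundary components without legs: the total number of boundary components minus
the number of cycles in the canonical decomposition of the legs. -/
def freeBoundary : ℤ := Γ.totalBoundary - numCycles Γ.legPerm

/-- Isomorphisms of stable ribbon graphs. -/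
@[ext]
structure Iso (Γ Γ' : RibbonGraph) where
  half : Fin Γ.n ≃ Fin Γ'.n
  vert : Fin Γ.m ≃ Fin Γ'.m
  map_ρ : ∀ h, Γ'.ρ (half h) = vert (Γ.ρ h)
  map_κ : ∀ h, Γ'.κ (half h) = half (Γ.κ h)
  map_c : ∀ h, Γ'.c (half h) = half (Γ.c h)
  map_gen : ∀ v, Γ'.gen (vert v) = Γ.gen v
  map_bdry : ∀ v, Γ'.bdry (vert v) = Γ.bdry v

/-- The order of the automorphism group. -/
def numAut : ℕ := Nat.card (Iso Γ Γ)

instance setoid : Setoid RibbonGraph where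
  r Γ Γ' := Nonempty (Iso Γ Γ')
  iseqv :=
    { refl := fun Γ => ⟨⟨Equiv.refl _, Equiv.refl _, fun _ => rfl, fun _ => rfl, fun _ => rfl,
        fun _ => rfl, fun _ => rfl⟩⟩
      symm := fun ⟨f⟩ => ⟨⟨f.half.symm, f.vert.symm,
        fun h => by rw [Equiv.eq_symm_apply, ← f.map_ρ, Equiv.apply_symm_apply],
        fun h => by rw [Equiv.eq_symm_apply, ← f.map_κ, Equiv.apply_symm_apply],
        fun h => by rw [Equiv.eq_symm_apply, ← f.map_c, Equiv.apply_symm_apply],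
        fun v => by rw [← f.map_gen, Equiv.apply_symm_apply],
        fun v => by rw [← f.map_bdry, Equiv.apply_symm_apply]⟩⟩
      trans := fun ⟨f⟩ ⟨f'⟩ => ⟨⟨f.half.trans f'.half, f.vert.trans f'.vert,
        fun h => by simp [f.map_ρ, f'.map_ρ], fun h => by simp [f.map_κ, f'.map_κ],
        fun h => by simp [f.map_c, f'.map_c], fun v => by simp [f.map_gen, f'.map_gen],
        fun v => by simp [f.map_bdry, f'.map_bdry]⟩⟩ }

end RibbonGraph

end Combinatorics

section Amplitudes

variable {𝕜 E A : Type*} [RCLike 𝕜]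
  [AddCommGroup E] [Module 𝕜 E] [TopologicalSpace E] [IsTopologicalAddGroup E]
  [ContinuousSMul 𝕜 E] [FirstCountableTopology E]
  [Ring A] [Algebra 𝕜 A] [UniformSpace A] [IsUniformAddGroup A] [ContinuousSMul 𝕜 A]
  [ContinuousMul A] [PolynormableSpace 𝕜 A] [T2Space A] [CompleteSpace A]

theorem vertexTensor_aux (Γ : HalfEdgeGraph) (F : ∀ v, MultiFun 𝕜 E A (Γ.Fiber v))
    [DecidableEq (Σₗ v : Fin Γ.m, Γ.Fiber v)] (x : (Σₗ v : Fin Γ.m, Γ.Fiber v) → E)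
    (v₀ : Fin Γ.m) (h₀ : Γ.Fiber v₀) (a : E) :
    (fun v => F v fun h => Function.update x (toLex ⟨v₀, h₀⟩) a (toLex ⟨v, h⟩)) =
      Function.update (fun v => F v fun h => x (toLex ⟨v, h⟩)) v₀
        (F v₀ (Function.update (fun h => x (toLex ⟨v₀, h⟩)) h₀ a)) := by
  funext v
  rcases eq_or_ne v v₀ with rfl | hv
  · rw [Function.update_self]
    congr 1
    funext h
    rcases eq_or_ne h h₀ with rfl | hh
    · simp
    · rw [Function.update_of_ne hh, Function.update_of_ne]
      intro heq
      have := toLex.injective heq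
      simp only [Sigma.mk.injEq, heq_eq_eq, true_and] at this
      exact hh this
  · rw [Function.update_of_ne hv]
    congr 1
    funext h
    rw [Function.update_of_ne]
    intro heq
    have := toLex.injective heq
    simp only [Sigma.mk.injEq] at this
    exact hv this.1

/-- The tensor product of functionals attached to the vertices, with the values multiplied in `A`:
`x ↦ ∏ v, F v (x restricted to the half-edges at v)`. The half-edges are ordered by vertices. -/
def vertexTensor (Γ : HalfEdgeGraph) (F : ∀ v, MultiFun 𝕜 E A (Γ.Fiber v)) :
    MultiFun 𝕜 E A (Σₗ v : Fin Γ.m, Γ.Fiber v) where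
  toFun x := ContinuousMultilinearMap.mkPiAlgebraFin 𝕜 Γ.m A
    fun v => F v fun h => x (toLex ⟨v, h⟩)
  map_update_add' x i a b := by
    obtain ⟨⟨v₀, h₀⟩, rfl⟩ := toLex.surjective i
    simp only [vertexTensor_aux Γ F x v₀ h₀, ContinuousMultilinearMap.map_update_add]
  map_update_smul' x i c a := by
    obtain ⟨⟨v₀, h₀⟩, rfl⟩ := toLex.surjective i
    simp only [vertexTensor_aux Γ F x v₀ h₀, ContinuousMultilinearMap.map_update_smul]
  cont := by fun_prop

/-- Contraction of the last `r` pairs of arguments with `P`. -/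
def contractAll (P : CTensor 𝕜 E E A) {q : ℕ} :
    ∀ r : ℕ, MultiFun 𝕜 E A (Fin (q + 2 * r)) → MultiFun 𝕜 E A (Fin q)
  | 0, f => f
  | r + 1, f => contractAll P r (contract (n := q + 2 * r) P f)

variable (gE : FinGrading 𝕜 E)

/-- The Feynman amplitude of a graph with a functional `F v` attached to every vertex and `P` attached
to every edge, as a functional of the legs: `∏ v, F v` is evaluated on the legs and on one copy of `P`
for every edge, with Koszul signs, and all factors in `A` are multiplied. -/
def amplitude (Γ : HalfEdgeGraph) (F : ∀ v, MultiFun 𝕜 E A (Γ.Fiber v)) (P : CTensor 𝕜 E E A) :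
    MultiFun 𝕜 E A (Fin Γ.numLegs) :=
  contractAll P Γ.numEdges <|
    transport gE ((toLex.symm.trans (Equiv.sigmaFiberEquiv Γ.ρ)).trans Γ.numbering.symm) <|
      vertexTensor Γ F

end Amplitudes

section Flows

variable {𝕜 E : Type*} [RCLike 𝕜]
  [AddCommGroup E] [Module 𝕜 E] [TopologicalSpace E] [IsTopologicalAddGroup E]
  [ContinuousSMul 𝕜 E] [FirstCountableTopology E] (gE : FinGrading 𝕜 E)

section Spaces

variable (A : Type*) [Ring A] [Algebra 𝕜 A] [UniformSpace A] [IsUniformAddGroup A]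
  [ContinuousSMul 𝕜 A]

/-- Series `∑ ħ^p I_{pq}`, with `I_{pq}` of order `q` in the fields. -/
abbrev CommFunctional : Type _ := ∀ _p q : ℕ, SymFun gE A q

/-- Series `∑ γ^i ν^j I_{ijkl}`, with `I_{ijkl}` a sum of products of `k` cyclic words of positive
length and total order `l` in the fields. -/
abbrev NCFunctional : Type _ := ∀ _i _j k l : ℕ, CycFun gE A k l

end Spaces

variable {A : Type*} [Ring A] [Algebra 𝕜 A] [UniformSpace A] [IsUniformAddGroup A]
  [ContinuousSMul 𝕜 A]

/-- The functional `ħ^p w`. -/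
def commMonomial (p : ℕ) {q : ℕ} (w : SymFun gE A q) : CommFunctional gE A :=
  Pi.single p (Pi.single q w)

/-- The functional `γ^i ν^j w`. -/
def ncMonomial (i j : ℕ) {k l : ℕ} (w : CycFun gE A k l) : NCFunctional gE A :=
  Pi.single i (Pi.single j (Pi.single k (Pi.single l w)))

/-- The map `σ_{γ,ν}`: pass from cyclic to symmetric coinvariants and replace `γ^i ν^j` by
`ħ^(2i+j+k-1)` on products of `k` cyclic words. -/
def sigmaMap : NCFunctional gE A →ₗ[𝕜] CommFunctional gE A where
  toFun I p q := ∑ i ∈ Finset.range (p + 2), ∑ j ∈ Finset.range (p + 2),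
    ∑ k ∈ Finset.range (p + 2), if 2 * i + j + k = p + 1 then cycToSym gE k q (I i j k q) else 0
  map_add' I J := by
    funext p q
    simp only [Pi.add_apply, map_add, ← Finset.sum_add_distrib]
    refine Finset.sum_congr rfl fun i _ => Finset.sum_congr rfl fun j _ =>
      Finset.sum_congr rfl fun k _ => ?_
    split_ifs <;> simp
  map_smul' c I := by
    funext p q
    simp only [Pi.smul_apply, map_smul, RingHom.id_apply, Finset.smul_sum]
    refine Finset.sum_congr rfl fun i _ => Finset.sum_congr rfl fun j _ =>
      Finset.sum_congr rfl fun k _ => ?_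
    split_ifs <;> simp

section Degree

variable (gA : FinGrading 𝕜 A)

/-- `f` has total degree zero: it preserves degrees. -/
def IsDegZero {ι : Type*} [Fintype ι] (f : MultiFun 𝕜 E A ι) : Prop :=
  ∀ (d : ι → ℤ) (x : ι → E), (∀ i, gE.IsHomog (d i) (x i)) → gA.IsHomog (∑ i, d i) (f x)

/-- A class in the symmetric coinvariants has degree zero if it has a representative of degree zero. -/
def SymDegZero {n : ℕ} (w : SymFun gE A n) : Prop :=
  ∃ f : MultiFun 𝕜 E A (Fin n), IsDegZero gE gA f ∧ (symRel gE A n).mkQ f = w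

/-- A class in the cyclic coinvariants has degree zero if it has a representative of degree zero. -/
def CycDegZero {k l : ℕ} (w : CycFun gE A k l) : Prop :=
  ∃ f : CycDecomp k l → MultiFun 𝕜 E A (Fin l),
    (∀ c, IsDegZero gE gA (f c)) ∧ (cycRel gE A k l).mkQ f = w

/-- Families of commutative interactions. -/
structure IsCommInteraction (I : CommFunctional gE A) : Prop where
  degZero : ∀ p q, SymDegZero gE gA (I p q)
  eq_zero : ∀ p q, 2 * p + q < 3 → I p q = 0

/-- Families of noncommutative interactions. -/
structure IsNCInteraction (I : NCFunctional gE A) : Prop where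
  degZero : ∀ i j k l, CycDegZero gE gA (I i j k l)
  const_eq_zero : ∀ i l, I i 0 0 l = 0
  eq_zero : ∀ i j k l : ℕ, 2 * (2 * i + j + k - 1 : ℤ) + l < 3 → I i j k l = 0

/-- The flip `x ⊗ y ⊗ a ↦ (-1)^(|x||y|) y ⊗ x ⊗ a`. -/
def braid (P : CTensor 𝕜 E E A) : CTensor 𝕜 E E A :=
  ∑ δ : ZMod 2, ∑ ε : ZMod 2, (if δ = 1 ∧ ε = 1 then (-1 : ℤ) else 1) •
    CTensor.flip 𝕜 (CTensor.map 𝕜 (gE.par δ) (gE.par ε) (ContinuousLinearMap.id 𝕜 A) P)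

/-- Families of propagators: symmetric elements of `E ⊗̂ E ⊗̂ A` of total degree zero. -/
structure IsPropagator (P : CTensor 𝕜 E E A) : Prop where
  symm : braid gE P = P
  degZero : ∀ i j k : ℤ, i + j + k ≠ 0 → CTensor.map 𝕜 (gE.proj i) (gE.proj j) (gA.proj k) P = 0

end Degree

variable [ContinuousMul A] [PolynormableSpace 𝕜 A] [T2Space A] [CompleteSpace A]

/-- The Feynman weight of a stable graph: the interaction `I_{l(v) |v|}` is attached to every vertex
`v`. -/
def commWeight (Γ : StableGraph) (I : CommFunctional gE A) (P : CTensor 𝕜 E E A) :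
    SymFun gE A Γ.numLegs :=
  symClass gE <| amplitude gE Γ.toHalfEdgeGraph
    (fun v => attachSym gE (Γ.valency v) (I (Γ.loop v) (Γ.valency v))) P

/-- The Feynman weight of a stable ribbon graph: the interaction `I_{g(v) b(v) |C(v)| |v|}` is
attached to every vertex `v`, using the cyclic decomposition `C(v)`, and the legs of `Γ` carry their
canonical cyclic decomposition. -/
def ncWeight (Γ : RibbonGraph) (I : NCFunctional gE A) (P : CTensor 𝕜 E E A) :
    CycFun gE A (numCycles (Γ.legNumbering.symm.permCongr Γ.legPerm)) Γ.numLegs :=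
  cycClass gE (Γ.legNumbering.symm.permCongr Γ.legPerm) <| amplitude gE Γ.toHalfEdgeGraph
    (fun v => attachCyc gE (Γ.cyc v) (numCycles (Γ.cyc v)) (Γ.valency v)
      (I (Γ.gen v) (Γ.bdry v) (numCycles (Γ.cyc v)) (Γ.valency v))) P

open scoped Classical in
/-- The flow `∑_Γ ħ^ℓ(Γ) / |Aut Γ| · w_Γ(I, P)`, the sum being over isomorphism classes of connected
stable graphs. -/
def commFlow (I : CommFunctional gE A) (P : CTensor 𝕜 E E A) : CommFunctional gE A := fun p q =>
  ∑ᶠ Γ : Quotient StableGraph.setoid,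
    if Γ.out.Connected ∧ Γ.out.loopNumber = p then
      (Γ.out.numAut : 𝕜)⁻¹ •
        Pi.single (M := fun q => SymFun gE A q) Γ.out.numLegs (commWeight gE Γ.out I P) q
    else 0

open scoped Classical in
/-- The flow `∑_Γ γ^g(Γ) ν^b(Γ) / |Aut Γ| · w_Γ(I, P)`, the sum being over isomorphism classes of
connected stable ribbon graphs. -/
def ncFlow (I : NCFunctional gE A) (P : CTensor 𝕜 E E A) : NCFunctional gE A := fun i j k l =>
  ∑ᶠ Γ : Quotient RibbonGraph.setoid,
    if Γ.out.Connected ∧ Γ.out.genus = i ∧ Γ.out.freeBoundary = j then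
      (Γ.out.numAut : 𝕜)⁻¹ •
        Pi.single (M := fun k => ∀ l, CycFun gE A k l) _
          (Pi.single (M := fun l => CycFun gE A _ l) _ (ncWeight gE Γ.out I P)) k l
    else 0

end Flows

end NCFlow

end

open scoped TensorProduct

noncomputable section

set_option linter.unusedSectionVars false

namespace NCFlow

/-! ### Cycle counts under multiplication by a transposition and under removal of a point -/

section Cycles

open Equiv

variable {α β : Type*}

/-! The symmetrization `σ` forgets cyclic orders, so after `σ` a ribbon graph contributes the
ordinary Feynman amplitude of its underlying stable graph. Conversely, the functional that `σ(I)`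
attaches to a vertex with loop number `p` is the sum over all choices of a genus `g(v)`, a boundary
number `b(v)` and a cyclic decomposition `C(v)` with `2g(v) + b(v) + |C(v)| - 1 = p`
(`attachSym_sigmaMap`). The choices with `b(v) = |C(v)| = 0` are not allowed in ribbon graphs; they
drop out because `I` has no such terms. Expanding multilinearly over the vertices, the weight of a
stable graph `G` becomes the sum over all ribbon structures on `G` (`single_commWeight`).

It remains to compare symmetry factors. The isomorphisms from the stable graph underlying a ribbon
graph `R` to `G` are the pairs of a ribbon structure on `G` and an isomorphism from `R` to the
resulting ribbon graph (`RibbonStr.forget_bijective`). Hence, if there is such an isomorphism, `R`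
arises from exactly `|Aut G| / |Aut R|` structures, and the two weighted sums agree
(`RibbonStr.inv_numAut_smul_sum`).

Three further points are needed. The powers must match: an Euler characteristic count gives `ℓ = 2g
+ b + k - 1` (`RibbonGraph.loopNumber_toStable`). No ribbon graph may be lost because its exponents
are not natural numbers: `g` is a nonnegative integer because each edge changes the number of
boundary cycles by one, and `b ≥ 0` because legs on one boundary cycle stay on one cycle under
contraction. Finally, the symmetrized weight must depend only on the isomorphism class
(`symWeight_eq_of_iso`), which is where the Koszul signs enter. Renumbering vertices produces signs
that cancel against graded commutativity of `A`, since the vertex functionals have degree zero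
(`vertexTensor_transport`). Renumbering edges is harmless since `P` is symmetric and even
(`respects_of_commute`); the identities for completed tensors follow from elementary ones by
continuity, for which `continuous_doubleContract` is the analytic input.

Finiteness and the interaction conditions follow from summing the stability inequalities, which
bounds the number of vertices by `2ℓ + |L| - 2`. -/

theorem numCycles_congr {c : Perm α} {d : Perm β} (e : α ≃ β) (h : ∀ x, d (e x) = e (c x)) :
    numCycles d = numCycles c := by
  obtain rfl : d = e.permCongr c := by
    ext y
    obtain ⟨x, rfl⟩ := e.surjective y
    simp [h, Equiv.permCongr_apply]
  refine (Nat.card_congr (Quotient.congr e fun x y => ?_)).symm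
  change c.SameCycle x y ↔ (e.permCongr c).SameCycle (e x) (e y)
  have key : ∀ n : ℤ, (e.permCongr c ^ n) (e x) = e ((c ^ n) x) := by
    intro n
    have : e.permCongr c ^ n = e.permCongr (c ^ n) :=
      (map_zpow (e.permCongrHom) c n).symm
    rw [this]
    simp [Equiv.permCongr_apply]
  simp [Perm.SameCycle, key]

theorem numCycles_permCongr (e : α ≃ β) (c : Perm α) : numCycles (e.permCongr c) = numCycles c :=
  numCycles_congr e fun x => by simp [Equiv.permCongr_apply]

/-- Identifying one pair of points lowers the number of classes by at most one. -/
theorem card_quot_le_succ [Finite α] (r s : α → α → Prop) (a b : α)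
    (h : ∀ x y, s x y → Quot.mk r x = Quot.mk r y ∨ (x = a ∧ y = b)) :
    Nat.card (Quot r) ≤ Nat.card (Quot s) + 1 := by
  classical
  -- Every generating step of `s` stays in one `r`-class, except the step from `a` to `b`. So a
  -- chain of steps either stays in one class or has both ends in the classes of `a` and `b`.
  have key : ∀ x y, Quot.mk s x = Quot.mk s y → Quot.mk r x = Quot.mk r y ∨
      ((Quot.mk r x = Quot.mk r a ∨ Quot.mk r x = Quot.mk r b) ∧
        (Quot.mk r y = Quot.mk r a ∨ Quot.mk r y = Quot.mk r b)) := by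
    intro x y hxy
    induction Quot.eqvGen_exact hxy with
    | rel x y hs =>
      rcases h x y hs with h | ⟨rfl, rfl⟩
      · exact Or.inl h
      · exact Or.inr ⟨Or.inl rfl, Or.inr rfl⟩
    | refl x => exact Or.inl rfl
    | symm x y hr ih =>
      rcases ih (Quot.eqvGen_sound hr) with h | ⟨h1, h2⟩
      · exact Or.inl h.symm
      · exact Or.inr ⟨h2, h1⟩
    | trans x y z hr hr' ih ih' =>
      rcases ih (Quot.eqvGen_sound hr) with h | ⟨h1, h2⟩ <;>
        rcases ih' (Quot.eqvGen_sound hr') with h' | ⟨h1', h2'⟩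
      · exact Or.inl (h.trans h')
      · exact Or.inr ⟨h ▸ h1', h2'⟩
      · exact Or.inr ⟨h1, h' ▸ h2⟩
      · exact Or.inr ⟨h1, h2'⟩
  have hf : Finite (Quot r) := inferInstance
  -- Only the classes of `a` and `b` can acquire the same image, so moving the class of `a` to the
  -- extra point `none` makes the map injective.
  let f : Quot r → Option (Quot s) := fun q =>
    if q = Quot.mk r a then none else some (Quot.mk s q.out)
  have hinj : Function.Injective f := by
    intro p q hpq
    simp only [f] at hpq
    split_ifs at hpq with h1 h2 h2
    · rw [h1, h2]
    · have := key _ _ (Option.some.inj hpq)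
      simp only [Quot.out_eq] at this
      rcases this with h | ⟨h, h'⟩
      · exact h
      · rw [h.resolve_left h1, h'.resolve_left h2]
  calc Nat.card (Quot r) ≤ Nat.card (Option (Quot s)) := Nat.card_le_card_of_injective f hinj
    _ = Nat.card (Quot s) + 1 := Finite.card_option

theorem quotMk_eq_iff_sameCycle (c : Perm α) {x y : α} :
    Quot.mk (fun x y => c x = y) x = Quot.mk _ y ↔ c.SameCycle x y := by
  constructor
  · intro h
    have h' := Quot.eqvGen_exact h
    clear h
    induction h' with
    | rel x y h => exact ⟨1, by simpa using h⟩
    | refl x => exact Perm.SameCycle.refl _ _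
    | symm x y _ ih => exact ih.symm
    | trans x y z _ _ ih ih' => exact ih.trans ih'
  · have key : ∀ (n : ℕ) (z : α), Quot.mk (fun x y => c x = y) z = Quot.mk _ ((c ^ n) z) := by
      intro n
      induction n with
      | zero => intro z; rfl
      | succ n ih =>
        intro z
        rw [pow_succ, Perm.mul_apply, ← ih]
        exact Quot.sound rfl
    rintro ⟨n, rfl⟩
    obtain ⟨n, rfl | rfl⟩ := n.eq_nat_or_neg
    · exact key n x
    · have := key n ((c ^ (-(n : ℤ))) x)
      rw [← Perm.mul_apply, zpow_neg, zpow_natCast, mul_inv_cancel, Perm.one_apply] at this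
      rw [zpow_neg, zpow_natCast]
      exact this.symm

theorem numCycles_eq_card_quot (c : Perm α) :
    numCycles c = Nat.card (Quot fun x y => c x = y) := by
  refine Nat.card_congr ⟨Quot.lift (Quot.mk _) fun x y h => (quotMk_eq_iff_sameCycle c).mpr h,
    Quot.lift (Quot.mk _) fun x y h => Quot.sound ((quotMk_eq_iff_sameCycle c).mp (Quot.sound h)),
    ?_, ?_⟩ <;> rintro ⟨x⟩ <;> rfl

variable [DecidableEq α]

/-- The relation generated by `π` and the pair `a`, `b` coarsens the cycles of both permutations. It
has at most one class fewer than `π` has cycles, and at most as many classes as the product has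
cycles. -/
theorem numCycles_le_mul_swap [Finite α] (π : Perm α) (a b : α) :
    numCycles π ≤ numCycles (π * swap a b) + 1 := by
  have h1 := card_quot_le_succ (fun x y => π x = y)
    (fun x y => π x = y ∨ (x = a ∧ y = b)) a b (fun x y h => h.imp_left (Quot.sound ·))
  have h2 : Nat.card (Quot fun x y => π x = y ∨ (x = a ∧ y = b)) ≤
      Nat.card (Quot fun x y => (π * swap a b) x = y) := by
    have hab : Quot.mk (fun x y => π x = y ∨ (x = a ∧ y = b)) a = Quot.mk _ b :=
      Quot.sound (Or.inr ⟨rfl, rfl⟩)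
    have hπ : ∀ x, Quot.mk (fun x y => π x = y ∨ (x = a ∧ y = b)) x = Quot.mk _ (π x) :=
      fun x => Quot.sound (Or.inl rfl)
    refine Nat.card_le_card_of_surjective (Quot.lift (Quot.mk _) ?_) ?_
    · rintro x y rfl
      rw [Perm.mul_apply, ← hπ]
      rcases eq_or_ne x a with rfl | ha
      · rw [swap_apply_left, hab]
      rcases eq_or_ne x b with rfl | hb
      · rw [swap_apply_right, hab]
      rw [swap_apply_of_ne_of_ne ha hb]
    · rintro ⟨x⟩
      exact ⟨Quot.mk _ x, rfl⟩
  rw [numCycles_eq_card_quot, numCycles_eq_card_quot]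
  omega

/-- From `a` the product jumps to `π b` and then follows the `π`-cycle of `b`, which avoids `a`, up
to the first return to `b`. -/
theorem sameCycle_mul_swap [Finite α] {π : Perm α} {a b : α} (h : ¬ π.SameCycle a b) :
    (π * swap a b).SameCycle a b := by
  have hex : ∃ n, 0 < n ∧ (π ^ n) b = b :=
    ⟨orderOf π, orderOf_pos π, by rw [pow_orderOf_eq_one, Perm.one_apply]⟩
  classical
  obtain ⟨hn, hnb⟩ := Nat.find_spec hex
  have key : ∀ k, k + 1 ≤ Nat.find hex → ((π * swap a b) ^ (k + 1)) a = (π ^ (k + 1)) b := by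
    intro k
    induction k with
    | zero => intro _; simp
    | succ k ih =>
      intro hk
      rw [pow_succ', Perm.mul_apply, ih (by omega), pow_succ' π (k + 1), Perm.mul_apply,
        Perm.mul_apply, swap_apply_of_ne_of_ne]
      · intro ha
        exact h (Perm.SameCycle.symm ⟨(k + 1 : ℕ), by rw [zpow_natCast]; exact ha⟩)
      · intro hb
        exact Nat.find_min hex (Nat.lt_of_succ_le hk) ⟨Nat.succ_pos _, hb⟩
  refine ⟨(Nat.find hex : ℕ), ?_⟩
  obtain ⟨k, hk⟩ := Nat.exists_eq_succ_of_ne_zero hn.ne'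
  rw [zpow_natCast, hk, key k hk.ge, ← Nat.succ_eq_add_one, ← hk, hnb]

/-- The cycles of `π` map onto those of the product, and not injectively since the cycles of `a` and
`b` merge; at most one cycle is lost by `numCycles_le_mul_swap`. -/
theorem numCycles_mul_swap_of_not_sameCycle [Finite α] {π : Perm α} {a b : α}
    (h : ¬ π.SameCycle a b) : numCycles (π * swap a b) + 1 = numCycles π := by
  refine le_antisymm ?_ (numCycles_le_mul_swap π a b)
  have hab := sameCycle_mul_swap h
  have h1 : ∀ x, (π * swap a b).SameCycle x (π x) := by
    intro x
    have hs : ∀ z, (π * swap a b).SameCycle z ((π * swap a b) z) := fun z => ⟨1, by simp⟩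
    rcases eq_or_ne x a with rfl | ha
    · refine hab.trans ?_
      simpa using hs b
    rcases eq_or_ne x b with rfl | hb
    · refine hab.symm.trans ?_
      simpa using hs a
    · simpa [swap_apply_of_ne_of_ne ha hb] using hs x
  let f : (Quot fun x y => π x = y) → Quotient (Perm.SameCycle.setoid (π * swap a b)) :=
    Quot.lift (Quotient.mk _) fun x y hxy => Quotient.sound (hxy ▸ h1 x)
  have hf : Function.Surjective f := by
    rintro ⟨x⟩
    exact ⟨Quot.mk _ x, rfl⟩
  have : Fintype (Quot fun x y => π x = y) := Fintype.ofFinite _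
  have : Fintype (Quotient (Perm.SameCycle.setoid (π * swap a b))) := Fintype.ofFinite _
  rw [numCycles_eq_card_quot π, numCycles, Nat.card_eq_fintype_card, Nat.card_eq_fintype_card]
  refine Nat.succ_le_of_lt (lt_of_le_of_ne (Fintype.card_le_of_surjective f hf) fun he => h ?_)
  have hb := (Fintype.bijective_iff_surjective_and_card f).mpr ⟨hf, he.symm⟩
  have hq : Quot.mk (fun x y => π x = y) a = Quot.mk _ b := hb.1 (Quotient.sound hab)
  exact (quotMk_eq_iff_sameCycle π).mp hq

/-- It suffices that `a` and `b` are separated in the product: multiplying by the transposition once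
more returns to `π`, and that step is the merging case. -/
theorem numCycles_mul_swap_of_sameCycle [Finite α] {π : Perm α} {a b : α} (hab : a ≠ b)
    (h : π.SameCycle a b) : numCycles (π * swap a b) = numCycles π + 1 := by
  have hn : ¬ (π * swap a b).SameCycle a b := by
    classical
    have hex : ∃ n, (π ^ n) a = b := by
      obtain ⟨n, -, -, h⟩ := h.exists_pow_eq''
      exact ⟨n, h⟩
    have hk := Nat.find_spec hex
    set k := Nat.find hex
    have hk0 : k ≠ 0 := by
      intro h0
      rw [h0] at hk
      exact hab hk
    -- The arc `π a, …, π^k a = b` with `k` minimal is closed under the product, which sends `b`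
    -- back to `π a`. It contains `b` but not `a`.
    let S : Set α := {x | ∃ i, i + 1 ≤ k ∧ (π ^ (i + 1)) a = x}
    have hS : ∀ x ∈ S, (π * swap a b) x ∈ S := by
      rintro _ ⟨i, hi, rfl⟩
      rcases eq_or_ne ((π ^ (i + 1)) a) b with hb | hb
      · exact ⟨0, by omega, by simp [hb]⟩
      have ha : (π ^ (i + 1)) a ≠ a := by
        intro ha
        refine Nat.find_min hex (m := k - (i + 1)) (by omega) ?_
        have : (π ^ (k - (i + 1))) ((π ^ (i + 1)) a) = b := by
          rw [← Perm.mul_apply, ← pow_add, Nat.sub_add_cancel hi]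
          exact hk
        rwa [ha] at this
      refine ⟨i + 1, ?_, ?_⟩
      · rcases hi.lt_or_eq with h | h
        · omega
        · rw [h] at hb
          exact absurd hk hb
      · rw [Perm.mul_apply, swap_apply_of_ne_of_ne ha hb, pow_succ' π (i + 1), Perm.mul_apply]
    intro hs
    obtain ⟨n, -, -, hn⟩ := hs.symm.exists_pow_eq''
    have haS : a ∈ S := by
      rw [← hn]
      clear hn
      induction n with
      | zero => exact ⟨k - 1, by omega, by rw [Nat.sub_add_cancel (by omega)]; exact hk⟩
      | succ n ih => rw [pow_succ', Perm.mul_apply]; exact hS _ ih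
    obtain ⟨i, hi, ha⟩ := haS
    refine Nat.find_min hex (m := k - (i + 1)) (by omega) ?_
    have : (π ^ (k - (i + 1))) ((π ^ (i + 1)) a) = b := by
      rw [← Perm.mul_apply, ← pow_add, Nat.sub_add_cancel hi]
      exact hk
    rwa [ha] at this
  have := numCycles_mul_swap_of_not_sameCycle hn
  rw [mul_assoc, swap_mul_self, mul_one] at this
  exact this.symm

/-- The orbit of `x` is followed step by step; a passage through `h` turns two steps of `π` into one
step of the spliced permutation. -/
theorem sameCycle_spliceOut [Finite α] {π : Perm α} {h x y : α} (hs : π.SameCycle x y)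
    (hx : x ≠ h) (hy : y ≠ h) : (spliceOut π h).SameCycle x y := by
  obtain ⟨n, -, -, rfl⟩ := hs.exists_pow_eq''
  have key : ∀ n x, x ≠ h → (π ^ n) x ≠ h → (spliceOut π h).SameCycle x ((π ^ n) x) := by
    intro n
    induction n using Nat.strong_induction_on with
    | _ n ih =>
      intro x hx hy
      rcases n with _ | n
      · exact Perm.SameCycle.refl _ _
      have hs : (spliceOut π h).SameCycle x (spliceOut π h x) := ⟨1, by simp⟩
      rw [pow_succ, Perm.mul_apply] at hy ⊢
      by_cases h1 : π x = h
      · rcases n with _ | n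
        · exact absurd h1 hy
        rw [pow_succ, Perm.mul_apply, h1] at hy ⊢
        have h2 : spliceOut π h x = π h := by
          rw [spliceOut, Perm.mul_apply, h1, swap_apply_left]
        rw [h2] at hs
        refine hs.trans (ih n (by omega) _ ?_ hy)
        intro h3
        exact hx (π.injective (h1.trans h3.symm))
      · have h2 : spliceOut π h x = π x := by
          rw [spliceOut, Perm.mul_apply, swap_apply_of_ne_of_ne h1]
          exact π.injective.ne hx
        rw [h2] at hs
        exact hs.trans (ih n (by omega) _ h1 hy)
  exact key n x hx hy

/-- This lets the transpositions of the edges not yet contracted pass through the removal of a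
half-edge. -/
theorem spliceOut_mul (π s : Perm α) {h : α} (hs : s h = h) :
    spliceOut (π * s) h = spliceOut π h * s := by
  rw [spliceOut, spliceOut, Perm.mul_apply, hs, mul_assoc]

end Cycles

/-! ### Genus, free boundary and loop number of a ribbon graph -/

section Genus

open Equiv

/-- Euler's formula with defect `2g`, by adding edges one at a time. An edge that splits a boundary
cycle has both ends in one component already, so the number of components does not drop. An edge
that joins two boundary cycles lowers the number of components by at most one. In both cases `g`
does not decrease. -/
theorem exists_genus_of_list {α μ : Type*} [Finite α] [DecidableEq α] [Finite μ] (ρ : α → μ)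
    (c : Perm α) (hc : ∀ h, ρ (c h) = ρ h) (L : List (α × α)) (hL : ∀ p ∈ L, p.1 ≠ p.2) :
    ∃ g : ℕ, 2 * g + 2 * Nat.card μ + numCycles (c * (L.map fun p => swap p.1 p.2).prod) =
      2 * Nat.card (Quot fun v w => ∃ p ∈ L, ρ p.1 = v ∧ ρ p.2 = w) + L.length + numCycles c := by
  induction L using List.reverseRecOn with
  | nil =>
    refine ⟨0, ?_⟩
    have : Nat.card (Quot fun v w => ∃ p ∈ ([] : List (α × α)), ρ p.1 = v ∧ ρ p.2 = w) =
        Nat.card μ := by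
      refine Nat.card_congr ⟨Quot.lift id fun v w h => by simp at h, Quot.mk _, ?_, ?_⟩
      · rintro ⟨x⟩; rfl
      · intro x; rfl
    rw [this]
    simp
  | append_singleton L p ih =>
    obtain ⟨g, hg⟩ := ih fun q hq => hL q (by simp [hq])
    have hp := hL p (by simp)
    rw [List.map_append, List.prod_append, List.map_singleton, List.prod_singleton, ← mul_assoc,
      List.length_append, List.length_singleton]
    set π := c * (L.map fun p => swap p.1 p.2).prod with hπ
    by_cases hs : π.SameCycle p.1 p.2
    · rw [numCycles_mul_swap_of_sameCycle hp hs]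
      have hK : Nat.card (Quot fun v w => ∃ p ∈ L, ρ p.1 = v ∧ ρ p.2 = w) ≤
          Nat.card (Quot fun v w => ∃ q ∈ L ++ [p], ρ q.1 = v ∧ ρ q.2 = w) := by
        -- `c` preserves vertices and each earlier transposition moves along an edge, so `π` never
        -- leaves a component.
        have hstep : ∀ x, Quot.mk (fun v w => ∃ p ∈ L, ρ p.1 = v ∧ ρ p.2 = w) (ρ x) =
            Quot.mk _ (ρ (π x)) := by
          have hmk : ∀ (l : List (α × α)), (∀ q ∈ l, q ∈ L) → ∀ x,
              Quot.mk (fun v w => ∃ p ∈ L, ρ p.1 = v ∧ ρ p.2 = w) (ρ x) =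
                Quot.mk _ (ρ ((l.map fun p => swap p.1 p.2).prod x)) := by
            intro l
            induction l with
            | nil => intro _ x; rfl
            | cons q l ih =>
              intro hl x
              rw [ih (fun q hq => hl q (by simp [hq])), List.map_cons, List.prod_cons,
                Perm.mul_apply]
              generalize (l.map fun p => swap p.1 p.2).prod x = y
              have hq : Quot.mk (fun v w => ∃ p ∈ L, ρ p.1 = v ∧ ρ p.2 = w) (ρ q.1) =
                Quot.mk _ (ρ q.2) := Quot.sound ⟨q, hl q (by simp), rfl, rfl⟩
              rcases eq_or_ne y q.1 with rfl | h1
              · rw [swap_apply_left, hq]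
              rcases eq_or_ne y q.2 with rfl | h2
              · rw [swap_apply_right, hq]
              · rw [swap_apply_of_ne_of_ne h1 h2]
          intro x
          rw [hπ, Perm.mul_apply, hc]
          exact hmk L (fun _ h => h) x
        have hsame : Quot.mk (fun v w => ∃ p ∈ L, ρ p.1 = v ∧ ρ p.2 = w) (ρ p.1) =
            Quot.mk _ (ρ p.2) := by
          obtain ⟨n, -, -, hn⟩ := hs.exists_pow_eq''
          rw [← hn]
          clear hn
          induction n with
          | zero => rfl
          | succ n ih => rw [pow_succ', Perm.mul_apply, ← hstep, ← ih]
        refine Nat.card_le_card_of_surjective (Quot.lift (Quot.mk _) ?_) ?_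
        · rintro v w ⟨q, hq, rfl, rfl⟩
          rcases List.mem_append.mp hq with hq | hq
          · exact Quot.sound ⟨q, hq, rfl, rfl⟩
          · rw [List.mem_singleton.mp hq, hsame]
        · rintro ⟨x⟩
          exact ⟨Quot.mk _ x, rfl⟩
      exact ⟨g + (Nat.card (Quot fun v w => ∃ q ∈ L ++ [p], ρ q.1 = v ∧ ρ q.2 = w) -
        Nat.card (Quot fun v w => ∃ p ∈ L, ρ p.1 = v ∧ ρ p.2 = w)), by omega⟩
    · have hβ := numCycles_mul_swap_of_not_sameCycle hs
      have hK := card_quot_le_succ (fun v w => ∃ p ∈ L, ρ p.1 = v ∧ ρ p.2 = w)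
        (fun v w => ∃ q ∈ L ++ [p], ρ q.1 = v ∧ ρ q.2 = w) (ρ p.1) (ρ p.2) (by
          rintro v w ⟨q, hq, rfl, rfl⟩
          rcases List.mem_append.mp hq with hq | hq
          · exact Or.inl (Quot.sound ⟨q, hq, rfl, rfl⟩)
          · rw [List.mem_singleton.mp hq]
            exact Or.inr ⟨rfl, rfl⟩)
      -- The `1` is added before subtracting, so that by `hK` the difference is not truncated even
      -- when the number of components drops.
      exact ⟨g + 1 + Nat.card (Quot fun v w => ∃ q ∈ L ++ [p], ρ q.1 = v ∧ ρ q.2 = w) -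
        Nat.card (Quot fun v w => ∃ p ∈ L, ρ p.1 = v ∧ ρ p.2 = w), by omega⟩

namespace HalfEdgeGraph

variable (Γ : HalfEdgeGraph)

/-- The list of the edges, each represented by the smaller one of its half-edges. -/
def edgeList : List (Fin Γ.n) := (List.finRange Γ.n).filter fun h => h < Γ.κ h

theorem mem_edgeList {h : Fin Γ.n} : h ∈ Γ.edgeList ↔ h < Γ.κ h := by
  simp [edgeList]

theorem nodup_edgeList : Γ.edgeList.Nodup := (List.nodup_finRange _).filter _

theorem length_edgeList : Γ.edgeList.length = Γ.numEdges := by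
  rw [numEdges, Fintype.card_subtype, ← List.toFinset_card_of_nodup Γ.nodup_edgeList]
  congr 1
  ext h
  simp [mem_edgeList]

/-- Distinct edges consist of disjoint pairs of half-edges, so at most one factor moves a given `x`.
-/
theorem prod_swap_apply (L : List (Fin Γ.n)) (hL : L.Nodup) (h : ∀ x ∈ L, x < Γ.κ x)
    (x : Fin Γ.n) : (L.map fun h => swap h (Γ.κ h)).prod x =
      if x ∈ L ∨ Γ.κ x ∈ L then Γ.κ x else x := by
  induction L with
  | nil => simp
  | cons a L ih =>
    rw [List.map_cons, List.prod_cons, Perm.mul_apply,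
      ih hL.of_cons fun x hx => h x (List.mem_cons_of_mem _ hx)]
    have haL : a ∉ L := (List.nodup_cons.mp hL).1
    have haκ : a < Γ.κ a := h a List.mem_cons_self
    have hκaL : Γ.κ a ∉ L := fun hm => by
      have := h _ (List.mem_cons_of_mem _ hm)
      rw [Γ.κ_κ] at this
      exact absurd haκ this.not_gt
    by_cases hx : x ∈ L ∨ Γ.κ x ∈ L
    · rw [if_pos hx, if_pos (hx.imp (List.mem_cons_of_mem _) (List.mem_cons_of_mem _))]
      refine swap_apply_of_ne_of_ne ?_ ?_
      · rintro rfl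
        rw [Γ.κ_κ] at hκaL
        tauto
      · intro he
        rw [Γ.κ.injective he, ] at hx
        tauto
    · rw [if_neg hx]
      by_cases h1 : x = a
      · simp [h1]
      by_cases h2 : x = Γ.κ a
      · simp [h2, Γ.κ_κ]
      rw [swap_apply_of_ne_of_ne h1 h2, if_neg]
      have h3 : Γ.κ x ≠ a := fun h3 => h2 (by rw [← h3, Γ.κ_κ])
      simp only [List.mem_cons]
      tauto

theorem prod_swap_edgeList : (Γ.edgeList.map fun h => swap h (Γ.κ h)).prod = Γ.κ := by
  ext x
  rw [Γ.prod_swap_apply _ Γ.nodup_edgeList fun x hx => Γ.mem_edgeList.mp hx]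
  simp only [mem_edgeList, Γ.κ_κ]
  split_ifs with h
  · rfl
  · rw [not_or, not_lt, not_lt] at h
    rw [le_antisymm h.1 h.2]

theorem numComponents_eq : Γ.numComponents =
    Nat.card (Quot fun v w => ∃ p ∈ Γ.edgeList.map fun h => (h, Γ.κ h),
      Γ.ρ p.1 = v ∧ Γ.ρ p.2 = w) := by
  refine Nat.card_congr ⟨Quot.lift (Quot.mk _) ?_, Quot.map id ?_, ?_, ?_⟩
  · rintro v w ⟨h, rfl, rfl⟩
    rcases lt_trichotomy h (Γ.κ h) with hh | hh | hh
    · exact Quot.sound ⟨(h, Γ.κ h), List.mem_map.mpr ⟨h, Γ.mem_edgeList.mpr hh, rfl⟩, rfl, rfl⟩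
    · rw [← hh]
    · refine (Quot.sound ⟨(Γ.κ h, h), List.mem_map.mpr ⟨Γ.κ h, Γ.mem_edgeList.mpr ?_, ?_⟩, rfl,
        rfl⟩).symm
      · rwa [Γ.κ_κ]
      · rw [Γ.κ_κ]
  · rintro v w ⟨p, hp, rfl, rfl⟩
    obtain ⟨h, -, rfl⟩ := List.mem_map.mp hp
    exact ⟨h, rfl, rfl⟩
  · rintro ⟨x⟩; rfl
  · rintro ⟨x⟩; rfl

theorem exists_genus (c : Perm (Fin Γ.n)) (hc : ∀ h, Γ.ρ (c h) = Γ.ρ h) :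
    ∃ g : ℕ, 2 * g + 2 * Γ.m + numCycles (c * Γ.κ) =
      2 * Γ.numComponents + Γ.numEdges + numCycles c := by
  have h := exists_genus_of_list Γ.ρ c hc (Γ.edgeList.map fun h => (h, Γ.κ h)) (by
    intro p hp
    obtain ⟨h, hh, rfl⟩ := List.mem_map.mp hp
    exact (Γ.mem_edgeList.mp hh).ne)
  rw [← numComponents_eq, List.map_map, List.length_map, length_edgeList] at h
  rw [← prod_swap_edgeList]
  simpa [Function.comp_def] using h

theorem card_halfEdges : Γ.n = Γ.numLegs + 2 * Γ.numEdges := by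
  have := Fintype.card_congr Γ.numbering
  simpa using this.symm

theorem sum_valency : ∑ v, Γ.valency v = Γ.n := by
  have := Fintype.card_congr (Equiv.sigmaFiberEquiv Γ.ρ)
  simpa [valency, Fintype.card_sigma] using this

/-- Every cycle of `c` stays at a single vertex, because `c` preserves `ρ`. -/
theorem sum_numCycles_vertexPerm (c : Perm (Fin Γ.n)) (hc : ∀ h, Γ.ρ (c h) = Γ.ρ h) :
    ∑ v, numCycles (Γ.vertexPerm c hc v) = numCycles c := by
  have hρ : ∀ x y, c.SameCycle x y → Γ.ρ x = Γ.ρ y := by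
    rintro x y h
    obtain ⟨n, -, -, rfl⟩ := h.exists_pow_eq''
    induction n with
    | zero => rfl
    | succ n ih => rw [pow_succ', Perm.mul_apply, hc, ← ih ⟨n, by simp⟩]
  let f : (Σ v, Quotient (Perm.SameCycle.setoid (Γ.vertexPerm c hc v))) →
      Quotient (Perm.SameCycle.setoid c) := fun q =>
    Quotient.map (sa := Perm.SameCycle.setoid (Γ.vertexPerm c hc q.1))
      (sb := Perm.SameCycle.setoid c) Subtype.val (fun x y h =>
        Perm.sameCycle_subtypePerm.mp h) q.2
  have hf : Function.Bijective f := by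
    constructor
    · rintro ⟨v, ⟨x, rfl⟩⟩ ⟨w, ⟨y, hy⟩⟩ h
      have h' : c.SameCycle x y := Quotient.exact h
      obtain rfl : Γ.ρ x = w := (hρ x y h').trans hy
      congr 1
      exact Quotient.sound (s := Perm.SameCycle.setoid (Γ.vertexPerm c hc (Γ.ρ x)))
        (Perm.sameCycle_subtypePerm.mpr h')
    · rintro ⟨x⟩
      exact ⟨⟨Γ.ρ x, Quotient.mk _ ⟨x, rfl⟩⟩, rfl⟩
  rw [numCycles, ← Nat.card_congr (Equiv.ofBijective f hf), Nat.card_sigma]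
  rfl

end HalfEdgeGraph

namespace RibbonGraph

variable (Γ : RibbonGraph)

/-- The stable graph underlying a stable ribbon graph. -/
def toStable : StableGraph where
  toHalfEdgeGraph := Γ.toHalfEdgeGraph
  loop v := 2 * Γ.gen v + Γ.bdry v + numCycles (Γ.cyc v) - 1
  stable v := by
    have h1 := Γ.pos v
    have h2 := Γ.stable v
    simp only [cyc]
    omega

theorem toStable_loop (v : Fin Γ.m) :
    Γ.toStable.loop v + 1 = 2 * Γ.gen v + Γ.bdry v + numCycles (Γ.cyc v) := by
  have h1 := Γ.pos v
  simp only [toStable, cyc]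
  omega

/-- The flow has natural exponents while `genus` is a rational number; integrality and nonnegativity
ensure that no connected ribbon graph is left out. -/
theorem exists_genus (h : Γ.Connected) : ∃ g : ℕ, Γ.genus = g := by
  obtain ⟨g, hg⟩ := Γ.toHalfEdgeGraph.exists_genus Γ.c Γ.ρ_c
  refine ⟨g + ∑ v, Γ.gen v, ?_⟩
  rw [h] at hg
  have hg' : (2 * g + 2 * Γ.m + numCycles (Γ.c * Γ.κ) : ℚ) =
      2 * 1 + Γ.numEdges + numCycles Γ.c := by exact_mod_cast hg
  rw [genus]
  push_cast
  linarith

/-- Contracting `{h, κ h}` means multiplying by its transposition and removing its two half-edges.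
The other transpositions fix both half-edges, so all removals can be postponed until `c` has been
multiplied by the whole of `κ`; removing points does not separate the points that remain. -/
theorem contractedPerm_sameCycle {x y : Fin Γ.n} (hx : Γ.κ x = x) (hy : Γ.κ y = y)
    (h : (Γ.c * Γ.κ).SameCycle x y) : Γ.contractedPerm.SameCycle x y := by
  have key : ∀ (L : List (Fin Γ.n)) (π : Perm (Fin Γ.n)), L.Nodup → (∀ h ∈ L, h < Γ.κ h) →
      (π * (L.map fun h => swap h (Γ.κ h)).prod).SameCycle x y →
      (L.foldl (fun π h => contractPair π h (Γ.κ h)) π).SameCycle x y := by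
    intro L
    induction L with
    | nil => intro π _ _ h; simpa using h
    | cons a L ih =>
      intro π hL hlt h
      rw [List.foldl_cons]
      have hlt' : ∀ h ∈ L, h < Γ.κ h := fun h hh => hlt h (List.mem_cons_of_mem _ hh)
      have haκ : a < Γ.κ a := hlt a List.mem_cons_self
      have haL : a ∉ L := (List.nodup_cons.mp hL).1
      have hκaL : Γ.κ a ∉ L := fun hm => by
        have := hlt' _ hm
        rw [Γ.κ_κ] at this
        exact absurd haκ this.not_gt
      refine ih _ hL.of_cons hlt' ?_
      have h1 : (L.map fun h => swap h (Γ.κ h)).prod a = a := by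
        rw [Γ.prod_swap_apply L hL.of_cons hlt', if_neg (by tauto)]
      have h2 : (L.map fun h => swap h (Γ.κ h)).prod (Γ.κ a) = Γ.κ a := by
        rw [Γ.prod_swap_apply L hL.of_cons hlt', if_neg (by rw [Γ.κ_κ]; tauto)]
      rw [contractPair, ← spliceOut_mul _ _ h2, ← spliceOut_mul _ _ h1, mul_assoc,
        ← List.prod_cons]
      have hne : ∀ z, Γ.κ z = z → z ≠ a ∧ z ≠ Γ.κ a := by
        intro z hz
        refine ⟨fun e => ?_, fun e => ?_⟩
        · rw [← e, hz] at haκ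
          exact haκ.false
        · rw [e, Γ.κ_κ] at hz
          exact haκ.ne hz
      exact sameCycle_spliceOut (sameCycle_spliceOut h (hne x hx).1 (hne y hy).1)
        (hne x hx).2 (hne y hy).2
  refine key Γ.edgeList Γ.c Γ.nodup_edgeList (fun h hh => Γ.mem_edgeList.mp hh) ?_
  rw [Γ.prod_swap_edgeList]
  exact h

/-- Different cycles of legs lie on different boundary cycles, by `contractedPerm_sameCycle`. This
makes the free boundary nonnegative. -/
theorem numCycles_legPerm_le : numCycles Γ.legPerm ≤ numCycles (Γ.c * Γ.κ) := by
  refine Nat.card_le_card_of_injective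
    (fun q => Quotient.mk (Perm.SameCycle.setoid (Γ.c * Γ.κ)) q.out.1) fun p q h => ?_
  have h' : (Γ.c * Γ.κ).SameCycle p.out.1 q.out.1 := Quotient.exact h
  rw [← Quotient.out_eq p, ← Quotient.out_eq q]
  exact Quotient.sound (s := Perm.SameCycle.setoid Γ.legPerm) (Perm.sameCycle_subtypePerm.mpr
    (Γ.contractedPerm_sameCycle p.out.2 q.out.2 h'))

theorem exists_freeBoundary : ∃ b : ℕ, Γ.freeBoundary = b := by
  refine ⟨Γ.totalBoundary - numCycles Γ.legPerm, ?_⟩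
  have := Γ.numCycles_legPerm_le
  rw [freeBoundary, Nat.cast_sub]
  rw [totalBoundary]
  omega

/-- In `2g + b + k` the numbers of boundary cycles and of leg cycles cancel, leaving `2 - 2V + E +
|C| + 2 ∑ g(v) + ∑ b(v)`. Summing `l(v) + 1 = 2g(v) + b(v) + |C(v)|` over the vertices turns this
into `(E - V + 1) + ∑ l(v) + 1`. -/
theorem loopNumber_toStable (h : Γ.Connected) {g b : ℕ} (hg : Γ.genus = g)
    (hb : Γ.freeBoundary = b) :
    Γ.toStable.loopNumber = 2 * g + b + numCycles Γ.legPerm - 1 := by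
  have h1 : ∑ v, ((Γ.toStable.loop v : ℤ) + 1) =
      ∑ v, (2 * (Γ.gen v : ℤ) + Γ.bdry v + numCycles (Γ.cyc v)) :=
    Finset.sum_congr rfl fun v _ => by exact_mod_cast Γ.toStable_loop v
  have h2 : (∑ v, (numCycles (Γ.cyc v) : ℤ)) = numCycles Γ.c := by
    exact_mod_cast Γ.sum_numCycles_vertexPerm Γ.c Γ.ρ_c
  simp only [Finset.sum_add_distrib, ← Finset.mul_sum, h2] at h1
  have h3 : Γ.toStable.betti = Γ.numEdges - Γ.m + 1 := by
    have : Γ.toStable.numComponents = 1 := h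
    rw [HalfEdgeGraph.betti, this]
    rfl
  have h4 : (2 * g : ℤ) = 2 - 2 * Γ.m + (Γ.numEdges + numCycles Γ.c - numCycles (Γ.c * Γ.κ)) +
      2 * ∑ v, (Γ.gen v : ℤ) := by
    have : (2 * g : ℚ) = 2 - 2 * Γ.m + (Γ.numEdges + numCycles Γ.c - numCycles (Γ.c * Γ.κ)) +
      2 * ∑ v, (Γ.gen v : ℚ) := by
      rw [← hg, genus]; ring
    exact_mod_cast this
  rw [freeBoundary, totalBoundary] at hb
  rw [StableGraph.loopNumber, h3]
  push_cast at hb h1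
  change _ + ∑ v : Fin Γ.m, (Γ.toStable.loop v : ℤ) = _
  change (∑ v : Fin Γ.m, (Γ.toStable.loop v : ℤ)) + ∑ v : Fin Γ.m, (1 : ℤ) = _ at h1
  simp only [Finset.sum_const, Finset.card_univ, Fintype.card_fin, nsmul_eq_mul, mul_one] at h1
  linarith

end RibbonGraph

end Genus

/-! ### Stability bounds and finiteness of the sums over graphs -/

section Finiteness

open Equiv

namespace StableGraph

variable {Γ : StableGraph}

theorem numEdges_add_sum_loop (h : Γ.Connected) {p : ℕ} (hp : Γ.loopNumber = p) :
    Γ.numEdges + ∑ v, Γ.loop v + 1 = p + Γ.m := by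
  have h1 : Γ.numComponents = 1 := h
  rw [loopNumber, HalfEdgeGraph.betti, h1] at hp
  zify
  push_cast at hp
  linarith

theorem three_mul_le : 3 * Γ.m ≤ 2 * ∑ v, Γ.loop v + Γ.n := by
  have h := Finset.sum_le_sum fun v (_ : v ∈ Finset.univ) => Γ.stable v
  rw [Finset.sum_add_distrib, Γ.sum_valency, ← Finset.mul_sum, Finset.sum_const,
    Finset.card_univ, Fintype.card_fin, smul_eq_mul] at h
  omega

/-- Stability summed over the vertices reads `3V ≤ 2 ∑ l(v) + |L| + 2E`. By connectedness `E + ∑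
l(v) = p + V - 1`, so the right side absorbs two of the three copies of `V`. -/
theorem m_add_two_le (h : Γ.Connected) {p : ℕ} (hp : Γ.loopNumber = p) :
    Γ.m + 2 ≤ 2 * p + Γ.numLegs := by
  have h1 := numEdges_add_sum_loop h hp
  have h2 := Γ.three_mul_le
  have h3 := Γ.card_halfEdges
  omega

theorem m_pos (h : Γ.Connected) : 0 < Γ.m := by
  rw [Nat.pos_iff_ne_zero]
  intro h0
  have h1 : Γ.numComponents = 1 := h
  have : IsEmpty (Fin Γ.m) := by rw [h0]; infer_instance
  rw [HalfEdgeGraph.numComponents, Nat.card_of_isEmpty] at h1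
  exact absurd h1 (by norm_num)

theorem three_le (h : Γ.Connected) {p : ℕ} (hp : Γ.loopNumber = p) : 3 ≤ 2 * p + Γ.numLegs := by
  have := m_pos h
  have := m_add_two_le h hp
  omega

end StableGraph

theorem finite_halfEdgeGraph (N : ℕ) : {Γ : HalfEdgeGraph | Γ.n ≤ N ∧ Γ.m ≤ N}.Finite := by
  let T := Σ n : Fin (N + 1), Σ m : Fin (N + 1), (Fin n → Fin m) × Perm (Fin n)
  -- The value `none` outside the bounds plays no role: injectivity is only needed on the bounded
  -- set.
  let f : HalfEdgeGraph → Option T := fun Γ =>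
    if h : Γ.n ≤ N ∧ Γ.m ≤ N then
      some ⟨⟨Γ.n, Nat.lt_succ_of_le h.1⟩, ⟨Γ.m, Nat.lt_succ_of_le h.2⟩, Γ.ρ, Γ.κ⟩
    else none
  refine Set.Finite.of_injOn (f := f) (t := Set.univ) (fun _ _ => Set.mem_univ _) ?_
    Set.finite_univ
  rintro ⟨n, m, ρ, κ, h⟩ hΓ ⟨n', m', ρ', κ', h'⟩ hΓ' he
  simp only [f] at he
  simp only [Set.mem_ofPred_eq] at hΓ hΓ'
  rw [dif_pos hΓ, dif_pos hΓ'] at he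
  have he := Option.some.inj he
  obtain ⟨he', he⟩ := Sigma.mk.inj he
  obtain rfl := Fin.mk.inj he'
  replace he := eq_of_heq he
  obtain ⟨he', he⟩ := Sigma.mk.inj he
  obtain rfl := Fin.mk.inj he'
  replace he := eq_of_heq he
  simp only [Prod.mk.injEq] at he
  obtain ⟨rfl, rfl⟩ := he
  rfl

theorem finite_stableGraph (N : ℕ) :
    {Γ : StableGraph | (Γ.n ≤ N ∧ Γ.m ≤ N) ∧ ∀ v, Γ.loop v ≤ N}.Finite := by
  have hfin : Finite {Γ : HalfEdgeGraph // Γ.n ≤ N ∧ Γ.m ≤ N} :=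
    (finite_halfEdgeGraph N).to_subtype
  let T := Σ Γ : {Γ : HalfEdgeGraph // Γ.n ≤ N ∧ Γ.m ≤ N}, (Fin Γ.1.m → Fin (N + 1))
  have : Finite T := inferInstanceAs (Finite (Σ _ : _, _))
  let f : StableGraph → Option T := fun Γ =>
    if h : (Γ.n ≤ N ∧ Γ.m ≤ N) ∧ ∀ v, Γ.loop v ≤ N then
      some ⟨⟨Γ.toHalfEdgeGraph, h.1⟩, fun v => ⟨Γ.loop v, Nat.lt_succ_of_le (h.2 v)⟩⟩
    else none
  refine Set.Finite.of_injOn (f := f) (t := Set.univ) (fun _ _ => Set.mem_univ _) ?_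
    Set.finite_univ
  rintro ⟨G, l, s⟩ hΓ ⟨G', l', s'⟩ hΓ' he
  simp only [f] at he
  simp only [Set.mem_ofPred_eq] at hΓ hΓ'
  rw [dif_pos hΓ, dif_pos hΓ'] at he
  have he := Option.some.inj he
  obtain ⟨he', he⟩ := Sigma.mk.inj he
  obtain rfl := Subtype.mk.inj he'
  replace he := eq_of_heq he
  obtain rfl : l = l' := by
    funext v
    simpa using congrFun he v
  rfl

theorem finite_ribbonGraph (N : ℕ) :
    {Γ : RibbonGraph | (Γ.n ≤ N ∧ Γ.m ≤ N) ∧ ∀ v, Γ.gen v ≤ N ∧ Γ.bdry v ≤ N}.Finite := by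
  have hfin : Finite {Γ : HalfEdgeGraph // Γ.n ≤ N ∧ Γ.m ≤ N} :=
    (finite_halfEdgeGraph N).to_subtype
  let T := Σ Γ : {Γ : HalfEdgeGraph // Γ.n ≤ N ∧ Γ.m ≤ N},
    Perm (Fin Γ.1.n) × (Fin Γ.1.m → Fin (N + 1) × Fin (N + 1))
  have : Finite T := inferInstanceAs (Finite (Σ _ : _, _))
  let f : RibbonGraph → Option T := fun Γ =>
    if h : (Γ.n ≤ N ∧ Γ.m ≤ N) ∧ ∀ v, Γ.gen v ≤ N ∧ Γ.bdry v ≤ N then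
      some ⟨⟨Γ.toHalfEdgeGraph, h.1⟩, Γ.c, fun v =>
        (⟨Γ.gen v, Nat.lt_succ_of_le (h.2 v).1⟩, ⟨Γ.bdry v, Nat.lt_succ_of_le (h.2 v).2⟩)⟩
    else none
  refine Set.Finite.of_injOn (f := f) (t := Set.univ) (fun _ _ => Set.mem_univ _) ?_
    Set.finite_univ
  rintro ⟨G, c, _, g, b, _, _⟩ hΓ ⟨G', c', _, g', b', _, _⟩ hΓ' he
  simp only [f] at he
  simp only [Set.mem_ofPred_eq] at hΓ hΓ'
  rw [dif_pos hΓ, dif_pos hΓ'] at he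
  have he := Option.some.inj he
  obtain ⟨he', he⟩ := Sigma.mk.inj he
  obtain rfl := Subtype.mk.inj he'
  replace he := eq_of_heq he
  simp only [Prod.mk.injEq] at he
  obtain ⟨rfl, he⟩ := he
  have h1 : ∀ v, g v = g' v ∧ b v = b' v := fun v => by simpa using congrFun he v
  obtain rfl : g = g' := funext fun v => (h1 v).1
  obtain rfl : b = b' := funext fun v => (h1 v).2
  rfl

/-- The factor `10` is generous: the bound on `V` controls `E` and all loop numbers through `E + ∑
l(v) + 1 = p + V`. -/
theorem StableGraph.bounds {Γ : StableGraph} (h : Γ.Connected) {p : ℕ} (hp : Γ.loopNumber = p) :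
    (Γ.n ≤ 10 * (p + Γ.numLegs) ∧ Γ.m ≤ 10 * (p + Γ.numLegs)) ∧
      ∀ v, Γ.loop v ≤ 10 * (p + Γ.numLegs) := by
  have h1 := StableGraph.numEdges_add_sum_loop h hp
  have h2 := StableGraph.m_add_two_le h hp
  have h3 := Γ.card_halfEdges
  refine ⟨⟨by omega, by omega⟩, fun v => ?_⟩
  have := Finset.single_le_sum (f := Γ.loop) (fun _ _ => Nat.zero_le _) (Finset.mem_univ v)
  omega

theorem finite_stable (p q : ℕ) : {Γ : Quotient StableGraph.setoid |
    Γ.out.Connected ∧ Γ.out.loopNumber = p ∧ Γ.out.numLegs = q}.Finite := by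
  refine Set.Finite.of_injOn (f := Quotient.out) (t := {Γ : StableGraph |
    (Γ.n ≤ 10 * (p + q) ∧ Γ.m ≤ 10 * (p + q)) ∧ ∀ v, Γ.loop v ≤ 10 * (p + q)}) ?_
    Quotient.out_injective.injOn (finite_stableGraph _)
  rintro Γ ⟨h, hp, rfl⟩
  exact StableGraph.bounds h hp

/-- The sizes are controlled by the underlying stable graph, and `g(v)` and `b(v)` are at most `l(v)
+ 1`, which accounts for the extra `1`. -/
theorem finite_ribbon (p q : ℕ) : {Γ : Quotient RibbonGraph.setoid |
    Γ.out.Connected ∧ Γ.out.toStable.loopNumber = p ∧ Γ.out.numLegs = q}.Finite := by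
  refine Set.Finite.of_injOn (f := Quotient.out) (t := {Γ : RibbonGraph |
    (Γ.n ≤ 20 * (p + q) + 1 ∧ Γ.m ≤ 20 * (p + q) + 1) ∧
      ∀ v, Γ.gen v ≤ 20 * (p + q) + 1 ∧ Γ.bdry v ≤ 20 * (p + q) + 1}) ?_
    Quotient.out_injective.injOn (finite_ribbonGraph _)
  rintro Γ ⟨h, hp, rfl⟩
  obtain ⟨⟨h1, h2⟩, h3⟩ := StableGraph.bounds (Γ := Γ.out.toStable) h hp
  change Γ.out.n ≤ 10 * (p + Γ.out.numLegs) at h1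
  change Γ.out.m ≤ 10 * (p + Γ.out.numLegs) at h2
  change ∀ v, _ ≤ 10 * (p + Γ.out.numLegs) at h3
  refine ⟨⟨by omega, by omega⟩, fun v => ?_⟩
  have := h3 v
  have := Γ.out.toStable_loop v
  constructor <;> omega

/-- A half-edge lies on some boundary cycle; without half-edges a vertex has no cycles, and
positivity of `|C(v)| + b(v)` gives `b(v) > 0`. This rules out terms with `j = k = 0` in the
noncommutative flow. -/
theorem RibbonGraph.totalBoundary_pos {Γ : RibbonGraph} (h : Γ.Connected) :
    0 < Γ.totalBoundary := by
  rw [totalBoundary]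
  rcases isEmpty_or_nonempty (Fin Γ.n) with hn | hn
  · have hm : 0 < Γ.m := StableGraph.m_pos (Γ := Γ.toStable) h
    have h1 : numCycles (Γ.vertexPerm Γ.c Γ.ρ_c ⟨0, hm⟩) = 0 := by
      have : IsEmpty (Γ.Fiber ⟨0, hm⟩) := ⟨fun x => hn.false x.1⟩
      rw [numCycles_eq_card_quot, Nat.card_of_isEmpty]
    have h2 := Γ.pos ⟨0, hm⟩
    have := Finset.single_le_sum (f := Γ.bdry) (fun _ _ => Nat.zero_le _)
      (Finset.mem_univ ⟨0, hm⟩)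
    omega
  · have : 0 < numCycles (Γ.c * Γ.κ) := by
      rw [numCycles_eq_card_quot]
      have : Nonempty (Quot fun x y => (Γ.c * Γ.κ) x = y) := hn.map (Quot.mk _)
      exact Nat.card_pos
    omega

theorem RibbonGraph.one_le {Γ : RibbonGraph} (h : Γ.Connected) {j : ℕ}
    (hj : Γ.freeBoundary = j) : 1 ≤ j + numCycles Γ.legPerm := by
  have := totalBoundary_pos h
  rw [freeBoundary] at hj
  omega

theorem RibbonGraph.loopNumber_eq {Γ : RibbonGraph} (h : Γ.Connected) {i j p : ℕ}
    (hi : Γ.genus = i) (hj : Γ.freeBoundary = j) :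
    Γ.toStable.loopNumber = p ↔ 2 * i + j + numCycles Γ.legPerm = p + 1 := by
  rw [Γ.loopNumber_toStable h hi hj]
  omega

theorem RibbonGraph.three_le {Γ : RibbonGraph} (h : Γ.Connected) {i j : ℕ} (hi : Γ.genus = i)
    (hj : Γ.freeBoundary = j) :
    (3 : ℤ) ≤ 2 * (2 * i + j + numCycles Γ.legPerm - 1) + Γ.numLegs := by
  have h1 := one_le h hj
  have h4 := StableGraph.three_le (Γ := Γ.toStable) h
    ((loopNumber_eq h hi hj (p := 2 * i + j + numCycles Γ.legPerm - 1)).mpr (by omega))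
  change 3 ≤ 2 * _ + Γ.numLegs at h4
  omega

theorem finite_ribbon' (i j k l : ℕ) : {Γ : Quotient RibbonGraph.setoid |
    Γ.out.Connected ∧ Γ.out.genus = i ∧ Γ.out.freeBoundary = j ∧
      numCycles Γ.out.legPerm = k ∧ Γ.out.numLegs = l}.Finite := by
  -- For graphs in the set the subtraction is not truncated, by `RibbonGraph.one_le`.
  refine (finite_ribbon (2 * i + j + k - 1) l).subset ?_
  rintro Γ ⟨h, hi, hj, rfl, rfl⟩
  have := RibbonGraph.one_le h hj
  exact ⟨h, (RibbonGraph.loopNumber_eq h hi hj).mpr (by omega), rfl⟩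

end Finiteness

/-! ### Koszul signs of block permutations -/

section Signs

open Equiv

/-- The Koszul sign of exchanging two factors of parities `a` and `b`. -/
def exchangeSign (a b : ZMod 2) : ℤ := if a = 1 ∧ b = 1 then -1 else 1

theorem exchangeSign_add_left (a b c : ZMod 2) :
    exchangeSign (a + b) c = exchangeSign a c * exchangeSign b c := by
  revert a b c; decide

theorem exchangeSign_comm (a b : ZMod 2) : exchangeSign a b = exchangeSign b a := by
  revert a b; decide

theorem exchangeSign_mul_self (a b : ZMod 2) : exchangeSign a b * exchangeSign a b = 1 := by
  revert a b; decide

theorem exchangeSign_sum_left {α : Type*} (s : Finset α) (x : α → ZMod 2) (c : ZMod 2) :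
    exchangeSign (∑ a ∈ s, x a) c = ∏ a ∈ s, exchangeSign (x a) c := by
  classical
  induction s using Finset.induction_on with
  | empty => simp [exchangeSign]
  | insert a s ha ih => rw [Finset.sum_insert ha, Finset.prod_insert ha, exchangeSign_add_left, ih]

theorem exchangeSign_sum_sum {α β : Type*} (s : Finset α) (t : Finset β) (x : α → ZMod 2)
    (y : β → ZMod 2) : exchangeSign (∑ a ∈ s, x a) (∑ b ∈ t, y b) =
      ∏ a ∈ s, ∏ b ∈ t, exchangeSign (x a) (y b) := by
  rw [exchangeSign_sum_left]
  refine Finset.prod_congr rfl fun a _ => ?_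
  rw [exchangeSign_comm, exchangeSign_sum_left]
  exact Finset.prod_congr rfl fun b _ => exchangeSign_comm _ _

theorem koszulSign_eq {ι κ : Type*} [Fintype ι] [LinearOrder ι] [LinearOrder κ] (e : ι ≃ κ)
    (δ : κ → ZMod 2) : koszulSign e δ =
      ∏ i, ∏ j, if i < j ∧ e j < e i then exchangeSign (δ (e i)) (δ (e j)) else 1 := by
  refine Finset.prod_congr rfl fun i _ => Finset.prod_congr rfl fun j _ => ?_
  simp only [exchangeSign, ← ite_and, and_assoc]

/-- The lexicographic bijection determined by a bijection of indices and bijections of the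
fibers. -/
def sigmaLexCongr {ι κ : Type*} {α : ι → Type*} {β : κ → Type*} (e : ι ≃ κ)
    (f : ∀ i, α i ≃ β (e i)) : (Σₗ i, α i) ≃ Σₗ k, β k :=
  toLex.symm.trans ((Equiv.sigmaCongr e f).trans toLex)

theorem sigmaLexCongr_apply {ι κ : Type*} {α : ι → Type*} {β : κ → Type*} (e : ι ≃ κ)
    (f : ∀ i, α i ≃ β (e i)) (i : ι) (a : α i) :
    sigmaLexCongr e f (toLex ⟨i, a⟩) = toLex ⟨e i, f i a⟩ := rfl

theorem toLex_sigma_lt {ι : Type*} {α : ι → Type*} [LinearOrder ι] [∀ i, LinearOrder (α i)]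
    {i j : ι} {a : α i} {b : α j} : (toLex ⟨i, a⟩ : Σₗ i, α i) < toLex ⟨j, b⟩ ↔
      i < j ∨ ∃ h : i = j, h.rec a < b :=
  Sigma.Lex.lt_def

/-- An inversion for the lexicographic orders lies either inside one block or between two inverted
blocks. All pairs between two inverted blocks are inverted, and bimultiplicativity of `exchangeSign`
collects them into the sign of the total parities. -/
theorem koszulSign_sigmaLexCongr {ι κ : Type*} {α : ι → Type*} {β : κ → Type*} [Fintype ι]
    [LinearOrder ι] [LinearOrder κ] [∀ i, Fintype (α i)] [∀ i, LinearOrder (α i)]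
    [∀ k, Fintype (β k)] [∀ k, LinearOrder (β k)] (e : ι ≃ κ) (f : ∀ i, α i ≃ β (e i))
    (δ : (Σₗ k, β k) → ZMod 2) :
    koszulSign (sigmaLexCongr e f) δ =
      koszulSign e (fun k => ∑ b, δ (toLex ⟨k, b⟩)) *
        ∏ i, koszulSign (f i) fun b => δ (toLex ⟨e i, b⟩) := by
  have h1 : ∀ F : (Σₗ i, α i) → ℤ, ∏ x, F x = ∏ i, ∏ a, F (toLex ⟨i, a⟩) := by
    intro F
    rw [← Fintype.prod_sigma' (f := fun i a => F (toLex ⟨i, a⟩))]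
    exact (Fintype.prod_equiv toLex _ _ fun _ => rfl).symm
  have h2 : ∀ i j, ∏ a, ∏ b, (if (toLex ⟨i, a⟩ : Σₗ i, α i) < toLex ⟨j, b⟩ ∧
        sigmaLexCongr e f (toLex ⟨j, b⟩) < sigmaLexCongr e f (toLex ⟨i, a⟩) then
        exchangeSign (δ (sigmaLexCongr e f (toLex ⟨i, a⟩)))
          (δ (sigmaLexCongr e f (toLex ⟨j, b⟩))) else 1) =
      (if i < j ∧ e j < e i then exchangeSign (∑ b, δ (toLex ⟨e i, b⟩))
        (∑ b, δ (toLex ⟨e j, b⟩)) else 1) *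
      (if i = j then koszulSign (f i) fun b => δ (toLex ⟨e i, b⟩) else 1) := by
    intro i j
    simp only [sigmaLexCongr_apply, toLex_sigma_lt]
    by_cases hij : i = j
    · subst hij
      simp [koszulSign_eq]
    · have hij' : e i ≠ e j := e.injective.ne hij
      have hij'' : e j ≠ e i := hij'.symm
      simp only [hij, hij'', IsEmpty.exists_iff, or_false, if_false, mul_one]
      split_ifs with h
      · rw [← (f i).sum_comp, ← (f j).sum_comp, exchangeSign_sum_sum]
      · simp
  rw [koszulSign_eq, h1, koszulSign_eq, ← Finset.prod_mul_distrib]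
  refine Finset.prod_congr rfl fun i _ => ?_
  have h3 : ∏ j, (if i = j then koszulSign (f i) fun b => δ (toLex ⟨e i, b⟩) else 1) =
      koszulSign (f i) fun b => δ (toLex ⟨e i, b⟩) := by simp
  rw [← h3, ← Finset.prod_mul_distrib]
  simp only [h1]
  rw [Finset.prod_comm]
  exact Finset.prod_congr rfl fun j _ => h2 i j

/-- The exchanged pair is the only inversion. -/
theorem koszulSign_adjacent {n : ℕ} (i : Fin n) (δ : Fin (n + 1) → ZMod 2) :
    koszulSign (swap i.castSucc i.succ) δ = exchangeSign (δ i.castSucc) (δ i.succ) := by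
  have key : ∀ a b : Fin (n + 1), a < b ∧ swap i.castSucc i.succ b < swap i.castSucc i.succ a →
      a = i.castSucc ∧ b = i.succ := by
    rintro a b ⟨h1, h2⟩
    rw [swap_apply_def, swap_apply_def] at h2
    rw [Fin.lt_def] at h1 h2
    split_ifs at h2 with h3 h4 h5 h6 h7 h8 h9 <;> simp only [Fin.ext_iff, Fin.val_castSucc,
      Fin.val_succ] at * <;> omega
  rw [koszulSign_eq, Finset.prod_eq_single i.castSucc, Finset.prod_eq_single i.succ]
  · rw [if_pos]
    · rw [swap_apply_left, swap_apply_right, exchangeSign_comm]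
    · simp
  · intro b _ hb
    exact if_neg fun h => hb (key _ _ h).2
  · simp
  · intro a _ ha
    exact Finset.prod_eq_one fun b _ => if_neg fun h => ha (key _ _ h).1
  · simp

end Signs

/-! ### Reduction to arguments of pure parity -/

section Parity

variable {𝕜 E A : Type*} [RCLike 𝕜]
  [AddCommGroup E] [Module 𝕜 E] [TopologicalSpace E] [IsTopologicalAddGroup E]
  [Ring A] [Algebra 𝕜 A] [UniformSpace A] [IsUniformAddGroup A] [ContinuousSMul 𝕜 A]

/-- `x` is homogeneous of parity `ε`. -/
def FinGrading.IsPar {V : Type*} [AddCommGroup V] [Module 𝕜 V] [TopologicalSpace V]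
    [IsTopologicalAddGroup V] (g : FinGrading 𝕜 V) (ε : ZMod 2) (x : V) : Prop := g.par ε x = x

theorem FinGrading.isPar_par {V : Type*} [AddCommGroup V] [Module 𝕜 V] [TopologicalSpace V]
    [IsTopologicalAddGroup V] (g : FinGrading 𝕜 V) (ε : ZMod 2) (x : V) :
    g.IsPar ε (g.par ε x) := by
  rw [IsPar, g.par_par, if_pos rfl]

theorem FinGrading.IsPar.par_of_ne {V : Type*} [AddCommGroup V] [Module 𝕜 V] [TopologicalSpace V]
    [IsTopologicalAddGroup V] {g : FinGrading 𝕜 V} {ε ε' : ZMod 2} {x : V} (h : g.IsPar ε x)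
    (hne : ε' ≠ ε) : g.par ε' x = 0 := by
  rw [← h, g.par_par, if_neg hne]

variable (g : FinGrading 𝕜 E) {ι κ : Type*}

/-- This reduces identities between functionals to arguments of pure parity, on which `transport` is
a single signed reindexing. -/
theorem multiFun_ext [Fintype ι] {f f' : MultiFun 𝕜 E A ι}
    (h : ∀ (δ : ι → ZMod 2) (y : ι → E), (∀ i, g.IsPar (δ i) (y i)) → f y = f' y) : f = f' := by
  classical
  ext y
  have h1 : y = fun i => ∑ ε, g.par ε (y i) := funext fun i => (g.sum_par (y i)).symm
  rw [h1, f.map_sum (fun i ε => g.par ε (y i)), f'.map_sum (fun i ε => g.par ε (y i))]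
  exact Finset.sum_congr rfl fun δ _ => h δ _ fun i => g.isPar_par _ _

theorem transport_apply_of_isPar [Fintype ι] [LinearOrder ι] [Fintype κ] [LinearOrder κ]
    (e : ι ≃ κ) (f : MultiFun 𝕜 E A ι) {δ : κ → ZMod 2} {y : κ → E}
    (h : ∀ k, g.IsPar (δ k) (y k)) : transport g e f y = koszulSign e δ • f (y ∘ e) := by
  rw [transport_apply, Finset.sum_eq_single δ]
  · congr 2
    funext i
    exact h (e i)
  · intro δ' _ hne
    obtain ⟨k, hk⟩ := Function.ne_iff.mp hne
    rw [f.map_coord_zero (e.symm k), smul_zero]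
    rw [e.apply_symm_apply]
    exact (h k).par_of_ne hk
  · simp

theorem symClass_transport {n : ℕ} (σ : Equiv.Perm (Fin n)) (f : MultiFun 𝕜 E A (Fin n)) :
    symClass g (transport g σ f) = symClass g f := by
  rw [symClass, symClass, ← sub_eq_zero, ← map_sub, Submodule.mkQ_apply,
    Submodule.Quotient.mk_eq_zero]
  exact Submodule.subset_span ⟨σ, f, rfl⟩

end Parity

/-! ### Reordering products in a graded commutative algebra -/

section GradedProducts

open Equiv

variable {𝕜 A : Type*} [RCLike 𝕜] [Ring A] [Algebra 𝕜 A] [UniformSpace A] [IsUniformAddGroup A]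
  {gA : FinGrading 𝕜 A}

theorem FinGrading.IsHomog.isPar {V : Type*} [AddCommGroup V] [Module 𝕜 V] [TopologicalSpace V]
    [IsTopologicalAddGroup V] {g : FinGrading 𝕜 V} {d : ℤ} {x : V} (h : g.IsHomog d x) :
    g.IsPar (d : ZMod 2) x := by
  rw [IsPar, FinGrading.par, sum_apply]
  have h1 : ∀ i, g.proj i x = if i = d then x else 0 := fun i => by
    have := g.proj_proj i d x
    rw [h] at this
    exact this
  simp only [h1, Finset.sum_ite_eq', Finset.mem_filter, and_true]
  split_ifs with h2
  · rfl
  · rw [← h, g.proj_of_notMem d h2]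

theorem FinGrading.IsPar.eq_sum {V : Type*} [AddCommGroup V] [Module 𝕜 V] [TopologicalSpace V]
    [IsTopologicalAddGroup V] {g : FinGrading 𝕜 V} {ε : ZMod 2} {x : V} (h : g.IsPar ε x) :
    x = ∑ i ∈ g.degs.filter fun i : ℤ => (i : ZMod 2) = ε, g.proj i x := by
  conv_lhs => rw [← h]
  rw [FinGrading.par, sum_apply]

theorem FinGrading.isHomog_proj {V : Type*} [AddCommGroup V] [Module 𝕜 V] [TopologicalSpace V]
    (g : FinGrading 𝕜 V) (d : ℤ) (x : V) : g.IsHomog d (g.proj d x) := by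
  rw [IsHomog, g.proj_proj, if_pos rfl]

theorem FinGrading.IsPar.sum {V α : Type*} [AddCommGroup V] [Module 𝕜 V] [TopologicalSpace V]
    [IsTopologicalAddGroup V] {g : FinGrading 𝕜 V} {ε : ZMod 2} {s : Finset α} {x : α → V}
    (h : ∀ i ∈ s, g.IsPar ε (x i)) : g.IsPar ε (∑ i ∈ s, x i) := by
  rw [IsPar, map_sum]
  exact Finset.sum_congr rfl h

theorem negOnePow_mul (i j : ℤ) :
    (((i * j).negOnePow : ℤˣ) : ℤ) = exchangeSign (i : ZMod 2) (j : ZMod 2) := by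
  have h : ∀ i : ℤ, ((i : ZMod 2) = 1) ↔ Odd i := fun i => ZMod.intCast_eq_one_iff_odd
  simp only [exchangeSign, h]
  split_ifs with hij
  · rw [Int.negOnePow_odd _ (hij.1.mul hij.2)]; rfl
  · rw [Int.negOnePow_even]; · rfl
    rw [← Int.not_odd_iff_even, Int.odd_mul]
    exact hij

theorem FinGrading.IsPar.mul_comm (hA : gA.IsGradedCommAlgebra) {ε η : ZMod 2} {a b : A}
    (ha : gA.IsPar ε a) (hb : gA.IsPar η b) : a * b = exchangeSign ε η • (b * a) := by
  rw [ha.eq_sum, hb.eq_sum, Finset.sum_mul_sum, Finset.sum_mul_sum, Finset.smul_sum,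
    Finset.sum_comm]
  refine Finset.sum_congr rfl fun j hj => ?_
  rw [Finset.smul_sum]
  refine Finset.sum_congr rfl fun i hi => ?_
  rw [hA.mul_comm i j _ _ (gA.isHomog_proj _ _) (gA.isHomog_proj _ _), negOnePow_mul,
    (Finset.mem_filter.mp hi).2, (Finset.mem_filter.mp hj).2]

theorem prod_ofFn_adjacent (hA : gA.IsGradedCommAlgebra) {n : ℕ} (i : Fin n)
    {a : Fin (n + 1) → A} {p : Fin (n + 1) → ZMod 2} (h : ∀ k, gA.IsPar (p k) (a k)) :
    (List.ofFn (a ∘ swap i.castSucc i.succ)).prod =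
      exchangeSign (p i.castSucc) (p i.succ) • (List.ofFn a).prod := by
  induction n with
  | zero => exact i.elim0
  | succ n ih =>
    rcases Fin.eq_zero_or_eq_succ i with rfl | ⟨j, rfl⟩
    · rw [List.ofFn_succ, List.ofFn_succ, List.ofFn_succ, List.ofFn_succ]
      have h1 : ∀ k : Fin n, swap (0 : Fin (n + 1)).castSucc (0 : Fin (n + 1)).succ k.succ.succ =
          k.succ.succ := fun k => swap_apply_of_ne_of_ne (by simp [Fin.ext_iff])
            (by simp [Fin.ext_iff])
      simp only [List.prod_cons, Function.comp_apply, h1]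
      have h2 : swap (0 : Fin (n + 1)).castSucc (0 : Fin (n + 1)).succ 0 = Fin.succ 0 :=
        swap_apply_left _ _
      have h3 : swap (0 : Fin (n + 1)).castSucc (0 : Fin (n + 1)).succ (Fin.succ 0) = 0 :=
        swap_apply_right _ _
      rw [h2, h3, ← mul_assoc, ← mul_assoc, (h 0).mul_comm hA (h (Fin.succ 0)), ← smul_mul_assoc,
        smul_smul, Fin.castSucc_zero, exchangeSign_mul_self, one_smul]
    · rw [List.ofFn_succ, List.ofFn_succ (f := a)]
      have h1 : swap j.succ.castSucc j.succ.succ 0 = 0 :=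
        swap_apply_of_ne_of_ne (by simp [Fin.ext_iff]) (by simp [Fin.ext_iff])
      have h2 : ∀ k : Fin (n + 1), swap j.succ.castSucc j.succ.succ k.succ =
          (swap j.castSucc j.succ k).succ := fun k => by
        rw [swap_apply_def, swap_apply_def, Fin.castSucc_succ]
        simp only [Fin.succ_inj]
        split_ifs <;> rfl
      simp only [List.prod_cons, Function.comp_apply, h1, h2]
      have := ih j (a := fun k => a k.succ) (p := fun k => p k.succ) fun k => h _
      rw [Function.comp_def] at this
      rw [this, mul_smul_comm, Fin.castSucc_succ]

/-- Adjacent transpositions generate the symmetric group, and the signs compose by the cocycle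
identity `koszulSign_trans`. -/
theorem prod_ofFn_perm (hA : gA.IsGradedCommAlgebra) {n : ℕ} (σ : Perm (Fin n))
    {a : Fin n → A} {p : Fin n → ZMod 2} (h : ∀ k, gA.IsPar (p k) (a k)) :
    (List.ofFn (a ∘ σ)).prod = koszulSign σ p • (List.ofFn a).prod := by
  rcases n with _ | n
  · simp [koszulSign]
  have hσ : σ ∈ Submonoid.closure
      (Set.range fun i : Fin n => swap i.castSucc i.succ) := by
    rw [Perm.mclosure_swap_castSucc_succ]
    trivial
  induction hσ using Submonoid.closure_induction generalizing a p with
  | mem σ hσ =>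
    obtain ⟨i, rfl⟩ := hσ
    dsimp only
    rw [prod_ofFn_adjacent hA i h, koszulSign_adjacent]
  | one =>
    have : koszulSign (1 : Perm (Fin (n + 1))) p = 1 := by
      refine Finset.prod_eq_one fun i _ => Finset.prod_eq_one fun j _ => if_neg ?_
      rintro ⟨h1, h2, -⟩
      exact absurd h1 h2.not_gt
    rw [this, one_smul]
    rfl
  | mul σ τ _ _ ih ih' =>
    have h1 := ih' (a := a ∘ σ) (p := p ∘ σ) fun k => h _
    rw [Function.comp_assoc] at h1
    rw [Perm.coe_mul, h1, ih h, smul_smul, mul_comm, ← koszulSign_trans]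
    rfl

theorem prod_ofFn_equiv (hA : gA.IsGradedCommAlgebra) {m n : ℕ} (e : Fin m ≃ Fin n)
    {a : Fin n → A} {p : Fin n → ZMod 2} (h : ∀ k, gA.IsPar (p k) (a k)) :
    (List.ofFn (a ∘ e)).prod = koszulSign e p • (List.ofFn a).prod := by
  obtain rfl : m = n := by simpa using Fintype.card_congr e
  exact prod_ofFn_perm hA e h

end GradedProducts

/-! ### Functionals and classes of degree zero -/

section DegreeZero

open Equiv

variable {𝕜 V : Type*} [RCLike 𝕜] [AddCommGroup V] [Module 𝕜 V] [TopologicalSpace V]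
  [IsTopologicalAddGroup V]

/-- The subspace of homogeneous elements of degree `d`. -/
def FinGrading.homogSubmodule (g : FinGrading 𝕜 V) (d : ℤ) : Submodule 𝕜 V :=
  LinearMap.eqLocus (g.proj d).toLinearMap LinearMap.id

theorem FinGrading.IsHomog.proj {g : FinGrading 𝕜 V} {d : ℤ} {x : V} (h : g.IsHomog d x) (i : ℤ) :
    g.IsHomog d (g.proj i x) := by
  rw [IsHomog, g.proj_proj]
  split_ifs with hi
  · rfl
  · rw [← h, g.proj_proj, if_neg (Ne.symm hi)]

theorem FinGrading.IsHomog.par {g : FinGrading 𝕜 V} {d : ℤ} {x : V} (h : g.IsHomog d x)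
    (ε : ZMod 2) : g.IsHomog d (g.par ε x) := by
  rw [FinGrading.par, sum_apply]
  exact Submodule.sum_mem (g.homogSubmodule d) fun i _ => h.proj i

variable {E A : Type*}
  [AddCommGroup E] [Module 𝕜 E] [TopologicalSpace E] [IsTopologicalAddGroup E]
  [Ring A] [Algebra 𝕜 A] [UniformSpace A] [IsUniformAddGroup A] [ContinuousSMul 𝕜 A]
  (gE : FinGrading 𝕜 E) (gA : FinGrading 𝕜 A)

/-- The subspace of functionals of degree zero. -/
def degZeroSubmodule (ι : Type*) [Fintype ι] : Submodule 𝕜 (MultiFun 𝕜 E A ι) where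
  carrier := {f | IsDegZero gE gA f}
  zero_mem' := fun _ _ _ => Submodule.zero_mem (gA.homogSubmodule _)
  add_mem' := fun hf hf' d x hx =>
    Submodule.add_mem (gA.homogSubmodule _) (hf d x hx) (hf' d x hx)
  smul_mem' := fun c _ hf d x hx => Submodule.smul_mem (gA.homogSubmodule _) c (hf d x hx)

variable {gE gA} {ι κ : Type*} [Fintype ι] [Fintype κ]

theorem IsDegZero.isPar {f : MultiFun 𝕜 E A ι} (hf : IsDegZero gE gA f) {δ : ι → ZMod 2}
    {y : ι → E} (h : ∀ i, gE.IsPar (δ i) (y i)) : gA.IsPar (∑ i, δ i) (f y) := by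
  classical
  have h1 : y = fun i => ∑ d ∈ gE.degs.filter (fun d : ℤ => (d : ZMod 2) = δ i),
      gE.proj d (y i) := funext fun i => (h i).eq_sum
  rw [h1, f.map_sum_finset]
  refine .sum fun r hr => ?_
  have h2 : ∑ i, δ i = ((∑ i, r i : ℤ) : ZMod 2) := by
    rw [Int.cast_sum]
    exact Finset.sum_congr rfl fun i _ =>
      (Finset.mem_filter.mp (Fintype.mem_piFinset.mp hr i)).2.symm
  rw [h2]
  exact (hf r _ fun i => gE.isHomog_proj _ _).isPar

theorem IsDegZero.transport [LinearOrder ι] [LinearOrder κ] {f : MultiFun 𝕜 E A ι}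
    (hf : IsDegZero gE gA f) (e : ι ≃ κ) : IsDegZero gE gA (transport gE e f) := by
  intro d x hx
  rw [transport_apply]
  refine Submodule.sum_mem (gA.homogSubmodule _) fun δ _ => zsmul_mem ?_ _
  have := hf (d ∘ e) (fun i => gE.par (δ (e i)) (x (e i))) fun i => (hx (e i)).par _
  rwa [show ∑ i, (d ∘ e) i = ∑ k, d k from e.sum_comp d] at this

theorem isDegZero_attachSym {X : Type*} [Fintype X] [LinearOrder X] {n : ℕ} {w : SymFun gE A n}
    (hw : SymDegZero gE gA w) : IsDegZero gE gA (attachSym (X := X) gE n w) := by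
  obtain ⟨f, hf, rfl⟩ := hw
  rw [attachSym, Submodule.mkQ_apply, Submodule.liftQ_apply, LinearMap.sum_apply]
  exact Submodule.sum_mem (degZeroSubmodule gE gA X) fun φ _ => hf.transport φ

theorem isDegZero_attachCyc {X : Type*} [Fintype X] [LinearOrder X] (cX : Perm X) {k l : ℕ}
    {w : CycFun gE A k l} (hw : CycDegZero gE gA w) :
    IsDegZero gE gA (attachCyc gE cX k l w) := by
  obtain ⟨f, hf, rfl⟩ := hw
  rw [attachCyc, Submodule.mkQ_apply, Submodule.liftQ_apply, LinearMap.sum_apply]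
  refine Submodule.sum_mem (degZeroSubmodule gE gA X) fun c _ => ?_
  rw [LinearMap.sum_apply]
  refine Submodule.sum_mem (degZeroSubmodule gE gA X) fun φ _ => ?_
  split_ifs
  · exact (hf c).transport φ
  · exact Submodule.zero_mem _

theorem isHomog_prod_ofFn (hA : gA.IsGradedCommAlgebra) {n : ℕ} {d : Fin n → ℤ} {a : Fin n → A}
    (h : ∀ i, gA.IsHomog (d i) (a i)) : gA.IsHomog (∑ i, d i) (List.ofFn a).prod := by
  induction n with
  | zero => simpa using hA.one_homog
  | succ n ih =>
    rw [List.ofFn_succ, List.prod_cons, Fin.sum_univ_succ]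
    exact hA.mul_homog _ _ _ _ (h 0) (ih fun i => h i.succ)

theorem symDegZero_symClass {n : ℕ} {f : MultiFun 𝕜 E A (Fin n)} (hf : IsDegZero gE gA f) :
    SymDegZero gE gA (symClass gE f) := ⟨f, hf, rfl⟩

theorem cycDegZero_cycClass {l : ℕ} (c : Perm (Fin l)) {f : MultiFun 𝕜 E A (Fin l)}
    (hf : IsDegZero gE gA f) : CycDegZero gE gA (cycClass gE c f) := by
  classical
  refine ⟨Pi.single ⟨c, rfl⟩ f, fun c' => ?_, rfl⟩
  rcases eq_or_ne c' ⟨c, rfl⟩ with rfl | h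
  · simpa using hf
  · rw [Pi.single_eq_of_ne h]
    exact Submodule.zero_mem (degZeroSubmodule gE gA _)

variable (gE gA)

/-- The subspace of classes of degree zero in the symmetric coinvariants. -/
def symDegZeroSubmodule (n : ℕ) : Submodule 𝕜 (SymFun gE A n) where
  carrier := {w | SymDegZero gE gA w}
  zero_mem' := ⟨0, Submodule.zero_mem (degZeroSubmodule gE gA _), map_zero _⟩
  add_mem' := by
    rintro _ _ ⟨f, hf, rfl⟩ ⟨f', hf', rfl⟩
    exact ⟨f + f', Submodule.add_mem (degZeroSubmodule gE gA _) hf hf', map_add _ _ _⟩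
  smul_mem' := by
    rintro c _ ⟨f, hf, rfl⟩
    exact ⟨c • f, Submodule.smul_mem (degZeroSubmodule gE gA _) c hf, map_smul _ _ _⟩

/-- The subspace of classes of degree zero in the cyclic coinvariants. -/
def cycDegZeroSubmodule (k l : ℕ) : Submodule 𝕜 (CycFun gE A k l) where
  carrier := {w | CycDegZero gE gA w}
  zero_mem' := ⟨0, fun _ => Submodule.zero_mem (degZeroSubmodule gE gA _), map_zero _⟩
  add_mem' := by
    rintro _ _ ⟨f, hf, rfl⟩ ⟨f', hf', rfl⟩
    exact ⟨f + f', fun c => Submodule.add_mem (degZeroSubmodule gE gA _) (hf c) (hf' c),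
      map_add _ _ _⟩
  smul_mem' := by
    rintro a _ ⟨f, hf, rfl⟩
    exact ⟨a • f, fun c => Submodule.smul_mem (degZeroSubmodule gE gA _) a (hf c),
      map_smul _ _ _⟩

variable {gE gA}

theorem symDegZero_cycToSym {k l : ℕ} {w : CycFun gE A k l} (hw : CycDegZero gE gA w) :
    SymDegZero gE gA (cycToSym gE k l w) := by
  obtain ⟨f, hf, rfl⟩ := hw
  refine ⟨∑ c, f c, Submodule.sum_mem (degZeroSubmodule gE gA _) fun c _ => hf c, ?_⟩
  simp [cycToSym]

end DegreeZero

/-! ### Renumbering the vertices in the product of the vertex functionals -/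

section VertexTensor

open Equiv

variable {𝕜 E A : Type*} [RCLike 𝕜]
  [AddCommGroup E] [Module 𝕜 E] [TopologicalSpace E] [IsTopologicalAddGroup E]
  [ContinuousSMul 𝕜 E] [FirstCountableTopology E]
  [Ring A] [Algebra 𝕜 A] [UniformSpace A] [IsUniformAddGroup A] [ContinuousSMul 𝕜 A]
  [ContinuousMul A] [PolynormableSpace 𝕜 A] [T2Space A] [CompleteSpace A]
  {gE : FinGrading 𝕜 E} {gA : FinGrading 𝕜 A}

theorem vertexTensor_apply (Γ : HalfEdgeGraph) (F : ∀ v, MultiFun 𝕜 E A (Γ.Fiber v))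
    (x : (Σₗ v : Fin Γ.m, Γ.Fiber v) → E) :
    vertexTensor Γ F x = (List.ofFn fun v => F v fun h => x (toLex ⟨v, h⟩)).prod := rfl

theorem vertexTensor_sum (Γ : HalfEdgeGraph) {α : Fin Γ.m → Type*} [∀ v, Fintype (α v)]
    (F : ∀ v, α v → MultiFun 𝕜 E A (Γ.Fiber v)) :
    vertexTensor Γ (fun v => ∑ a, F v a) =
      ∑ r : ∀ v, α v, vertexTensor Γ fun v => F v (r v) := by
  ext x
  rw [sum_apply]
  change ContinuousMultilinearMap.mkPiAlgebraFin 𝕜 Γ.m A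
    (fun v => (∑ a, F v a) fun h => x (toLex ⟨v, h⟩)) = _
  simp only [sum_apply]
  rw [ContinuousMultilinearMap.map_sum]
  rfl

theorem isDegZero_vertexTensor (hA : gA.IsGradedCommAlgebra) (Γ : HalfEdgeGraph)
    {F : ∀ v, MultiFun 𝕜 E A (Γ.Fiber v)} (hF : ∀ v, IsDegZero gE gA (F v)) :
    IsDegZero gE gA (vertexTensor Γ F) := by
  intro d x hx
  have := isHomog_prod_ofFn hA (d := fun v => ∑ h, d (toLex ⟨v, h⟩))
    fun v => hF v _ _ fun h => hx (toLex ⟨v, h⟩)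
  rw [vertexTensor_apply]
  convert this
  rw [← Fintype.sum_sigma' (f := fun v h => d (toLex ⟨v, h⟩))]
  exact (Fintype.sum_equiv toLex _ _ fun _ => rfl).symm

theorem koszulSign_mul_self {ι κ : Type*} [Fintype ι] [LinearOrder ι] [LinearOrder κ] (e : ι ≃ κ)
    (δ : κ → ZMod 2) : koszulSign e δ * koszulSign e δ = 1 := by
  rw [koszulSign_eq, ← Finset.prod_mul_distrib]
  refine Finset.prod_eq_one fun i _ => ?_
  rw [← Finset.prod_mul_distrib]
  refine Finset.prod_eq_one fun j _ => ?_
  split_ifs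
  · exact exchangeSign_mul_self _ _
  · rfl

theorem prod_ofFn_zsmul {R : Type*} [Ring R] {n : ℕ} (s : Fin n → ℤ) (a : Fin n → R) :
    (List.ofFn fun i => s i • a i).prod = (∏ i, s i) • (List.ofFn a).prod := by
  induction n with
  | zero => simp
  | succ n ih =>
    rw [List.ofFn_succ, List.ofFn_succ, List.prod_cons, List.prod_cons, ih, Fin.prod_univ_succ,
      smul_mul_smul_comm]

/-- Permuting the vertices costs one sign for the blocks of arguments and one for reordering the
values in `A`. A functional of degree zero takes values of the same total parity as its block of
arguments, so the two signs cancel; the signs inside the blocks are those of the vertex transports.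
-/
theorem vertexTensor_transport (hA : gA.IsGradedCommAlgebra) {Γ Γ' : HalfEdgeGraph}
    (e : Fin Γ.m ≃ Fin Γ'.m) (f : ∀ v, Γ.Fiber v ≃ Γ'.Fiber (e v))
    {F : ∀ v, MultiFun 𝕜 E A (Γ.Fiber v)} {F' : ∀ v, MultiFun 𝕜 E A (Γ'.Fiber v)}
    (hF : ∀ v, IsDegZero gE gA (F v)) (h : ∀ v, F' (e v) = transport gE (f v) (F v)) :
    vertexTensor Γ' F' = transport gE (sigmaLexCongr e f) (vertexTensor Γ F) := by
  refine multiFun_ext gE fun δ y hy => ?_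
  rw [transport_apply_of_isPar gE _ _ hy, vertexTensor_apply, vertexTensor_apply,
    koszulSign_sigmaLexCongr]
  have h1 : ∀ v, F' (e v) (fun h => y (toLex ⟨e v, h⟩)) =
      koszulSign (f v) (fun h => δ (toLex ⟨e v, h⟩)) •
        F v fun h => y (toLex ⟨e v, f v h⟩) := fun v => by
    rw [h, transport_apply_of_isPar gE (f v) (F v) fun h => hy (toLex ⟨e v, h⟩)]
    rfl
  have h2 : ∀ v', gA.IsPar (∑ h, δ (toLex ⟨v', h⟩)) (F' v' fun h => y (toLex ⟨v', h⟩)) := by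
    intro v'
    obtain ⟨v, rfl⟩ := e.surjective v'
    rw [h]
    exact ((hF v).transport _).isPar fun h => hy _
  have h3 := prod_ofFn_equiv hA e h2
  simp only [Function.comp_def, h1, prod_ofFn_zsmul] at h3
  rw [mul_smul]
  change _ = _ • _ • (List.ofFn fun v => F v fun h => y (toLex ⟨e v, f v h⟩)).prod
  rw [h3, smul_smul, koszulSign_mul_self, one_smul]

end VertexTensor

/-! ### Equicontinuity on the projective tensor product -/

section TensorSeminorms

variable {𝕜 X Y Z : Type*} [RCLike 𝕜]
  [AddCommGroup X] [Module 𝕜 X] [AddCommGroup Y] [Module 𝕜 Y] [AddCommGroup Z] [Module 𝕜 Z]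

theorem algTensor_induction {C : AlgTensor 𝕜 X Y Z → Prop} (h0 : C 0)
    (hp : ∀ x y z, C (pureTensor 𝕜 x y z)) (ha : ∀ u v, C u → C v → C (u + v))
    (u : AlgTensor 𝕜 X Y Z) : C u := by
  refine TensorProduct.induction_on (motive := C) u h0 (fun x w => ?_) ha
  refine TensorProduct.induction_on (motive := fun w => C (x ⊗ₜ[𝕜] w : X ⊗[𝕜] (Y ⊗[𝕜] Z)))
    w ?_ (fun y z => hp x y z) fun v v' hv hv' => ?_
  · rw [TensorProduct.tmul_zero]
    exact h0
  · rw [TensorProduct.tmul_add]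
    exact ha _ _ hv hv'

theorem pureTensor_smul (a b c : 𝕜) (x : X) (y : Y) (z : Z) :
    pureTensor 𝕜 (a • x) (b • y) (c • z) = (a * b * c) • pureTensor 𝕜 x y z := by
  rw [pureTensor, TensorProduct.smul_tmul_smul, TensorProduct.smul_tmul_smul, mul_assoc]
  rfl

variable [TopologicalSpace X] [TopologicalSpace Y] [TopologicalSpace Z]
  [IsTopologicalAddGroup X] [IsTopologicalAddGroup Y] [IsTopologicalAddGroup Z]
  [ContinuousSMul 𝕜 X] [ContinuousSMul 𝕜 Y] [ContinuousSMul 𝕜 Z]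

/-- A seminorm on `X ⊗ Y ⊗ Z` that is bounded by `1` on the elementary tensors near zero is
continuous for the projective topology. -/
theorem continuous_seminorm_pure (q : Seminorm 𝕜 (AlgTensor 𝕜 X Y Z)) {U : Set (X × Y × Z)}
    (hU : U ∈ nhds 0) (h : ∀ z ∈ U, q (pureTensor 𝕜 z.1 z.2.1 z.2.2) ≤ 1) :
    Continuous fun p : X × Y × Z => q (pureTensor 𝕜 p.1 p.2.1 p.2.2) := by
  rw [continuous_iff_continuousAt]
  rintro ⟨x₀, y₀, z₀⟩
  -- A small `c` moves the base point, and the points obtained from it by cancelling one coordinate,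
  -- into the neighbourhood where the bound is known.
  have hc : ∃ c : 𝕜, c ≠ 0 ∧ c • ((x₀, y₀, z₀) : X × Y × Z) ∈ interior U ∧
      c • ((0, y₀, z₀) : X × Y × Z) ∈ interior U ∧
      c • ((x₀, 0, z₀) : X × Y × Z) ∈ interior U ∧
      c • ((x₀, y₀, 0) : X × Y × Z) ∈ interior U := by
    have hi : interior U ∈ nhds (0 : X × Y × Z) := interior_mem_nhds.mpr hU
    have key : ∀ w : X × Y × Z, ∀ᶠ c : 𝕜 in nhdsWithin 0 {0}ᶜ, c • w ∈ interior U := by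
      intro w
      have : Filter.Tendsto (fun c : 𝕜 => c • w) (nhdsWithin 0 {0}ᶜ) (nhds 0) := by
        have h1 : Continuous fun c : 𝕜 => c • w := by fun_prop
        have h2 := h1.tendsto 0
        rw [zero_smul] at h2
        exact h2.mono_left nhdsWithin_le_nhds
      exact this hi
    obtain ⟨c, hc, h1, h2, h3, h4⟩ := (eventually_mem_nhdsWithin.and ((key (x₀, y₀, z₀)).and
      ((key (0, y₀, z₀)).and ((key (x₀, 0, z₀)).and (key (x₀, y₀, 0)))))).exists
    exact ⟨c, hc, h1, h2, h3, h4⟩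
  obtain ⟨c, hc0, -, hx, hy, hz⟩ := hc
  have bound : ∀ (d : 𝕜) (x : X) (y : Y) (z : Z) (a b e : 𝕜), d ≠ 0 → a * b * e = c ^ 3 * d →
      (a • x, b • y, e • z) ∈ interior U →
      q (pureTensor 𝕜 x y z) ≤ ‖c ^ 3 * d‖⁻¹ := by
    intro d x y z a b e hd habe hm
    have h1 := h _ (interior_subset hm)
    simp only [pureTensor_smul, habe, map_smul_eq_mul] at h1
    have h2 : 0 < ‖c ^ 3 * d‖ := norm_pos_iff.mpr (mul_ne_zero (pow_ne_zero _ hc0) hd)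
    rw [← one_div, le_div_iff₀ h2, mul_comm]
    exact h1
  rw [ContinuousAt, Metric.tendsto_nhds]
  intro ε hε
  -- In each of the three differences below, the increment is multiplied by an extra `d`. Since the
  -- increment vanishes at the base point, the rescaled points still lie in `U` nearby, and a large
  -- `d` makes the three bounds add up to less than `ε`.
  obtain ⟨d, hd0, hd⟩ : ∃ d : 𝕜, d ≠ 0 ∧ 3 * ‖c ^ 3 * d‖⁻¹ < ε := by
    have h1 : Filter.Tendsto (fun d : 𝕜 => 3 * ‖c ^ 3 * d‖⁻¹) (Bornology.cobounded 𝕜)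
        (nhds 0) := by
      have h2 : Filter.Tendsto (fun d : 𝕜 => c ^ 3 * d) (Bornology.cobounded 𝕜)
          (Bornology.cobounded 𝕜) := Filter.tendsto_mul_left_cobounded (pow_ne_zero 3 hc0)
      simpa using ((tendsto_norm_cobounded_atTop.comp h2).inv_tendsto_atTop).const_mul 3
    obtain ⟨d, h2, h3⟩ := ((h1.eventually (gt_mem_nhds hε)).and
      (Bornology.eventually_ne_cobounded (0 : 𝕜))).exists
    exact ⟨d, h3, h2⟩
  have e1 : ∀ᶠ p : X × Y × Z in nhds (x₀, y₀, z₀),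
      ((c * d) • (p.1 - x₀), c • p.2.1, c • p.2.2) ∈ interior U := by
    have hcont : Continuous fun p : X × Y × Z => ((c * d) • (p.1 - x₀), c • p.2.1, c • p.2.2) := by
      fun_prop
    refine hcont.continuousAt.eventually_mem (isOpen_interior.mem_nhds ?_)
    simpa using hx
  have e2 : ∀ᶠ p : X × Y × Z in nhds (x₀, y₀, z₀),
      (c • x₀, (c * d) • (p.2.1 - y₀), c • p.2.2) ∈ interior U := by
    have hcont : Continuous fun p : X × Y × Z => (c • x₀, (c * d) • (p.2.1 - y₀), c • p.2.2) := by
      fun_prop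
    refine hcont.continuousAt.eventually_mem (isOpen_interior.mem_nhds ?_)
    simpa using hy
  have e3 : ∀ᶠ p : X × Y × Z in nhds (x₀, y₀, z₀),
      (c • x₀, c • y₀, (c * d) • (p.2.2 - z₀)) ∈ interior U := by
    have hcont : Continuous fun p : X × Y × Z => (c • x₀, c • y₀, (c * d) • (p.2.2 - z₀)) := by
      fun_prop
    refine hcont.continuousAt.eventually_mem (isOpen_interior.mem_nhds ?_)
    simpa using hz
  filter_upwards [e1, e2, e3] with p h1 h2 h3
  have b1 := bound d _ _ _ _ _ _ hd0 (by ring) h1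
  have b2 := bound d _ _ _ _ _ _ hd0 (by ring) h2
  have b3 := bound d _ _ _ _ _ _ hd0 (by ring) h3
  rw [Real.dist_eq]
  have hsplit : pureTensor 𝕜 p.1 p.2.1 p.2.2 - pureTensor 𝕜 x₀ y₀ z₀ =
      pureTensor 𝕜 (p.1 - x₀) p.2.1 p.2.2 + (pureTensor 𝕜 x₀ (p.2.1 - y₀) p.2.2
        + pureTensor 𝕜 x₀ y₀ (p.2.2 - z₀)) := by
    rw [pureTensor_sub_left, pureTensor_sub_mid, pureTensor_sub_right]; abel
  calc |q (pureTensor 𝕜 p.1 p.2.1 p.2.2) - q (pureTensor 𝕜 x₀ y₀ z₀)|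
      ≤ q (pureTensor 𝕜 p.1 p.2.1 p.2.2 - pureTensor 𝕜 x₀ y₀ z₀) := abs_sub_map_le_sub q _ _
    _ ≤ q (pureTensor 𝕜 (p.1 - x₀) p.2.1 p.2.2) + (q (pureTensor 𝕜 x₀ (p.2.1 - y₀) p.2.2)
        + q (pureTensor 𝕜 x₀ y₀ (p.2.2 - z₀))) := by
      rw [hsplit]
      exact (map_add_le_add _ _ _).trans (by gcongr; exact map_add_le_add _ _ _)
    _ ≤ 3 * ‖c ^ 3 * d‖⁻¹ := by linarith
    _ < ε := hd

/-- A family of seminorms on `X ⊗ Y ⊗ Z` that is bounded by `1` on the elementary tensors near zero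
is equicontinuous for the projective topology. -/
theorem exists_continuous_seminorm_ge {J : Type*} (q : J → Seminorm 𝕜 (AlgTensor 𝕜 X Y Z))
    {U : Set (X × Y × Z)} (hU : U ∈ nhds 0)
    (h : ∀ j, ∀ z ∈ U, q j (pureTensor 𝕜 z.1 z.2.1 z.2.2) ≤ 1) :
    ∃ D ∈ nhds (0 : AlgTensor 𝕜 X Y Z), ∀ j, ∀ u ∈ D, q j u ≤ 1 := by
  -- The family is pointwise bounded, on elementary tensors by rescaling into `U` and on sums by
  -- subadditivity. Its supremum is therefore a seminorm satisfying the same bound on `U`, hence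
  -- continuous.
  have hb : BddAbove (Set.range q) := by
    rw [Seminorm.bddAbove_range_iff]
    have key : ∀ u, ∃ M, ∀ j, q j u ≤ M := by
      refine algTensor_induction ⟨0, fun j => by simp⟩ (fun x y z => ?_) ?_
      · have hcont : Continuous fun c : 𝕜 => c • ((x, y, z) : X × Y × Z) := by fun_prop
        have h1 := hcont.tendsto 0
        rw [zero_smul] at h1
        obtain ⟨c, hc, hcU⟩ := ((eventually_mem_nhdsWithin (a := (0 : 𝕜)) (s := {0}ᶜ)).and
          ((h1.mono_left nhdsWithin_le_nhds).eventually hU)).exists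
        refine ⟨‖c * c * c‖⁻¹, fun j => ?_⟩
        have h2 := h j _ hcU
        simp only [Prod.smul_mk, pureTensor_smul, map_smul_eq_mul] at h2
        have h3 : 0 < ‖c * c * c‖ := norm_pos_iff.mpr (mul_ne_zero (mul_ne_zero hc hc) hc)
        rw [← one_div, le_div_iff₀ h3, mul_comm]
        exact h2
      · rintro u v ⟨M, hM⟩ ⟨N, hN⟩
        exact ⟨M + N, fun j => (map_add_le_add _ _ _).trans (add_le_add (hM j) (hN j))⟩
    intro u
    obtain ⟨M, hM⟩ := key u
    exact ⟨M, by rintro _ ⟨j, rfl⟩; exact hM j⟩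
  have hQ : ∀ z ∈ U, (⨆ j, q j) (pureTensor 𝕜 z.1 z.2.1 z.2.2) ≤ 1 := by
    intro z hz
    rw [Seminorm.iSup_apply hb]
    exact Real.iSup_le (fun j => h j z hz) zero_le_one
  have hcont : Continuous ((⨆ j, q j : Seminorm 𝕜 (AlgTensor 𝕜 X Y Z)) :
      AlgTensor 𝕜 X Y Z → ℝ) := (withSeminorms_projSeminorms 𝕜 X Y Z).continuous_seminorm
    ⟨⨆ j, q j, continuous_seminorm_pure _ hU hQ⟩
  refine ⟨{u | (⨆ j, q j) u < 1}, ?_, fun j u hu => ?_⟩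
  · refine (isOpen_lt hcont continuous_const).mem_nhds ?_
    change (⨆ j, q j) 0 < 1
    rw [map_zero]
    exact one_pos
  · have : q j u ≤ (⨆ j, q j) u := by
      rw [Seminorm.iSup_apply hb]
      exact le_ciSup ((Seminorm.bddAbove_range_iff.mp hb) u) j
    exact this.trans (le_of_lt hu)

theorem closure_image_toCTensor_mem_nhds {D : Set (AlgTensor 𝕜 X Y Z)} (hD : D ∈ nhds 0) :
    closure (toCTensor 𝕜 X Y Z '' D) ∈ nhds 0 := by
  have := (UniformSpace.Completion.isDenseInducing_coe
    (α := AlgTensor 𝕜 X Y Z)).closure_image_mem_nhds hD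
  rwa [UniformSpace.Completion.coe_zero] at this

theorem ctensor_hom_ext {W : Type*} [AddCommGroup W] [Module 𝕜 W] [TopologicalSpace W]
    [T2Space W] {L L' : CTensor 𝕜 X Y Z →L[𝕜] W}
    (h : ∀ x y z, L (toCTensor 𝕜 X Y Z (pureTensor 𝕜 x y z)) =
      L' (toCTensor 𝕜 X Y Z (pureTensor 𝕜 x y z))) : L = L' := by
  have h1 : ∀ u, L (toCTensor 𝕜 X Y Z u) = L' (toCTensor 𝕜 X Y Z u) := by
    refine algTensor_induction (by simp) h fun u v hu hv => ?_
    rw [map_add, map_add, map_add, hu, hv]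
  ext P
  exact congrFun (UniformSpace.Completion.denseRange_coe.equalizer L.continuous L'.continuous
    (funext h1)) P

end TensorSeminorms

/-! ### Linearity and continuity of contractions with a completed tensor -/

section Contract

open Equiv

variable {𝕜 E A : Type*} [RCLike 𝕜]
  [AddCommGroup E] [Module 𝕜 E] [TopologicalSpace E] [IsTopologicalAddGroup E]
  [ContinuousSMul 𝕜 E] [FirstCountableTopology E]
  [Ring A] [Algebra 𝕜 A] [UniformSpace A] [IsUniformAddGroup A] [ContinuousSMul 𝕜 A]
  [ContinuousMul A] [PolynormableSpace 𝕜 A] [T2Space A] [CompleteSpace A]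

/-- The contraction of a fixed functional, as a continuous linear map on the completed tensor
product. -/
def contractL {n : ℕ} (f : MultiFun 𝕜 E A (Fin (n + 2))) :
    CTensor 𝕜 E E A →L[𝕜] MultiFun 𝕜 E A (Fin n) :=
  CTensor.lift 𝕜 (plugLin f) (by simpa only [plugLin_pure] using continuous_plug f)

theorem contractL_apply {n : ℕ} (P : CTensor 𝕜 E E A) (f : MultiFun 𝕜 E A (Fin (n + 2))) :
    contractL f P = contract P f := rfl

/-- Contraction is constructed by extension in `P`, so its linearity in the functional is checked on
elementary tensors, which determine a continuous linear map. -/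
theorem contract_add {n : ℕ} (P : CTensor 𝕜 E E A) (f f' : MultiFun 𝕜 E A (Fin (n + 2))) :
    contract P (f + f') = contract P f + contract P f' := by
  have : contractL (f + f') = contractL f + contractL f' := by
    refine ctensor_hom_ext fun s t a => ?_
    rw [add_apply, contractL_apply, contractL_apply, contractL_apply, contract_pure,
      contract_pure, contract_pure]
    ext x
    simp [plug_apply, add_mul]
  exact DFunLike.congr_fun this P

theorem contract_smul {n : ℕ} (P : CTensor 𝕜 E E A) (c : 𝕜) (f : MultiFun 𝕜 E A (Fin (n + 2))) :
    contract P (c • f) = c • contract P f := by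
  have : contractL (c • f) = c • contractL f := by
    refine ctensor_hom_ext fun s t a => ?_
    rw [smul_apply, contractL_apply, contractL_apply, contract_pure, contract_pure]
    ext x
    simp [plug_apply]
  exact DFunLike.congr_fun this P

/-- The contraction with a fixed element of the completed tensor product, as a linear map. -/
def contractLin (P : CTensor 𝕜 E E A) (n : ℕ) :
    MultiFun 𝕜 E A (Fin (n + 2)) →ₗ[𝕜] MultiFun 𝕜 E A (Fin n) where
  toFun := contract P
  map_add' := contract_add P
  map_smul' := contract_smul P

/-- The evaluation of a contraction. -/
def contractAt {n : ℕ} (f : MultiFun 𝕜 E A (Fin (n + 2))) (y : Fin n → E) :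
    CTensor 𝕜 E E A →L[𝕜] A :=
  (ContinuousMultilinearMap.apply 𝕜 (fun _ : Fin n => E) A y).comp (contractL f)

theorem contractAt_apply {n : ℕ} (f : MultiFun 𝕜 E A (Fin (n + 2))) (y : Fin n → E)
    (P : CTensor 𝕜 E E A) : contractAt f y P = contract P f y := rfl

theorem contractAt_pure {n : ℕ} (f : MultiFun 𝕜 E A (Fin (n + 2))) (y : Fin n → E) (s t : E)
    (a : A) : contractAt f y (toCTensor 𝕜 E E A (pureTensor 𝕜 s t a)) =
      f (Fin.snoc (α := fun _ => E) (Fin.snoc (α := fun _ => E) y s) t) * a := by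
  rw [contractAt_apply, contract_pure, plug_apply]

/-- The double contraction `P' ↦ P ⌟ (P' ⌟ g)` evaluated at `y`. -/
def doubleContract {n : ℕ} (P : CTensor 𝕜 E E A) (g : MultiFun 𝕜 E A (Fin (n + 2 + 2)))
    (y : Fin n → E) : CTensor 𝕜 E E A →ₗ[𝕜] A :=
  (ContinuousMultilinearMap.apply 𝕜 (fun _ : Fin n => E) A y).toLinearMap ∘ₗ
    contractLin P n ∘ₗ (contractL g).toLinearMap

theorem doubleContract_apply {n : ℕ} (P P' : CTensor 𝕜 E E A)
    (g : MultiFun 𝕜 E A (Fin (n + 2 + 2))) (y : Fin n → E) :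
    doubleContract P g y P' = contract P (contract P' g) y := rfl

/-- For an elementary tensor the outer contraction only inserts two fixed arguments and multiplies
by an element of `A`; algebraic tensors are sums of these. -/
theorem continuous_doubleContract_coe {n : ℕ} (u : AlgTensor 𝕜 E E A)
    (g : MultiFun 𝕜 E A (Fin (n + 2 + 2))) (y : Fin n → E) :
    Continuous (doubleContract (toCTensor 𝕜 E E A u) g y) := by
  have key : Continuous fun P' => contractAt (contract P' g) y (toCTensor 𝕜 E E A u) := by
    refine algTensor_induction (C := fun u => Continuous fun P' => contractAt (contract P' g) y
      (toCTensor 𝕜 E E A u)) ?_ (fun s t a => ?_) (fun u v hu hv => ?_) u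
    · simp only [map_zero]
      exact continuous_const
    · simp only [contractAt_pure]
      exact (contractAt g _).continuous.mul continuous_const
    · simp only [map_add]
      exact hu.add hv
  exact key

/-- Contraction with a fixed functional is continuous in the tensor by construction, but here the
functional `P' ⌟ g` varies with `P'`. A bound valid for elementary tensors near zero in both slots
is carried by equicontinuity to neighbourhoods of zero of algebraic tensors and then to their
closures. The result lets identities in `P'` be checked on elementary tensors even when `P` is a
limit. -/
theorem continuous_doubleContract {n : ℕ} (P : CTensor 𝕜 E E A)
    (g : MultiFun 𝕜 E A (Fin (n + 2 + 2))) (y : Fin n → E) :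
    Continuous (doubleContract P g y) := by
  have hW := PolynormableSpace.withSeminorms 𝕜 A
  refine hW.continuous_of_continuous_comp _ fun p => ?_
  have hp : Continuous p.1 := p.2
  have hcont : Continuous fun w : (E × E × A) × (E × E × A) =>
      p.1 (doubleContract (toCTensor 𝕜 E E A (pureTensor 𝕜 w.1.1 w.1.2.1 w.1.2.2)) g y
        (toCTensor 𝕜 E E A (pureTensor 𝕜 w.2.1 w.2.2.1 w.2.2.2))) := by
    simp only [doubleContract_apply, contract_pure, plug_apply]
    refine hp.comp ?_
    refine Continuous.mul (Continuous.mul (g.cont.comp ?_) ?_) ?_ <;> fun_prop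
  have hnear := hcont.tendsto (0, 0)
  have h0 : p.1 (doubleContract (toCTensor 𝕜 E E A (pureTensor 𝕜 (0 : E) (0 : E) (0 : A))) g y
      (toCTensor 𝕜 E E A (pureTensor 𝕜 (0 : E) (0 : E) (0 : A)))) = 0 := by
    simp only [doubleContract_apply, contract_pure, plug_apply, mul_zero, map_zero]
  have hev := hnear.eventually (ge_mem_nhds (h0.trans_lt (one_pos : (0 : ℝ) < 1)))
  rw [nhds_prod_eq, Filter.eventually_prod_iff] at hev
  obtain ⟨U, hU, U', hU', hUU'⟩ := hev
  -- The outer slot is extended to algebraic tensors, uniformly over elementary tensors in the inner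
  -- slot; the next step does the same for the inner slot, uniformly over `D`.
  obtain ⟨D, hD, hDb⟩ := exists_continuous_seminorm_ge (𝕜 := 𝕜)
    (fun z' : {z' : E × E × A // U' z'} => p.1.comp
      ((contractAt (contract (toCTensor 𝕜 E E A (pureTensor 𝕜 z'.1.1 z'.1.2.1 z'.1.2.2)) g)
        y).toLinearMap ∘ₗ (toCTensor 𝕜 E E A).toLinearMap)) hU
    (fun z' z hz => hUU' hz z'.2)
  obtain ⟨D', hD', hDb'⟩ := exists_continuous_seminorm_ge (𝕜 := 𝕜)
    (fun u : D => p.1.comp (doubleContract (toCTensor 𝕜 E E A u.1) g y ∘ₗ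
      (toCTensor 𝕜 E E A).toLinearMap)) hU'
    (fun u z' hz' => hDb ⟨z', hz'⟩ u.1 u.2)
  have h1 : ∀ u ∈ D, ∀ P' ∈ closure (toCTensor 𝕜 E E A '' D'),
      p.1 (doubleContract (toCTensor 𝕜 E E A u) g y P') ≤ 1 := by
    intro u hu
    refine closure_minimal ?_ (isClosed_le (hp.comp (continuous_doubleContract_coe u g y))
      continuous_const)
    rintro _ ⟨u', hu', rfl⟩
    exact hDb' ⟨u, hu⟩ u' hu'
  have h2 : ∀ P' ∈ closure (toCTensor 𝕜 E E A '' D'), ∀ Q ∈ closure (toCTensor 𝕜 E E A '' D),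
      p.1 (contractAt (contract P' g) y Q) ≤ 1 := by
    intro P' hP'
    refine closure_minimal ?_ (isClosed_le (hp.comp (contractAt (contract P' g) y).continuous)
      continuous_const)
    rintro _ ⟨u, hu, rfl⟩
    exact h1 u hu P' hP'
  have hN := closure_image_toCTensor_mem_nhds hD
  have hN' := closure_image_toCTensor_mem_nhds hD'
  -- `P` is split as `(P - u) + u` with `u` algebraic: the remainder is handled by `h2`, and `u` by
  -- `h1` after rescaling into `D`. This produces the bound `1 + ‖c‖⁻¹`.
  obtain ⟨u, hu⟩ : ∃ u, P - toCTensor 𝕜 E E A u ∈ closure (toCTensor 𝕜 E E A '' D) := by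
    have h3 : Continuous fun Q => P - Q := by fun_prop
    have h4 := h3.tendsto P
    rw [sub_self] at h4
    obtain ⟨u, hu⟩ := UniformSpace.Completion.denseRange_coe.exists_mem_open isOpen_interior
      ⟨P, mem_interior_iff_mem_nhds.mpr (h4 hN)⟩
    have hu' := interior_subset hu
    exact ⟨u, hu'⟩
  obtain ⟨c, hc0, hc⟩ : ∃ c : 𝕜, c ≠ 0 ∧ c • u ∈ D := by
    have h3 : Continuous fun c : 𝕜 => c • u := by fun_prop
    have h4 := h3.tendsto 0
    rw [zero_smul] at h4
    obtain ⟨c, hc, hcN⟩ := ((eventually_mem_nhdsWithin (a := (0 : 𝕜)) (s := {0}ᶜ)).and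
      ((h4.mono_left nhdsWithin_le_nhds).eventually hD)).exists
    exact ⟨c, hc, hcN⟩
  refine Seminorm.continuous' (r := 1 + ‖c‖⁻¹) (Filter.mem_of_superset hN' fun P' hP' => ?_)
  have h5 := h2 P' hP' _ hu
  have h6 := h1 _ hc P' hP'
  rw [doubleContract_apply, ← contractAt_apply, map_smul, map_smul, map_smul_eq_mul] at h6
  have h7 : 0 < ‖c‖ := norm_pos_iff.mpr hc0
  have h8 : p.1 (contractAt (contract P' g) y (toCTensor 𝕜 E E A u)) ≤ ‖c‖⁻¹ := by
    rw [← one_div, le_div_iff₀ h7, mul_comm]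
    exact h6
  rw [Seminorm.mem_closedBall_zero]
  calc p.1 (contractAt (contract P' g) y P)
      = p.1 (contractAt (contract P' g) y (P - toCTensor 𝕜 E E A u) +
          contractAt (contract P' g) y (toCTensor 𝕜 E E A u)) := by
        rw [← map_add, sub_add_cancel]
    _ ≤ 1 + ‖c‖⁻¹ := (map_add_le_add _ _ _).trans (add_le_add h5 h8)

end Contract

/-! ### Permutations of the contracted pairs and their Koszul signs -/

section PairPermutations

open Equiv

/-- Append two entries to a tuple. -/
abbrev snocTwo {X : Type*} {n : ℕ} (y : Fin n → X) (s t : X) : Fin (n + 2) → X :=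
  Fin.snoc (α := fun _ => X) (Fin.snoc (α := fun _ => X) y s) t

theorem forall_fin_add_two {n : ℕ} {C : Fin (n + 2) → Prop} (h : ∀ i : Fin n, C i.castSucc.castSucc)
    (h1 : C (Fin.last n).castSucc) (h2 : C (Fin.last (n + 1))) (i : Fin (n + 2)) : C i :=
  Fin.lastCases h2 (fun j => Fin.lastCases h1 h j) i

/-- The permutation of `n + 2` points that exchanges the last two. -/
def flipLast (n : ℕ) : Perm (Fin (n + 2)) := swap (Fin.last n).castSucc (Fin.last n).succ

theorem flipLast_castSucc {n : ℕ} (i : Fin n) :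
    flipLast n i.castSucc.castSucc = i.castSucc.castSucc := by
  have := i.2
  refine swap_apply_of_ne_of_ne ?_ ?_ <;> simp only [ne_eq, Fin.ext_iff, Fin.val_castSucc,
    Fin.val_succ, Fin.val_last] <;> omega

theorem flipLast_last_castSucc (n : ℕ) : flipLast n (Fin.last n).castSucc = Fin.last (n + 1) :=
  swap_apply_left _ _

theorem flipLast_last (n : ℕ) : flipLast n (Fin.last (n + 1)) = (Fin.last n).castSucc :=
  swap_apply_right _ _

/-- The extension of a permutation of `n` points to `n + 2` points that fixes the last two. -/
def extendTwo {n : ℕ} (σ : Perm (Fin n)) : Perm (Fin (n + 2)) :=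
  finSumFinEquiv.permCongr (Equiv.sumCongr σ (Equiv.refl (Fin 2)))

theorem extendTwo_castSucc {n : ℕ} (σ : Perm (Fin n)) (i : Fin n) :
    extendTwo σ i.castSucc.castSucc = (σ i).castSucc.castSucc := by
  have h : (finSumFinEquiv (m := n) (n := 2)).symm i.castSucc.castSucc = Sum.inl i :=
    finSumFinEquiv_symm_apply_castAdd i
  rw [extendTwo, permCongr_apply, h]
  rfl

theorem extendTwo_last_castSucc {n : ℕ} (σ : Perm (Fin n)) :
    extendTwo σ (Fin.last n).castSucc = (Fin.last n).castSucc := by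
  have h : (finSumFinEquiv (m := n) (n := 2)).symm (Fin.last n).castSucc = Sum.inr 0 :=
    finSumFinEquiv_symm_apply_natAdd (0 : Fin 2)
  rw [extendTwo, permCongr_apply, h]
  rfl

theorem extendTwo_last {n : ℕ} (σ : Perm (Fin n)) :
    extendTwo σ (Fin.last (n + 1)) = Fin.last (n + 1) := by
  have h : (finSumFinEquiv (m := n) (n := 2)).symm (Fin.last (n + 1)) = Sum.inr 1 :=
    finSumFinEquiv_symm_apply_natAdd (1 : Fin 2)
  rw [extendTwo, permCongr_apply, h]
  rfl

theorem koszulSign_extendTwo {n : ℕ} (σ : Perm (Fin n)) (δ : Fin n → ZMod 2) (a b : ZMod 2) :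
    koszulSign (extendTwo σ) (snocTwo δ a b) = koszulSign σ δ := by
  simp only [koszulSign_eq, Fin.prod_univ_castSucc (n := n + 1), Fin.prod_univ_castSucc (n := n),
    extendTwo_castSucc, extendTwo_last_castSucc, extendTwo_last, Fin.snoc_castSucc, Fin.snoc_last,
    Fin.castSucc_lt_castSucc_iff, Fin.castSucc_lt_last, lt_irrefl, false_and, and_false, if_false,
    not_lt_of_gt (Fin.castSucc_lt_last _), mul_one, Finset.prod_const_one]

/-- The permutation of `n + 4` points that exchanges the last pair with the pair before it. -/
def blockSwap (n : ℕ) : Perm (Fin (n + 2 + 2)) :=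
  swap (Fin.last n).castSucc.castSucc.castSucc (Fin.last (n + 2)).castSucc *
    swap (Fin.last (n + 1)).castSucc.castSucc (Fin.last (n + 3))

section BlockSwap
variable (n : ℕ)

theorem blockSwap_castSucc (i : Fin n) : blockSwap n i.castSucc.castSucc.castSucc.castSucc =
    i.castSucc.castSucc.castSucc.castSucc := by
  have := i.2
  rw [blockSwap, Perm.mul_apply,
    swap_apply_of_ne_of_ne (a := (Fin.last (n + 1)).castSucc.castSucc), swap_apply_of_ne_of_ne] <;>
    simp only [ne_eq, Fin.ext_iff, Fin.val_castSucc, Fin.val_last] <;> omega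

theorem blockSwap_first : blockSwap n (Fin.last n).castSucc.castSucc.castSucc =
    (Fin.last (n + 2)).castSucc := by
  rw [blockSwap, Perm.mul_apply,
    swap_apply_of_ne_of_ne (a := (Fin.last (n + 1)).castSucc.castSucc), swap_apply_left] <;>
    simp only [ne_eq, Fin.ext_iff, Fin.val_castSucc, Fin.val_last] <;> omega

theorem blockSwap_second : blockSwap n (Fin.last (n + 1)).castSucc.castSucc = Fin.last (n + 3) := by
  rw [blockSwap, Perm.mul_apply, swap_apply_left, swap_apply_of_ne_of_ne] <;>
    simp only [ne_eq, Fin.ext_iff, Fin.val_castSucc, Fin.val_last] <;> omega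

theorem blockSwap_third : blockSwap n (Fin.last (n + 2)).castSucc =
    (Fin.last n).castSucc.castSucc.castSucc := by
  rw [blockSwap, Perm.mul_apply,
    swap_apply_of_ne_of_ne (a := (Fin.last (n + 1)).castSucc.castSucc), swap_apply_right] <;>
    simp only [ne_eq, Fin.ext_iff, Fin.val_castSucc, Fin.val_last] <;> omega

theorem blockSwap_last : blockSwap n (Fin.last (n + 3)) =
    (Fin.last (n + 1)).castSucc.castSucc := by
  rw [blockSwap, Perm.mul_apply, swap_apply_right, swap_apply_of_ne_of_ne] <;>
    simp only [ne_eq, Fin.ext_iff, Fin.val_castSucc, Fin.val_last] <;> omega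

theorem snocTwo_comp_blockSwap {X : Type*} (y : Fin n → X) (s t s' t' : X) :
    snocTwo (snocTwo y s t) s' t' ∘ blockSwap n = snocTwo (snocTwo y s' t') s t := by
  funext i
  revert i
  refine forall_fin_add_two (fun i => ?_) ?_ ?_
  · revert i
    refine forall_fin_add_two (fun i => ?_) ?_ ?_
    · rw [Function.comp_apply, blockSwap_castSucc]
      simp only [Fin.snoc_castSucc]
    · rw [Function.comp_apply, blockSwap_first]
      simp only [Fin.snoc_castSucc, Fin.snoc_last]
    · rw [Function.comp_apply, blockSwap_second]
      simp only [Fin.snoc_castSucc, Fin.snoc_last]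
  · rw [Function.comp_apply, blockSwap_third]
    simp only [Fin.snoc_castSucc, Fin.snoc_last]
  · rw [Function.comp_apply, blockSwap_last]
    simp only [Fin.snoc_castSucc, Fin.snoc_last]

/-- No inversion involves the first `n` points; the four inversions between the two pairs yield the
four factors of the sign of the total parities. -/
theorem koszulSign_blockSwap (δ : Fin n → ZMod 2) (a b a' b' : ZMod 2) :
    koszulSign (blockSwap n) (snocTwo (snocTwo δ a b) a' b') =
      exchangeSign (a + b) (a' + b') := by
  have h : ∀ {m : ℕ} (i : Fin m), ¬ Fin.last m < i.castSucc := fun i =>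
    not_lt_of_gt (Fin.castSucc_lt_last i)
  simp only [koszulSign_eq, Fin.prod_univ_castSucc (n := n + 1 + 2),
    Fin.prod_univ_castSucc (n := n + 2),
    Fin.prod_univ_castSucc (n := n + 1), Fin.prod_univ_castSucc (n := n), blockSwap_castSucc,
    blockSwap_first, blockSwap_second, blockSwap_third, blockSwap_last, Fin.snoc_castSucc,
    Fin.snoc_last, Fin.castSucc_lt_castSucc_iff, Fin.castSucc_lt_last, lt_irrefl, false_and,
    and_false, if_false, h, mul_one, Finset.prod_const_one, and_self]
  have h2 : ∀ i j : Fin n, ¬ (i < j ∧ j < i) := fun i j h => lt_asymm h.1 h.2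
  simp only [h2, if_false, Finset.prod_const_one, if_true, one_mul]
  revert a b a' b'
  decide

end BlockSwap

theorem snocTwo_comp_flipLast {X : Type*} {n : ℕ} (y : Fin n → X) (s t : X) :
    snocTwo y s t ∘ flipLast n = snocTwo y t s := by
  funext i
  revert i
  refine forall_fin_add_two (fun i => ?_) ?_ ?_
  · rw [Function.comp_apply, flipLast_castSucc]
    simp only [Fin.snoc_castSucc]
  · rw [Function.comp_apply, flipLast_last_castSucc]
    simp only [Fin.snoc_castSucc, Fin.snoc_last]
  · rw [Function.comp_apply, flipLast_last]
    simp only [Fin.snoc_castSucc, Fin.snoc_last]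

theorem koszulSign_flipLast {n : ℕ} (δ : Fin n → ZMod 2) (a b : ZMod 2) :
    koszulSign (flipLast n) (snocTwo δ a b) = exchangeSign a b := by
  rw [flipLast, koszulSign_adjacent, Fin.succ_last]
  simp only [Fin.snoc_castSucc, Fin.snoc_last]

theorem snocTwo_comp_extendTwo {X : Type*} {n : ℕ} (σ : Perm (Fin n)) (y : Fin n → X) (s t : X) :
    snocTwo y s t ∘ extendTwo σ = snocTwo (y ∘ σ) s t := by
  funext i
  revert i
  refine forall_fin_add_two (fun i => ?_) ?_ ?_
  · rw [Function.comp_apply, extendTwo_castSucc]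
    simp only [Fin.snoc_castSucc, Function.comp_apply]
  · rw [Function.comp_apply, extendTwo_last_castSucc]
    simp only [Fin.snoc_castSucc, Fin.snoc_last]
  · rw [Function.comp_apply, extendTwo_last]
    simp only [Fin.snoc_last]

end PairPermutations

/-! ### Symmetries and degree of contractions -/

section ContractSymmetry

open Equiv

variable {𝕜 E A : Type*} [RCLike 𝕜]
  [AddCommGroup E] [Module 𝕜 E] [TopologicalSpace E] [IsTopologicalAddGroup E]
  [ContinuousSMul 𝕜 E] [FirstCountableTopology E]
  [Ring A] [Algebra 𝕜 A] [UniformSpace A] [IsUniformAddGroup A] [ContinuousSMul 𝕜 A]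
  [ContinuousMul A] [PolynormableSpace 𝕜 A] [T2Space A] [CompleteSpace A]
  {gE : FinGrading 𝕜 E} {gA : FinGrading 𝕜 A}

theorem isPar_snocTwo {n : ℕ} {δ : Fin n → ZMod 2} {y : Fin n → E} {a b : ZMod 2} {s t : E}
    (h : ∀ i, gE.IsPar (δ i) (y i)) (hs : gE.IsPar a s) (ht : gE.IsPar b t) (i : Fin (n + 2)) :
    gE.IsPar (snocTwo δ a b i) (snocTwo y s t i) := by
  revert i
  refine forall_fin_add_two (fun i => ?_) ?_ ?_
  · simpa only [Fin.snoc_castSucc] using h i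
  · simpa only [Fin.snoc_castSucc, Fin.snoc_last] using hs
  · simpa only [Fin.snoc_last] using ht

theorem pureTensor_zero_left (t : E) (z : A) : pureTensor 𝕜 (0 : E) t z = 0 :=
  TensorProduct.zero_tmul _ _

theorem pureTensor_zero_mid (s : E) (z : A) : pureTensor 𝕜 s (0 : E) z = 0 := by
  rw [pureTensor, TensorProduct.zero_tmul, TensorProduct.tmul_zero]
  rfl

theorem pureTensor_zero_right (s t : E) : pureTensor 𝕜 s t (0 : A) = 0 := by
  rw [pureTensor, TensorProduct.tmul_zero, TensorProduct.tmul_zero]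
  rfl

theorem pureTensor_sum {α β γ : Type*} (r : Finset α) (s : Finset β) (t : Finset γ)
    (x : α → E) (y : β → E) (z : γ → A) :
    pureTensor 𝕜 (∑ i ∈ r, x i) (∑ j ∈ s, y j) (∑ k ∈ t, z k) =
      ∑ i ∈ r, ∑ j ∈ s, ∑ k ∈ t, pureTensor 𝕜 (x i) (y j) (z k) := by
  rw [pureTensor, TensorProduct.sum_tmul]
  refine Finset.sum_congr rfl fun i _ => ?_
  rw [TensorProduct.sum_tmul, TensorProduct.tmul_sum]
  refine Finset.sum_congr rfl fun j _ => ?_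
  rw [TensorProduct.tmul_sum, TensorProduct.tmul_sum]
  rfl

theorem ctensor_hom_ext_isPar (gE : FinGrading 𝕜 E) (gA : FinGrading 𝕜 A)
    {W : Type*} [AddCommGroup W] [Module 𝕜 W] [TopologicalSpace W]
    [T2Space W] {L L' : CTensor 𝕜 E E A →L[𝕜] W}
    (h : ∀ a b c s t z, gE.IsPar a s → gE.IsPar b t → gA.IsPar c z →
      L (toCTensor 𝕜 E E A (pureTensor 𝕜 s t z)) =
        L' (toCTensor 𝕜 E E A (pureTensor 𝕜 s t z))) : L = L' := by
  refine ctensor_hom_ext fun s t z => ?_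
  rw [← gE.sum_par s, ← gE.sum_par t, ← gA.sum_par z, pureTensor_sum]
  simp only [map_sum]
  exact Finset.sum_congr rfl fun a _ => Finset.sum_congr rfl fun b _ =>
    Finset.sum_congr rfl fun c _ => h a b c _ _ _ (gE.isPar_par _ _) (gE.isPar_par _ _)
      (gA.isPar_par _ _)

theorem contract_transport_extendTwo (gA : FinGrading 𝕜 A) {n : ℕ} (σ : Perm (Fin n))
    (P : CTensor 𝕜 E E A)
    (f : MultiFun 𝕜 E A (Fin (n + 2))) :
    contract P (transport gE (extendTwo σ) f) = transport gE σ (contract P f) := by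
  refine multiFun_ext gE fun δ y hy => ?_
  rw [transport_apply_of_isPar gE _ _ hy]
  have : contractAt (transport gE (extendTwo σ) f) y = koszulSign σ δ • contractAt f (y ∘ σ) := by
    refine ctensor_hom_ext_isPar gE gA fun a b c s t z hs ht hz => ?_
    rw [contractAt_pure, transport_apply_of_isPar gE _ _ (isPar_snocTwo hy hs ht),
      koszulSign_extendTwo, snocTwo_comp_extendTwo, smul_mul_assoc, smul_apply, contractAt_pure]
  exact DFunLike.congr_fun this P

/-- Exchanging the two contracted arguments is the same as exchanging the two factors `E` of `P`,
with the same sign; for a propagator nothing changes. -/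
theorem contract_transport_flipLast (gA : FinGrading 𝕜 A) {n : ℕ} (P : CTensor 𝕜 E E A)
    (f : MultiFun 𝕜 E A (Fin (n + 2))) :
    contract P (transport gE (flipLast n) f) = contract (braid gE P) f := by
  refine multiFun_ext gE fun δ y hy => ?_
  have : contractAt (transport gE (flipLast n) f) y = (contractAt f y).comp
      (∑ δ : ZMod 2, ∑ ε : ZMod 2, (if δ = 1 ∧ ε = 1 then (-1 : ℤ) else 1) •
        (CTensor.flip 𝕜).comp
          (CTensor.map 𝕜 (gE.par δ) (gE.par ε) (ContinuousLinearMap.id 𝕜 A))) := by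
    refine ctensor_hom_ext_isPar gE gA fun a b c s t z hs ht hz => ?_
    rw [contractAt_pure, transport_apply_of_isPar gE _ _ (isPar_snocTwo hy hs ht),
      koszulSign_flipLast, snocTwo_comp_flipLast, ContinuousLinearMap.comp_apply, sum_apply,
      Finset.sum_eq_single a, sum_apply, Finset.sum_eq_single b]
    · rw [smul_apply, ContinuousLinearMap.comp_apply, CTensor.map_pure, hs, ht, CTensor.flip_pure,
        map_zsmul, ContinuousLinearMap.id_apply, contractAt_pure, smul_mul_assoc]
      rfl
    · intro b' _ hb
      rw [smul_apply, ContinuousLinearMap.comp_apply, CTensor.map_pure, ht.par_of_ne hb,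
        CTensor.flip_pure, pureTensor_zero_left, map_zero, smul_zero]
    · simp
    · intro a' _ ha
      rw [sum_apply]
      refine Finset.sum_eq_zero fun b' _ => ?_
      rw [smul_apply, ContinuousLinearMap.comp_apply, CTensor.map_pure, hs.par_of_ne ha,
        CTensor.flip_pure, pureTensor_zero_mid, map_zero, smul_zero]
    · simp
  have h2 := DFunLike.congr_fun this P
  rw [contractAt_apply] at h2
  rw [h2, ContinuousLinearMap.comp_apply, contractAt_apply, braid]
  simp only [sum_apply, smul_apply, ContinuousLinearMap.comp_apply]

/-- The double contraction as a continuous linear map. -/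
def doubleContractL {n : ℕ} (P : CTensor 𝕜 E E A) (g : MultiFun 𝕜 E A (Fin (n + 2 + 2)))
    (y : Fin n → E) : CTensor 𝕜 E E A →L[𝕜] A :=
  ⟨doubleContract P g y, continuous_doubleContract P g y⟩

theorem doubleContractL_apply {n : ℕ} (P P' : CTensor 𝕜 E E A)
    (g : MultiFun 𝕜 E A (Fin (n + 2 + 2))) (y : Fin n → E) :
    doubleContractL P g y P' = contract P (contract P' g) y := rfl

variable (gE gA)

/-- The projection to the part of even total parity. -/
def evenPart : CTensor 𝕜 E E A →L[𝕜] CTensor 𝕜 E E A :=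
  ∑ a : ZMod 2, ∑ b : ZMod 2, CTensor.map 𝕜 (gE.par a) (gE.par b) (gA.par (a + b))

variable {gE gA}

theorem evenPart_pure {a b c : ZMod 2} {s t : E} {z : A} (hs : gE.IsPar a s) (ht : gE.IsPar b t)
    (hz : gA.IsPar c z) : evenPart gE gA (toCTensor 𝕜 E E A (pureTensor 𝕜 s t z)) =
      if c = a + b then toCTensor 𝕜 E E A (pureTensor 𝕜 s t z) else 0 := by
  rw [evenPart, sum_apply, Finset.sum_eq_single a, sum_apply, Finset.sum_eq_single b]
  · rw [CTensor.map_pure, hs, ht]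
    split_ifs with h
    · rw [← h, hz]
    · rw [hz.par_of_ne (Ne.symm h), pureTensor_zero_right, map_zero]
  · intro b' _ hb
    rw [CTensor.map_pure, ht.par_of_ne hb, pureTensor_zero_mid, map_zero]
  · simp
  · intro a' _ ha
    rw [sum_apply]
    refine Finset.sum_eq_zero fun b' _ => ?_
    rw [CTensor.map_pure, hs.par_of_ne ha, pureTensor_zero_left, map_zero]
  · simp

/-- A component with parities `c ≠ a + b` is a sum of components with `i + j + k` odd, hence
nonzero, and those vanish. -/
theorem evenPart_of_isPropagator {P : CTensor 𝕜 E E A} (hP : IsPropagator gE gA P) :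
    evenPart gE gA P = P := by
  have h1 : ∑ a : ZMod 2, ∑ b : ZMod 2, ∑ c : ZMod 2,
      CTensor.map 𝕜 (gE.par a) (gE.par b) (gA.par c) =
      ContinuousLinearMap.id 𝕜 (CTensor 𝕜 E E A) := by
    refine ctensor_hom_ext fun s t z => ?_
    simp only [sum_apply, CTensor.map_pure, ContinuousLinearMap.id_apply, ← map_sum]
    rw [← pureTensor_sum, gE.sum_par, gE.sum_par, gA.sum_par]
  have h2 : ∀ a b c : ZMod 2, c ≠ a + b →
      CTensor.map 𝕜 (gE.par a) (gE.par b) (gA.par c) P = 0 := by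
    intro a b c hc
    have h3 : CTensor.map 𝕜 (gE.par a) (gE.par b) (gA.par c) =
        ∑ i ∈ gE.degs.filter (fun i : ℤ => (i : ZMod 2) = a),
        ∑ j ∈ gE.degs.filter (fun i : ℤ => (i : ZMod 2) = b),
        ∑ k ∈ gA.degs.filter (fun i : ℤ => (i : ZMod 2) = c),
          CTensor.map 𝕜 (gE.proj i) (gE.proj j) (gA.proj k) := by
      refine ctensor_hom_ext fun s t z => ?_
      simp only [sum_apply, CTensor.map_pure, ← map_sum, FinGrading.par, ← pureTensor_sum]
    rw [h3]
    simp only [sum_apply]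
    refine Finset.sum_eq_zero fun i hi => Finset.sum_eq_zero fun j hj =>
      Finset.sum_eq_zero fun k hk => hP.degZero i j k fun h0 => hc ?_
    have h4 := congrArg (Int.cast : ℤ → ZMod 2) h0
    push_cast at h4
    rw [(Finset.mem_filter.mp hi).2, (Finset.mem_filter.mp hj).2, (Finset.mem_filter.mp hk).2] at h4
    exact (by decide : ∀ a b c : ZMod 2, a + b + c = 0 → c = a + b) a b c h4
  have h3 := DFunLike.congr_fun h1 P
  rw [ContinuousLinearMap.id_apply] at h3
  conv_rhs => rw [← h3]
  rw [evenPart]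
  simp only [sum_apply]
  refine Finset.sum_congr rfl fun a _ => Finset.sum_congr rfl fun b _ => ?_
  rw [Finset.sum_eq_single (a + b)]
  · intro c _ hc
    exact h2 a b c hc
  · simp

/-- For elementary tensors, exchanging the pairs gives the sign of the parities `a + b` and `a' +
b'`, and commuting the factors in `A` gives the sign of their parities. In the even part these
parities coincide, so the signs cancel. -/
theorem contract_contract_transport_blockSwap (hA : gA.IsGradedCommAlgebra) {n : ℕ}
    {P P' : CTensor 𝕜 E E A} (hP : evenPart gE gA P = P) (hP' : evenPart gE gA P' = P')
    (f : MultiFun 𝕜 E A (Fin (n + 2 + 2))) :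
    contract P (contract P' (transport gE (blockSwap n) f)) = contract P' (contract P f) := by
  refine multiFun_ext gE fun δ y hy => ?_
  -- The identity is extended in `P` first, with `P'` elementary, and afterwards in `P'`. Both
  -- extensions use continuity of a double contraction in its inner tensor.
  have h1 : ∀ a' b' s' t' z', gE.IsPar a' s' → gE.IsPar b' t' → gA.IsPar (a' + b') z' →
      contract P (contract (toCTensor 𝕜 E E A (pureTensor 𝕜 s' t' z'))
        (transport gE (blockSwap n) f)) y =
      contract (toCTensor 𝕜 E E A (pureTensor 𝕜 s' t' z')) (contract P f) y := by
    intro a' b' s' t' z' hs' ht' hz'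
    have : (contractAt (contract (toCTensor 𝕜 E E A (pureTensor 𝕜 s' t' z'))
          (transport gE (blockSwap n) f)) y).comp (evenPart gE gA) =
        (doubleContractL (toCTensor 𝕜 E E A (pureTensor 𝕜 s' t' z')) f y).comp
          (evenPart gE gA) := by
      refine ctensor_hom_ext_isPar gE gA fun a b c s t z hs ht hz => ?_
      rw [ContinuousLinearMap.comp_apply, ContinuousLinearMap.comp_apply, evenPart_pure hs ht hz]
      split_ifs with hc
      · subst hc
        rw [contractAt_apply, doubleContractL_apply]
        simp only [contract_pure, plug_apply]
        rw [transport_apply_of_isPar gE _ _ (isPar_snocTwo (isPar_snocTwo hy hs ht) hs' ht'),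
          koszulSign_blockSwap, snocTwo_comp_blockSwap, smul_mul_assoc, smul_mul_assoc, mul_assoc,
          mul_assoc, hz.mul_comm hA hz', mul_smul_comm]
      · rw [map_zero, map_zero]
    have := DFunLike.congr_fun this P
    rwa [ContinuousLinearMap.comp_apply, ContinuousLinearMap.comp_apply, hP] at this
  have h2 : (doubleContractL P (transport gE (blockSwap n) f) y).comp (evenPart gE gA) =
      (contractAt (contract P f) y).comp (evenPart gE gA) := by
    refine ctensor_hom_ext_isPar gE gA fun a b c s t z hs ht hz => ?_
    rw [ContinuousLinearMap.comp_apply, ContinuousLinearMap.comp_apply, evenPart_pure hs ht hz]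
    split_ifs with hc
    · subst hc
      exact h1 a b s t z hs ht hz
    · rw [map_zero, map_zero]
  have := DFunLike.congr_fun h2 P'
  rwa [ContinuousLinearMap.comp_apply, ContinuousLinearMap.comp_apply, hP'] at this

theorem isDegZero_contract (hA : gA.IsGradedCommAlgebra) {n : ℕ} {P : CTensor 𝕜 E E A}
    (hP : IsPropagator gE gA P) {f : MultiFun 𝕜 E A (Fin (n + 2))} (hf : IsDegZero gE gA f) :
    IsDegZero gE gA (contract P f) := by
  intro d x hx
  have h1 : ∑ i ∈ gE.degs, ∑ j ∈ gE.degs, ∑ k ∈ gA.degs,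
      CTensor.map 𝕜 (gE.proj i) (gE.proj j) (gA.proj k) =
      ContinuousLinearMap.id 𝕜 (CTensor 𝕜 E E A) := by
    refine ctensor_hom_ext fun s t z => ?_
    simp only [sum_apply, CTensor.map_pure, ContinuousLinearMap.id_apply, ← map_sum]
    rw [← pureTensor_sum, gE.sum_proj, gE.sum_proj, gA.sum_proj]
  have h2 := DFunLike.congr_fun h1 P
  rw [ContinuousLinearMap.id_apply] at h2
  rw [← contractAt_apply, ← h2]
  simp only [sum_apply, map_sum]
  refine Submodule.sum_mem (gA.homogSubmodule _) fun i _ =>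
    Submodule.sum_mem (gA.homogSubmodule _) fun j _ =>
    Submodule.sum_mem (gA.homogSubmodule _) fun k _ => ?_
  by_cases h0 : i + j + k = 0
  · have h3 : (gA.proj (∑ i, d i)).comp ((contractAt f x).comp
        (CTensor.map 𝕜 (gE.proj i) (gE.proj j) (gA.proj k))) =
        (contractAt f x).comp (CTensor.map 𝕜 (gE.proj i) (gE.proj j) (gA.proj k)) := by
      refine ctensor_hom_ext fun s t z => ?_
      simp only [ContinuousLinearMap.comp_apply, CTensor.map_pure, contractAt_pure]
      have h4 := hA.mul_homog _ _ _ _ (hf (snocTwo d i j) (snocTwo x (gE.proj i s) (gE.proj j t))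
        (forall_fin_add_two (fun l => by simpa only [Fin.snoc_castSucc] using hx l)
          (by simpa only [Fin.snoc_castSucc, Fin.snoc_last] using gE.isHomog_proj i s)
          (by simpa only [Fin.snoc_last] using gE.isHomog_proj j t))) (gA.isHomog_proj k z)
      simp only [Fin.sum_univ_castSucc, Fin.snoc_castSucc, Fin.snoc_last] at h4
      rwa [show ∑ l, d l + i + j + k = ∑ l, d l by linarith] at h4
    exact DFunLike.congr_fun h3 P
  · rw [hP.degZero i j k h0, map_zero]
    exact Submodule.zero_mem _

end ContractSymmetry

/-! ### The centralizer of the standard involution -/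

section StandardInvolution

open Equiv

theorem commute_iff {α : Type*} {π ρ : Perm α} : Commute π ρ ↔ ∀ x, π (ρ x) = ρ (π x) :=
  ⟨fun h x => DFunLike.congr_fun h x, fun h => Equiv.ext h⟩

/-- The involution of `q + 2 r` points that fixes the first `q` points and exchanges the members of
the `r` consecutive pairs that follow. -/
def stdInvol (q : ℕ) : ∀ r : ℕ, Perm (Fin (q + 2 * r))
  | 0 => 1
  | r + 1 => (extendTwo (stdInvol q r) * flipLast (q + 2 * r) : Perm (Fin (q + 2 * r + 2)))

theorem stdInvol_succ (q r : ℕ) : stdInvol q (r + 1) =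
    (extendTwo (stdInvol q r) * flipLast (q + 2 * r) : Perm (Fin (q + 2 * r + 2))) := rfl

section
variable (q r : ℕ)

theorem stdInvol_castSucc (i : Fin (q + 2 * r)) :
    stdInvol q (r + 1) (i.castSucc.castSucc : Fin (q + 2 * r + 2)) =
      ((stdInvol q r i).castSucc.castSucc : Fin (q + 2 * r + 2)) := by
  rw [stdInvol_succ, Perm.mul_apply, flipLast_castSucc, extendTwo_castSucc]

theorem stdInvol_last_castSucc :
    stdInvol q (r + 1) ((Fin.last (q + 2 * r)).castSucc : Fin (q + 2 * r + 2)) =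
      (Fin.last (q + 2 * r + 1) : Fin (q + 2 * r + 2)) := by
  rw [stdInvol_succ, Perm.mul_apply, flipLast_last_castSucc, extendTwo_last]

theorem stdInvol_last :
    stdInvol q (r + 1) (Fin.last (q + 2 * r + 1) : Fin (q + 2 * r + 2)) =
      ((Fin.last (q + 2 * r)).castSucc : Fin (q + 2 * r + 2)) := by
  rw [stdInvol_succ, Perm.mul_apply, flipLast_last, extendTwo_last_castSucc]

end

theorem stdInvol_val (q r : ℕ) (x : Fin (q + 2 * r)) : (stdInvol q r x : ℕ) =
    if (x : ℕ) < q then (x : ℕ) else if ((x : ℕ) - q) % 2 = 0 then (x : ℕ) + 1 else (x : ℕ) - 1 := by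
  induction r with
  | zero =>
    have := x.2
    rw [if_pos (by omega)]
    rfl
  | succ r ih =>
    change Fin (q + 2 * r + 2) at x
    revert x
    refine forall_fin_add_two (fun i => ?_) ?_ ?_
    · rw [stdInvol_castSucc]
      exact ih i
    · rw [stdInvol_last_castSucc]
      simp only [Fin.val_castSucc, Fin.val_last]
      rw [if_neg (by omega), if_pos (by omega)]
    · rw [stdInvol_last]
      simp only [Fin.val_castSucc, Fin.val_last]
      rw [if_neg (by omega), if_neg (by omega)]
      omega

theorem commute_flipLast (q r : ℕ) :
    Commute (flipLast (q + 2 * r) : Perm (Fin (q + 2 * r + 2))) (stdInvol q (r + 1)) := by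
  rw [commute_iff]
  refine forall_fin_add_two (fun i => ?_) ?_ ?_
  · rw [flipLast_castSucc, stdInvol_castSucc, flipLast_castSucc]
  · rw [flipLast_last_castSucc, stdInvol_last_castSucc, stdInvol_last, flipLast_last]
  · rw [flipLast_last, stdInvol_last, stdInvol_last_castSucc, flipLast_last_castSucc]

theorem commute_extendTwo_iff {q r : ℕ} {π : Perm (Fin (q + 2 * r))} :
    Commute (extendTwo π : Perm (Fin (q + 2 * r + 2))) (stdInvol q (r + 1)) ↔
      Commute π (stdInvol q r) := by
  rw [commute_iff, commute_iff]
  constructor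
  · intro h i
    have := h i.castSucc.castSucc
    rw [stdInvol_castSucc, extendTwo_castSucc, extendTwo_castSucc, stdInvol_castSucc] at this
    exact Fin.castSucc_injective _ (Fin.castSucc_injective _ this)
  · intro h
    refine forall_fin_add_two (fun i => ?_) ?_ ?_
    · rw [stdInvol_castSucc, extendTwo_castSucc, extendTwo_castSucc, stdInvol_castSucc, h]
    · rw [stdInvol_last_castSucc, extendTwo_last, extendTwo_last_castSucc, stdInvol_last_castSucc]
    · rw [stdInvol_last, extendTwo_last, extendTwo_last_castSucc, stdInvol_last]

theorem commute_blockSwap (q r : ℕ) :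
    Commute (blockSwap (q + 2 * r) : Perm (Fin (q + 2 * r + 2 + 2))) (stdInvol q (r + 2)) := by
  have h1 : ∀ i : Fin (q + 2 * r), stdInvol q (r + 2)
      (i.castSucc.castSucc.castSucc.castSucc : Fin (q + 2 * r + 2 + 2)) =
      ((stdInvol q r i).castSucc.castSucc.castSucc.castSucc : Fin (q + 2 * r + 2 + 2)) := fun i =>
    (stdInvol_castSucc q (r + 1) i.castSucc.castSucc).trans
      (congrArg (fun i : Fin (q + 2 * r + 2) => i.castSucc.castSucc) (stdInvol_castSucc q r i))
  have h2 : stdInvol q (r + 2)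
      ((Fin.last (q + 2 * r)).castSucc.castSucc.castSucc : Fin (q + 2 * r + 2 + 2)) =
      ((Fin.last (q + 2 * r + 1)).castSucc.castSucc : Fin (q + 2 * r + 2 + 2)) :=
    (stdInvol_castSucc q (r + 1) (Fin.last (q + 2 * r)).castSucc).trans
      (congrArg (fun i : Fin (q + 2 * r + 2) => i.castSucc.castSucc) (stdInvol_last_castSucc q r))
  have h3 : stdInvol q (r + 2)
      ((Fin.last (q + 2 * r + 1)).castSucc.castSucc : Fin (q + 2 * r + 2 + 2)) =
      ((Fin.last (q + 2 * r)).castSucc.castSucc.castSucc : Fin (q + 2 * r + 2 + 2)) :=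
    (stdInvol_castSucc q (r + 1) (Fin.last (q + 2 * r + 1))).trans
      (congrArg (fun i : Fin (q + 2 * r + 2) => i.castSucc.castSucc) (stdInvol_last q r))
  have h4 : stdInvol q (r + 2) ((Fin.last (q + 2 * r + 2)).castSucc : Fin (q + 2 * r + 2 + 2)) =
      (Fin.last (q + 2 * r + 3) : Fin (q + 2 * r + 2 + 2)) := stdInvol_last_castSucc q (r + 1)
  have h5 : stdInvol q (r + 2) (Fin.last (q + 2 * r + 3) : Fin (q + 2 * r + 2 + 2)) =
      ((Fin.last (q + 2 * r + 2)).castSucc : Fin (q + 2 * r + 2 + 2)) := stdInvol_last q (r + 1)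
  rw [commute_iff]
  refine forall_fin_add_two (forall_fin_add_two (fun i => ?_) ?_ ?_) ?_ ?_
  · rw [h1, blockSwap_castSucc, blockSwap_castSucc, h1]
  · rw [h2, blockSwap_first, blockSwap_second, h4]
  · rw [h3, blockSwap_first, blockSwap_second, h5]
  · rw [h4, blockSwap_third, blockSwap_last, h2]
  · rw [h5, blockSwap_third, blockSwap_last, h3]

theorem exists_extendTwo {n : ℕ} {π : Perm (Fin (n + 2))} (h : π (Fin.last (n + 1)) = Fin.last _)
    (h' : π (Fin.last n).castSucc = (Fin.last n).castSucc) : ∃ π₀, π = extendTwo π₀ := by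
  have key : ∀ (σ : Perm (Fin (n + 2))), σ (Fin.last (n + 1)) = Fin.last _ →
      σ (Fin.last n).castSucc = (Fin.last n).castSucc →
      ∀ i : Fin n, ∃ j : Fin n, σ i.castSucc.castSucc = j.castSucc.castSucc := by
    intro σ h h' i
    have h1 : ∀ x : Fin (n + 2), x ≠ Fin.last (n + 1) → x ≠ (Fin.last n).castSucc →
        ∃ j : Fin n, x = j.castSucc.castSucc :=
      forall_fin_add_two (fun j _ _ => ⟨j, rfl⟩) (fun _ h => absurd rfl h) (fun h => absurd rfl h)
    refine h1 _ (fun e => ?_) (fun e => ?_)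
    · have := σ.injective (e.trans h.symm)
      simp only [Fin.ext_iff, Fin.val_castSucc, Fin.val_last] at this
      omega
    · have := σ.injective (e.trans h'.symm)
      simp only [Fin.ext_iff, Fin.val_castSucc, Fin.val_last] at this
      omega
  choose f hf using key π h h'
  choose g hg using key π⁻¹ (by rw [Perm.inv_eq_iff_eq, h]) (by rw [Perm.inv_eq_iff_eq, h'])
  refine ⟨⟨f, g, fun i => ?_, fun i => ?_⟩, ?_⟩
  · apply Fin.castSucc_injective _
    apply Fin.castSucc_injective _
    rw [← hg, ← hf]
    exact π.symm_apply_apply _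
  · apply Fin.castSucc_injective _
    apply Fin.castSucc_injective _
    rw [← hf, ← hg]
    exact π.apply_symm_apply _
  · refine Equiv.ext (forall_fin_add_two (fun i => ?_) ?_ ?_)
    · rw [extendTwo_castSucc, hf]
      rfl
    · rw [extendTwo_last_castSucc, h']
    · rw [extendTwo_last, h]

/-- The centralizer of `stdInvol` is transitive on the paired points: a point of an earlier pair is
first moved to the end of the earlier pairs, and then by `blockSwap` to the very end. -/
theorem exists_commute_apply_eq_last {q r : ℕ} (x : Fin (q + 2 * r + 2))
    (hx : stdInvol q (r + 1) x ≠ x) : ∃ ρ : Perm (Fin (q + 2 * r + 2)),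
      Commute ρ (stdInvol q (r + 1)) ∧ ρ x = Fin.last (q + 2 * r + 1) := by
  induction r with
  | zero =>
    revert x
    refine forall_fin_add_two (fun i hi => ?_) (fun _ => ?_) (fun _ => ?_)
    · exact absurd (stdInvol_castSucc q 0 i) hi
    · exact ⟨flipLast _, commute_flipLast q 0, flipLast_last_castSucc _⟩
    · exact ⟨1, Commute.one_left _, rfl⟩
  | succ r ih =>
    revert x
    refine forall_fin_add_two (fun i hi => ?_) (fun _ => ?_) (fun _ => ?_)
    · obtain ⟨ρ, hρ, hρi⟩ := ih i fun h => hi (by rw [stdInvol_castSucc, h])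
      refine ⟨blockSwap (q + 2 * r) * extendTwo ρ, (commute_blockSwap q r).mul_left
        (commute_extendTwo_iff.mpr hρ), ?_⟩
      rw [Perm.mul_apply, extendTwo_castSucc, hρi, blockSwap_second]
      rfl
    · exact ⟨flipLast _, commute_flipLast q (r + 1), flipLast_last_castSucc _⟩
    · exact ⟨1, Commute.one_left _, rfl⟩

/-- Through the numberings, a bijection of half-edges compatible with `κ` becomes one that
intertwines the standard involutions. -/
theorem numbering_stdInvol (Γ : HalfEdgeGraph) (x : Fin (Γ.numLegs + 2 * Γ.numEdges)) :
    Γ.numbering (stdInvol Γ.numLegs Γ.numEdges x) = Γ.κ (Γ.numbering x) := by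
  obtain ⟨y, rfl⟩ := finSumFinEquiv.surjective x
  rcases y with i | j
  · have h1 : stdInvol Γ.numLegs Γ.numEdges (finSumFinEquiv (Sum.inl i)) =
        finSumFinEquiv (Sum.inl i) := by
      ext
      rw [stdInvol_val, if_pos]
      simp
    have h2 : Γ.numbering (finSumFinEquiv (Sum.inl i)) = (Γ.legNumbering i).1 := by
      simp [HalfEdgeGraph.numbering, HalfEdgeGraph.halfEdgeEquiv]
    rw [h1, h2, (Γ.legNumbering i).2]
  · obtain ⟨k, rfl⟩ := (finCongr (Nat.mul_comm Γ.numEdges 2)).surjective j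
    obtain ⟨⟨e, i⟩, rfl⟩ := finProdFinEquiv.surjective k
    have h2 : ∀ i : Fin 2, Γ.numbering (finSumFinEquiv (Sum.inr
        ((finCongr (Nat.mul_comm Γ.numEdges 2)) (finProdFinEquiv (e, i))))) =
        if i = 0 then (Γ.edgeNumbering e).1 else Γ.κ (Γ.edgeNumbering e).1 := by
      intro i
      simp only [HalfEdgeGraph.numbering, HalfEdgeGraph.halfEdgeEquiv, Equiv.trans_apply,
        Equiv.symm_apply_apply, Equiv.sumCongr_apply, Sum.map_inr]
      have h3 : (finCongr (Nat.mul_comm 2 Γ.numEdges)) ((finCongr (Nat.mul_comm Γ.numEdges 2))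
        (finProdFinEquiv (e, i))) = finProdFinEquiv (e, i) := rfl
      rw [h3, Equiv.symm_apply_apply]
      rfl
    have h1 : stdInvol Γ.numLegs Γ.numEdges (finSumFinEquiv (Sum.inr
        ((finCongr (Nat.mul_comm Γ.numEdges 2)) (finProdFinEquiv (e, i))))) =
        finSumFinEquiv (Sum.inr ((finCongr (Nat.mul_comm Γ.numEdges 2))
          (finProdFinEquiv (e, 1 - i)))) := by
      ext
      rw [stdInvol_val]
      simp only [finSumFinEquiv_apply_right, Fin.val_natAdd, finCongr_apply, Fin.val_cast,
        finProdFinEquiv_apply_val]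
      rw [if_neg (by omega)]
      fin_cases i
      · rw [if_pos (by simp)]
        simp
        omega
      · rw [if_neg (by simp)]
        simp
        omega
    rw [h1, h2, h2]
    fin_cases i
    · simp
    · simp [Γ.κ_κ]

end StandardInvolution

/-! ### Isomorphism invariance of Feynman amplitudes -/

section Amplitude

open Equiv

variable {𝕜 E A : Type*} [RCLike 𝕜]
  [AddCommGroup E] [Module 𝕜 E] [TopologicalSpace E] [IsTopologicalAddGroup E]
  [ContinuousSMul 𝕜 E] [FirstCountableTopology E]
  [Ring A] [Algebra 𝕜 A] [UniformSpace A] [IsUniformAddGroup A] [ContinuousSMul 𝕜 A]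
  [ContinuousMul A] [PolynormableSpace 𝕜 A] [T2Space A] [CompleteSpace A]
  {gE : FinGrading 𝕜 E} {gA : FinGrading 𝕜 A}

theorem contractAll_succ (P : CTensor 𝕜 E E A) {q : ℕ} (r : ℕ)
    (f : MultiFun 𝕜 E A (Fin (q + 2 * r + 2))) :
    contractAll P (q := q) (r + 1) f = contractAll P r (contract P f) := rfl

variable (gE) in
/-- The permutation `π` of the arguments is compatible with the contraction of the last `r` pairs. -/
def Respects (P : CTensor 𝕜 E E A) (q r : ℕ) (π : Perm (Fin (q + 2 * r))) : Prop :=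
  ∃ σ : Perm (Fin q), ∀ f : MultiFun 𝕜 E A (Fin (q + 2 * r)),
    contractAll P r (transport gE π f) = transport gE σ (contractAll P r f)

theorem Respects.mul {P : CTensor 𝕜 E E A} {q r : ℕ} {π ρ : Perm (Fin (q + 2 * r))}
    (h : Respects gE P q r π) (h' : Respects gE P q r ρ) : Respects gE P q r (π * ρ) := by
  obtain ⟨σ, h⟩ := h
  obtain ⟨τ, h'⟩ := h'
  refine ⟨σ * τ, fun f => ?_⟩
  have h1 : ∀ {n : ℕ} (π ρ : Perm (Fin n)) (f : MultiFun 𝕜 E A (Fin n)),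
      transport gE (π * ρ) f = transport gE π (transport gE ρ f) := fun π ρ f =>
    transport_trans gE ρ π f
  rw [h1, h1, h, h']

theorem Respects.inv {P : CTensor 𝕜 E E A} {q r : ℕ} {π : Perm (Fin (q + 2 * r))}
    (h : Respects gE P q r π) : Respects gE P q r π⁻¹ := by
  obtain ⟨σ, h⟩ := h
  refine ⟨σ⁻¹, fun f => ?_⟩
  have h1 : ∀ {n : ℕ} (π : Perm (Fin n)) (f : MultiFun 𝕜 E A (Fin n)),
      transport gE π (transport gE π⁻¹ f) = f := fun π f => by
    rw [← transport_trans]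
    exact (congrArg (fun e => transport gE e f) (Equiv.ext fun x => by simp)).trans
      (transport_refl gE f)
  have h2 := h (transport gE π⁻¹ f)
  rw [h1] at h2
  rw [h2, ← inv_inv σ, inv_inv σ⁻¹]
  have h3 := h1 σ⁻¹ (contractAll P r (transport gE π⁻¹ f))
  rw [inv_inv] at h3
  exact h3.symm

theorem Respects.extendTwo (gA : FinGrading 𝕜 A) {P : CTensor 𝕜 E E A} {q r : ℕ}
    {π : Perm (Fin (q + 2 * r))}
    (h : Respects gE P q r π) : Respects gE P q (r + 1) (extendTwo π) := by
  obtain ⟨σ, h⟩ := h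
  refine ⟨σ, fun f => ?_⟩
  rw [contractAll_succ, contractAll_succ, ← h]
  exact congrArg (contractAll P r) (contract_transport_extendTwo gA π P f)

/-- A permutation in the centralizer that fixes the last point also fixes its partner, so it comes
from a permutation with one pair fewer. -/
theorem respects_of_fix (gA : FinGrading 𝕜 A) {P : CTensor 𝕜 E E A} {q r : ℕ}
    {π : Perm (Fin (q + 2 * r + 2))}
    (h : ∀ π : Perm (Fin (q + 2 * r)), Commute π (stdInvol q r) → Respects gE P q r π)
    (hπ : Commute π (stdInvol q (r + 1))) (hfix : π (Fin.last (q + 2 * r + 1)) = Fin.last _) :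
    Respects gE P q (r + 1) π := by
  have h' : π (Fin.last (q + 2 * r)).castSucc = (Fin.last (q + 2 * r)).castSucc := by
    have h1 := commute_iff.mp hπ (Fin.last (q + 2 * r + 1))
    rw [hfix, stdInvol_last] at h1
    exact h1
  obtain ⟨π₀, rfl⟩ := exists_extendTwo hfix h'
  exact (h π₀ (commute_extendTwo_iff.mp hπ)).extendTwo gA

/-- By induction on the number of pairs, `π` is composed with a compatible permutation that brings
the image of the last point back to the end; then the last pair can be dropped. Flips are compatible
because `P` is symmetric, exchanges of pairs because `P` is even. Without pairs only a permutation
of the legs remains. -/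
theorem respects_of_commute (hA : gA.IsGradedCommAlgebra) {P : CTensor 𝕜 E E A}
    (hP : IsPropagator gE gA P) (q r : ℕ) (π : Perm (Fin (q + 2 * r)))
    (hπ : Commute π (stdInvol q r)) : Respects gE P q r π := by
  induction r with
  | zero => exact ⟨π, fun f => rfl⟩
  | succ r ih =>
    have hflip : Respects gE P q (r + 1) (flipLast (q + 2 * r)) := by
      refine ⟨1, fun f => (?_ : _ = _).trans (transport_refl gE _).symm⟩
      rw [contractAll_succ, contractAll_succ]
      refine congrArg (contractAll P r) ?_
      rw [contract_transport_flipLast gA, hP.symm]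
    have hcases : ∀ x : Fin (q + 2 * r + 2), x = Fin.last (q + 2 * r + 1) ∨
        x = (Fin.last (q + 2 * r)).castSucc ∨ ∃ i : Fin (q + 2 * r), x = i.castSucc.castSucc :=
      forall_fin_add_two (fun i => Or.inr (Or.inr ⟨i, rfl⟩)) (Or.inr (Or.inl rfl)) (Or.inl rfl)
    change Perm (Fin (q + 2 * r + 2)) at π
    rcases hcases (π (Fin.last (q + 2 * r + 1))) with h | h | ⟨i, h⟩
    · exact respects_of_fix gA ih hπ h
    · have h1 : Respects gE P q (r + 1) (flipLast (q + 2 * r) * π) := by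
        refine respects_of_fix gA ih ((commute_flipLast q r).mul_left hπ) ?_
        rw [Perm.mul_apply, h, flipLast_last_castSucc]
      have h2 := hflip.inv.mul h1
      rwa [inv_mul_cancel_left] at h2
    · have hi : stdInvol q r i ≠ i := by
        intro hi
        have h1 := commute_iff.mp hπ (Fin.last (q + 2 * r + 1))
        rw [h, stdInvol_castSucc, hi, ← h] at h1
        have h2 := π.injective h1
        rw [stdInvol_last] at h2
        simp [Fin.ext_iff] at h2
      rcases r with _ | r
      · exact absurd rfl hi
      obtain ⟨ρ, hρ, hρi⟩ := exists_commute_apply_eq_last i hi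
      have hB : Respects gE P q (r + 2) (blockSwap (q + 2 * r)) := by
        refine ⟨1, fun f => (?_ : _ = _).trans (transport_refl gE _).symm⟩
        have hE := evenPart_of_isPropagator hP
        exact congrArg (contractAll P r) (contract_contract_transport_blockSwap hA hE hE f)
      have h1 : Respects gE P q (r + 2) (blockSwap (q + 2 * r) * extendTwo ρ * π) := by
        refine respects_of_fix gA ih (((commute_blockSwap q r).mul_left
          (commute_extendTwo_iff.mpr hρ)).mul_left hπ) ?_
        rw [Perm.mul_apply, h, Perm.mul_apply, extendTwo_castSucc, hρi]
        exact blockSwap_second _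
      have h2 := (hB.mul ((ih ρ hρ).extendTwo gA)).inv.mul h1
      rwa [inv_mul_cancel_left] at h2

/-- `Pi.single` places classes with equal but not definitionally equal numbers of legs in a common
type. -/
theorem symClass_contractAll_transport (hA : gA.IsGradedCommAlgebra) {P : CTensor 𝕜 E E A}
    (hP : IsPropagator gE gA P) {q q' r r' : ℕ} (hq : q = q') (hr : r = r')
    (π : Fin (q + 2 * r) ≃ Fin (q' + 2 * r'))
    (hπ : ∀ x, π (stdInvol q r x) = stdInvol q' r' (π x)) (f : MultiFun 𝕜 E A (Fin (q + 2 * r))) :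
    (Pi.single q' (symClass gE (contractAll P r' (transport gE π f))) : ∀ q, SymFun gE A q) =
      Pi.single q (symClass gE (contractAll P r f)) := by
  subst hq hr
  obtain ⟨σ, h⟩ := respects_of_commute hA hP q r π (commute_iff.mpr hπ)
  rw [h, symClass_transport]

theorem isDegZero_contractAll (hA : gA.IsGradedCommAlgebra) {P : CTensor 𝕜 E E A}
    (hP : IsPropagator gE gA P) {q : ℕ} (r : ℕ) {f : MultiFun 𝕜 E A (Fin (q + 2 * r))}
    (hf : IsDegZero gE gA f) : IsDegZero gE gA (contractAll P r f) := by
  induction r with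
  | zero => exact hf
  | succ r ih => exact ih (isDegZero_contract hA hP hf)

theorem contractAll_sum (P : CTensor 𝕜 E E A) {q : ℕ} (r : ℕ) {α : Type*} (s : Finset α)
    (f : α → MultiFun 𝕜 E A (Fin (q + 2 * r))) :
    contractAll P r (∑ a ∈ s, f a) = ∑ a ∈ s, contractAll P r (f a) := by
  induction r with
  | zero => rfl
  | succ r ih =>
    have h : contract P (∑ a ∈ s, f a : MultiFun 𝕜 E A (Fin (q + 2 * r + 2))) =
        ∑ a ∈ s, contract (n := q + 2 * r) P (f a) := map_sum (contractLin P (q + 2 * r)) f s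
    exact (congrArg (contractAll P r) h).trans (ih _)

theorem isDegZero_amplitude (hA : gA.IsGradedCommAlgebra) {P : CTensor 𝕜 E E A}
    (hP : IsPropagator gE gA P) (Γ : HalfEdgeGraph) {F : ∀ v, MultiFun 𝕜 E A (Γ.Fiber v)}
    (hF : ∀ v, IsDegZero gE gA (F v)) : IsDegZero gE gA (amplitude gE Γ F P) :=
  isDegZero_contractAll hA hP _ ((isDegZero_vertexTensor hA Γ hF).transport _)

theorem amplitude_sum (P : CTensor 𝕜 E E A) (Γ : HalfEdgeGraph) {α : Fin Γ.m → Type*}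
    [∀ v, Fintype (α v)] (F : ∀ v, α v → MultiFun 𝕜 E A (Γ.Fiber v)) :
    amplitude gE Γ (fun v => ∑ a, F v a) P =
      ∑ r : ∀ v, α v, amplitude gE Γ (fun v => F v (r v)) P := by
  rw [amplitude, vertexTensor_sum, map_sum, contractAll_sum]
  rfl

/-- The bijection between the half-edges at corresponding vertices of isomorphic graphs. -/
def fiberCongr {Γ Γ' : HalfEdgeGraph} (half : Fin Γ.n ≃ Fin Γ'.n) (vert : Fin Γ.m ≃ Fin Γ'.m)
    (hρ : ∀ h, Γ'.ρ (half h) = vert (Γ.ρ h)) (v : Fin Γ.m) : Γ.Fiber v ≃ Γ'.Fiber (vert v) :=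
  half.subtypeEquiv fun h => by rw [hρ, vert.apply_eq_iff_eq]

/-- The two orderings of half-edges differ by a bijection that intertwines the standard involutions.
It only permutes the legs of the amplitude, which is invisible in the symmetric coinvariants. -/
theorem symClass_amplitude_congr (hA : gA.IsGradedCommAlgebra) {P : CTensor 𝕜 E E A}
    (hP : IsPropagator gE gA P) {Γ Γ' : HalfEdgeGraph} (half : Fin Γ.n ≃ Fin Γ'.n)
    (vert : Fin Γ.m ≃ Fin Γ'.m) (hρ : ∀ h, Γ'.ρ (half h) = vert (Γ.ρ h))
    (hκ : ∀ h, Γ'.κ (half h) = half (Γ.κ h)) {F : ∀ v, MultiFun 𝕜 E A (Γ.Fiber v)}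
    {F' : ∀ v, MultiFun 𝕜 E A (Γ'.Fiber v)} (hF : ∀ v, IsDegZero gE gA (F v))
    (h : ∀ v, F' (vert v) = transport gE (fiberCongr half vert hρ v) (F v)) :
    (Pi.single Γ'.numLegs (symClass gE (amplitude gE Γ' F' P)) : ∀ q, SymFun gE A q) =
      Pi.single Γ.numLegs (symClass gE (amplitude gE Γ F P)) := by
  have hL : Γ.numLegs = Γ'.numLegs := Fintype.card_congr
    (half.subtypeEquiv fun x => by rw [hκ, half.apply_eq_iff_eq])
  have hn : Γ.n = Γ'.n := by simpa using Fintype.card_congr half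
  have hE : Γ.numEdges = Γ'.numEdges := by
    have h1 := Γ.card_halfEdges
    have h2 := Γ'.card_halfEdges
    omega
  have h1 := symClass_contractAll_transport hA hP hL hE
    ((Γ.numbering.trans half).trans Γ'.numbering.symm) (fun x => by
      simp only [Equiv.trans_apply]
      rw [numbering_stdInvol, ← hκ, Equiv.symm_apply_eq, numbering_stdInvol,
        Equiv.apply_symm_apply])
    (transport gE ((toLex.symm.trans (Equiv.sigmaFiberEquiv Γ.ρ)).trans Γ.numbering.symm)
      (vertexTensor Γ F))
  rw [amplitude, amplitude, ← h1, vertexTensor_transport hA vert (fiberCongr half vert hρ) hF h,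
    ← transport_trans, ← transport_trans]
  have h2 : (sigmaLexCongr vert (fiberCongr half vert hρ)).trans
      ((toLex.symm.trans (Equiv.sigmaFiberEquiv Γ'.ρ)).trans Γ'.numbering.symm) =
      ((toLex.symm.trans (Equiv.sigmaFiberEquiv Γ.ρ)).trans Γ.numbering.symm).trans
        ((Γ.numbering.trans half).trans Γ'.numbering.symm) := by
    refine Equiv.ext fun x => ?_
    obtain ⟨⟨v, x⟩, rfl⟩ := toLex.surjective x
    simp only [Equiv.trans_apply, sigmaLexCongr_apply, Equiv.apply_symm_apply]
    rfl
  rw [h2]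

end Amplitude

/-! ### Ribbon structures on a stable graph and the comparison of automorphism groups -/

section Isomorphisms

open Equiv

namespace StableGraph

variable {Γ Γ' Γ'' : StableGraph}

/-- The inverse of an isomorphism. -/
def Iso.symm (f : Iso Γ Γ') : Iso Γ' Γ where
  half := f.half.symm
  vert := f.vert.symm
  map_ρ h := by rw [Equiv.eq_symm_apply, ← f.map_ρ, Equiv.apply_symm_apply]
  map_κ h := by rw [Equiv.eq_symm_apply, ← f.map_κ, Equiv.apply_symm_apply]
  map_loop v := by rw [← f.map_loop, Equiv.apply_symm_apply]

/-- The composition of isomorphisms. -/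
def Iso.trans (f : Iso Γ Γ') (f' : Iso Γ' Γ'') : Iso Γ Γ'' where
  half := f.half.trans f'.half
  vert := f.vert.trans f'.vert
  map_ρ h := by simp [f.map_ρ, f'.map_ρ]
  map_κ h := by simp [f.map_κ, f'.map_κ]
  map_loop v := by simp [f.map_loop, f'.map_loop]

instance : Finite (Iso Γ Γ') :=
  Finite.of_injective (fun f : Iso Γ Γ' => (f.half, f.vert)) fun _ _ h =>
    Iso.ext (congrArg Prod.fst h) (congrArg Prod.snd h)

theorem Iso.card_eq (f : Iso Γ Γ') : Nat.card (Iso Γ Γ') = Γ'.numAut :=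
  Nat.card_congr
    { toFun := fun g => f.symm.trans g
      invFun := fun g => f.trans g
      left_inv := fun _ => by ext x <;> simp [trans, symm]
      right_inv := fun _ => by ext x <;> simp [trans, symm] }

theorem numAut_ne_zero (Γ : StableGraph) : Γ.numAut ≠ 0 := by
  have : Nonempty (Iso Γ Γ) := Quotient.exact (s := setoid) rfl
  exact Nat.card_pos.ne'

theorem Iso.numLegs_eq (f : Iso Γ Γ') : Γ.numLegs = Γ'.numLegs := Fintype.card_congr
  (f.half.subtypeEquiv fun x => by rw [f.map_κ, f.half.apply_eq_iff_eq])

theorem Iso.numEdges_eq (f : Iso Γ Γ') : Γ.numEdges = Γ'.numEdges := by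
  have hn : Γ.n = Γ'.n := by simpa using Fintype.card_congr f.half
  have h0 := f.numLegs_eq
  have h1 := Γ.card_halfEdges
  have h2 := Γ'.card_halfEdges
  omega

theorem Iso.numComponents_eq (f : Iso Γ Γ') : Γ.numComponents = Γ'.numComponents := by
  refine Nat.card_congr (Quot.congr f.vert fun v w => ?_)
  constructor
  · rintro ⟨h, rfl, rfl⟩
    exact ⟨f.half h, f.map_ρ h, by rw [f.map_κ, f.map_ρ]⟩
  · rintro ⟨h, hv, hw⟩
    refine ⟨f.half.symm h, ?_, ?_⟩
    · rw [← f.vert.apply_eq_iff_eq, ← f.map_ρ, Equiv.apply_symm_apply, hv]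
    · rw [← f.vert.apply_eq_iff_eq, ← f.map_ρ, ← f.map_κ, Equiv.apply_symm_apply, hw]

theorem Iso.connected_iff (f : Iso Γ Γ') : Γ.Connected ↔ Γ'.Connected := by
  rw [HalfEdgeGraph.Connected, HalfEdgeGraph.Connected, f.numComponents_eq]

theorem Iso.loopNumber_eq (f : Iso Γ Γ') : Γ.loopNumber = Γ'.loopNumber := by
  have hm : Γ.m = Γ'.m := by simpa using Fintype.card_congr f.vert
  have hl : ∑ v, (Γ.loop v : ℤ) = ∑ v, (Γ'.loop v : ℤ) := by
    rw [← f.vert.sum_comp]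
    exact Finset.sum_congr rfl fun v _ => by rw [f.map_loop]
  rw [loopNumber, loopNumber, HalfEdgeGraph.betti, HalfEdgeGraph.betti, hl, f.numEdges_eq,
    f.numComponents_eq, hm]

end StableGraph

namespace RibbonGraph

variable {Γ Γ' Γ'' : RibbonGraph}

/-- The inverse of an isomorphism. -/
def Iso.symm (f : Iso Γ Γ') : Iso Γ' Γ where
  half := f.half.symm
  vert := f.vert.symm
  map_ρ h := by rw [Equiv.eq_symm_apply, ← f.map_ρ, Equiv.apply_symm_apply]
  map_κ h := by rw [Equiv.eq_symm_apply, ← f.map_κ, Equiv.apply_symm_apply]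
  map_c h := by rw [Equiv.eq_symm_apply, ← f.map_c, Equiv.apply_symm_apply]
  map_gen v := by rw [← f.map_gen, Equiv.apply_symm_apply]
  map_bdry v := by rw [← f.map_bdry, Equiv.apply_symm_apply]

/-- The composition of isomorphisms. -/
def Iso.trans (f : Iso Γ Γ') (f' : Iso Γ' Γ'') : Iso Γ Γ'' where
  half := f.half.trans f'.half
  vert := f.vert.trans f'.vert
  map_ρ h := by simp [f.map_ρ, f'.map_ρ]
  map_κ h := by simp [f.map_κ, f'.map_κ]
  map_c h := by simp [f.map_c, f'.map_c]
  map_gen v := by simp [f.map_gen, f'.map_gen]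
  map_bdry v := by simp [f.map_bdry, f'.map_bdry]

instance : Finite (Iso Γ Γ') :=
  Finite.of_injective (fun f : Iso Γ Γ' => (f.half, f.vert)) fun _ _ h =>
    Iso.ext (congrArg Prod.fst h) (congrArg Prod.snd h)

/-- Here the automorphisms of the source are counted, for stable graphs those of the target: this is
the form in which the two enter `RibbonStr.card_mul_numAut`. -/
theorem Iso.card_eq (f : Iso Γ Γ') : Nat.card (Iso Γ Γ') = Γ.numAut :=
  Nat.card_congr
    { toFun := fun g => g.trans f.symm
      invFun := fun g => g.trans f
      left_inv := fun _ => by ext x <;> simp [trans, symm]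
      right_inv := fun _ => by ext x <;> simp [trans, symm] }

theorem numAut_ne_zero (Γ : RibbonGraph) : Γ.numAut ≠ 0 := by
  have : Nonempty (Iso Γ Γ) := Quotient.exact (s := setoid) rfl
  exact Nat.card_pos.ne'

theorem Iso.permCongr_cyc (f : Iso Γ Γ') (v : Fin Γ.m) :
    (fiberCongr f.half f.vert f.map_ρ v).permCongr (Γ.cyc v) = Γ'.cyc (f.vert v) := by
  refine Equiv.ext fun x => ?_
  obtain ⟨x, rfl⟩ := (fiberCongr f.half f.vert f.map_ρ v).surjective x
  rw [Equiv.permCongr_apply, Equiv.symm_apply_apply]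
  exact Subtype.ext (f.map_c x.1).symm

theorem Iso.toStable_loop (f : Iso Γ Γ') (v : Fin Γ.m) :
    Γ'.toStable.loop (f.vert v) = Γ.toStable.loop v := by
  have h1 := Γ.toStable_loop v
  have h2 := Γ'.toStable_loop (f.vert v)
  rw [f.map_gen, f.map_bdry, ← f.permCongr_cyc, numCycles_permCongr] at h2
  omega

/-- The isomorphism of the underlying stable graphs. -/
def Iso.toStable (f : Iso Γ Γ') : StableGraph.Iso Γ.toStable Γ'.toStable where
  half := f.half
  vert := f.vert
  map_ρ := f.map_ρ
  map_κ := f.map_κ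
  map_loop := f.toStable_loop

end RibbonGraph

/-- The possible values of the genus, the boundary and the cyclic decomposition at a vertex with
loop number `p` and set of half-edges `X`. -/
abbrev VertexStr (p : ℕ) (X : Type*) : Type _ :=
  {x : Fin (p + 2) × Fin (p + 2) × Perm X //
    2 * (x.1 : ℕ) + (x.2.1 : ℕ) + numCycles x.2.2 = p + 1 ∧ 0 < numCycles x.2.2 + (x.2.1 : ℕ)}

/-- The structures of a stable ribbon graph on a stable graph. -/
abbrev RibbonStr (G : StableGraph) : Type := ∀ v : Fin G.m, VertexStr (G.loop v) (G.Fiber v)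

namespace RibbonStr

variable {G : StableGraph} (s : RibbonStr G)

/-- The permutation of all half-edges determined by the cyclic decompositions at the vertices. -/
def perm : Perm (Fin G.n) :=
  (Equiv.sigmaFiberEquiv G.ρ).permCongr (Perm.sigmaCongrRight fun v => (s v).1.2.2)

theorem perm_apply (x : Fin G.n) : s.perm x = ((s (G.ρ x)).1.2.2 ⟨x, rfl⟩).1 := rfl

theorem coe_apply {v : Fin G.m} {x : Fin G.n} (hx : G.ρ x = v) :
    ((s v).1.2.2 ⟨x, hx⟩).1 = s.perm x := by
  subst hx
  rfl

theorem ρ_perm (x : Fin G.n) : G.ρ (s.perm x) = G.ρ x :=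
  ((s (G.ρ x)).1.2.2 ⟨x, rfl⟩).2

theorem vertexPerm_perm (v : Fin G.m) : G.vertexPerm s.perm s.ρ_perm v = (s v).1.2.2 := by
  refine Equiv.ext fun x => ?_
  obtain ⟨x, rfl⟩ := x
  exact Subtype.ext (s.perm_apply x)

/-- The stable ribbon graph determined by a ribbon structure. -/
def toRibbon : RibbonGraph where
  toHalfEdgeGraph := G.toHalfEdgeGraph
  c := s.perm
  ρ_c := s.ρ_perm
  gen v := (s v).1.1
  bdry v := (s v).1.2.1
  pos v := by
    rw [vertexPerm_perm]
    exact (s v).2.2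
  stable v := by
    rw [vertexPerm_perm]
    have h1 := (s v).2.1
    have h2 := G.stable v
    zify at h1 h2
    linarith

theorem toRibbon_cyc (v : Fin G.m) : s.toRibbon.cyc v = (s v).1.2.2 := s.vertexPerm_perm v

theorem toStable_loop_toRibbon (v : Fin G.m) : s.toRibbon.toStable.loop v = G.loop v := by
  have h1 := s.toRibbon.toStable_loop v
  rw [toRibbon_cyc] at h1
  have h2 := (s v).2.1
  change _ = 2 * ((s v).1.1 : ℕ) + ((s v).1.2.1 : ℕ) + _ at h1
  exact Nat.succ_injective (h1.trans h2)

/-- The stable graph underlying the ribbon graph of a ribbon structure on `G` is `G`. -/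
def isoToStable : StableGraph.Iso s.toRibbon.toStable G where
  half := Equiv.refl _
  vert := Equiv.refl _
  map_ρ _ := rfl
  map_κ _ := rfl
  map_loop v := (s.toStable_loop_toRibbon v).symm

/-- Forget the ribbon structures. -/
def forget (R : RibbonGraph) (x : Σ s : RibbonStr G, RibbonGraph.Iso R s.toRibbon) :
    StableGraph.Iso R.toStable G :=
  x.2.toStable.trans x.1.isoToStable

/-- An isomorphism of underlying stable graphs carries the genera, boundaries and cycles of `R` to
exactly one ribbon structure on `G` for which it is an isomorphism of ribbon graphs. -/
theorem forget_bijective (R : RibbonGraph) :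
    Function.Bijective (forget R : _ → StableGraph.Iso R.toStable G) := by
  constructor
  · rintro ⟨s, f⟩ ⟨s', f'⟩ h
    have hh : f.half = f'.half := congrArg StableGraph.Iso.half h
    have hv : f.vert = f'.vert := congrArg StableGraph.Iso.vert h
    obtain rfl : s = s' := by
      funext v
      obtain ⟨w, rfl⟩ := f.vert.surjective v
      have h1 := (f.map_gen w).trans (f'.map_gen w).symm
      have h2 := (f.map_bdry w).trans (f'.map_bdry w).symm
      rw [← hv] at h1 h2
      refine Subtype.ext (Prod.ext (Fin.ext h1) (Prod.ext (Fin.ext h2) (Equiv.ext fun x => ?_)))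
      obtain ⟨x, hx⟩ := x
      obtain ⟨y, rfl⟩ := f.half.surjective x
      have h3 := (f.map_c y).trans ((congrArg (fun e => e (R.c y)) hh).trans (f'.map_c y).symm)
      rw [← hh] at h3
      change s.perm (f.half y) = s'.perm (f.half y) at h3
      exact Subtype.ext ((s.coe_apply hx).trans (h3.trans (s'.coe_apply hx).symm))
    obtain rfl : f = f' := RibbonGraph.Iso.ext hh hv
    rfl
  · intro f
    let half : Fin R.n ≃ Fin G.n := f.half
    let vert : Fin R.m ≃ Fin G.m := f.vert
    have hρ : ∀ h, G.ρ (half h) = vert (R.ρ h) := f.map_ρ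
    have hc : ∀ h, G.ρ (half.permCongr R.c h) = G.ρ h := by
      intro h
      obtain ⟨h, rfl⟩ := half.surjective h
      rw [Equiv.permCongr_apply, Equiv.symm_apply_apply, hρ, hρ, R.ρ_c]
    have hcyc : ∀ v, numCycles (G.vertexPerm (half.permCongr R.c) hc v) =
        numCycles (R.cyc (vert.symm v)) := by
      intro v
      obtain ⟨w, rfl⟩ := vert.surjective v
      rw [Equiv.symm_apply_apply]
      refine numCycles_congr (fiberCongr half vert hρ w) fun x => Subtype.ext ?_
      change half (R.c (half.symm (half x.1))) = _
      rw [Equiv.symm_apply_apply]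
      rfl
    have hloop : ∀ v, 2 * R.gen (vert.symm v) + R.bdry (vert.symm v) +
        numCycles (R.cyc (vert.symm v)) = G.loop v + 1 := by
      intro v
      have h1 : R.toStable.loop (vert.symm v) = G.loop v :=
        (f.map_loop (vert.symm v)).symm.trans (congrArg G.loop (vert.apply_symm_apply v))
      rw [← R.toStable_loop, h1]
    let s : RibbonStr G := fun v =>
      ⟨(⟨R.gen (vert.symm v), by have := hloop v; omega⟩,
        ⟨R.bdry (vert.symm v), by have := hloop v; omega⟩,
        G.vertexPerm (half.permCongr R.c) hc v), by
          rw [hcyc]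
          exact ⟨hloop v, R.pos _⟩⟩
    refine ⟨⟨s, ⟨half, vert, hρ, f.map_κ, fun h => ?_, fun v => ?_, fun v => ?_⟩⟩, ?_⟩
    · change half (R.c (half.symm (half h))) = half (R.c h)
      rw [Equiv.symm_apply_apply]
    · exact congrArg R.gen (vert.symm_apply_apply v)
    · exact congrArg R.bdry (vert.symm_apply_apply v)
    · rfl

-- Both sides count the isomorphisms from `R.toStable` to `G`. By `forget_bijective` they are
-- grouped by ribbon structures `s`, and each `s` with `s.toRibbon` isomorphic to `R` contributes
-- `|Aut R|` of them.
open scoped Classical in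
theorem card_mul_numAut (R : RibbonGraph) (f : StableGraph.Iso R.toStable G) :
    (Finset.univ.filter fun s : RibbonStr G => Nonempty (RibbonGraph.Iso R s.toRibbon)).card *
      R.numAut = G.numAut := by
  rw [← f.card_eq, ← Nat.card_congr (Equiv.ofBijective _ (forget_bijective R)), Nat.card_sigma,
    Finset.card_eq_sum_ones, Finset.sum_mul, Finset.sum_filter]
  refine Finset.sum_congr rfl fun s _ => ?_
  split_ifs with h
  · obtain ⟨g⟩ := h
    rw [one_mul, g.card_eq]
  · rw [not_nonempty_iff] at h
    exact Nat.card_of_isEmpty.symm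

-- Grouping the ribbon structures by the isomorphism class of their ribbon graphs, a class `Q` in
-- `T` occurs `|Aut G| / |Aut Q|` times.
open scoped Classical in
theorem inv_numAut_smul_sum {𝕜 M : Type*} [Field 𝕜] [CharZero 𝕜] [AddCommGroup M] [Module 𝕜 M]
    (Φ : RibbonGraph → M) (hΦ : ∀ R R', Nonempty (RibbonGraph.Iso R R') → Φ R = Φ R')
    (G : StableGraph) (T : Finset (Quotient RibbonGraph.setoid))
    (hT : ∀ Q, Q ∈ T ↔ Nonempty (StableGraph.Iso Q.out.toStable G)) :
    (G.numAut : 𝕜)⁻¹ • ∑ s : RibbonStr G, Φ s.toRibbon =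
      ∑ Q ∈ T, (Q.out.numAut : 𝕜)⁻¹ • Φ Q.out := by
  have hmk : ∀ s : RibbonStr G, Nonempty (RibbonGraph.Iso
      (Quotient.mk RibbonGraph.setoid s.toRibbon).out s.toRibbon) := fun s =>
    Quotient.mk_out (s := RibbonGraph.setoid) s.toRibbon
  rw [← Finset.sum_fiberwise_of_maps_to (t := T)
    (g := fun s : RibbonStr G => Quotient.mk RibbonGraph.setoid s.toRibbon), Finset.smul_sum]
  · refine Finset.sum_congr rfl fun Q hQ => ?_
    obtain ⟨f⟩ := (hT Q).mp hQ
    have h1 : (Finset.univ.filter fun s : RibbonStr G =>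
        Quotient.mk RibbonGraph.setoid s.toRibbon = Q) =
        Finset.univ.filter fun s : RibbonStr G => Nonempty (RibbonGraph.Iso Q.out s.toRibbon) := by
      refine Finset.filter_congr fun s _ => ?_
      constructor
      · rintro rfl
        exact hmk s
      · intro h
        rw [← Quotient.out_eq Q]
        exact (Quotient.sound (s := RibbonGraph.setoid) h).symm
    have h2 := card_mul_numAut Q.out f
    rw [h1, Finset.sum_congr rfl (g := fun _ => Φ Q.out) fun s hs =>
      (hΦ _ _ (Finset.mem_filter.mp hs).2).symm, Finset.sum_const, ← Nat.cast_smul_eq_nsmul 𝕜,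
      smul_smul, ← h2]
    have h3 : (Q.out.numAut : 𝕜) ≠ 0 := Nat.cast_ne_zero.mpr Q.out.numAut_ne_zero
    have h4 := G.numAut_ne_zero
    rw [← h2] at h4
    have h5 := Nat.cast_ne_zero (R := 𝕜).mpr (left_ne_zero_of_mul h4)
    congr 1
    push_cast
    field_simp
  · intro s _
    rw [hT]
    obtain ⟨g⟩ := hmk s
    exact ⟨g.toStable.trans s.isoToStable⟩

end RibbonStr

end Isomorphisms

/-! ### Attaching symmetrized products of cyclic words to a vertex -/

section Attach

open Equiv

variable {𝕜 E A : Type*} [RCLike 𝕜]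
  [AddCommGroup E] [Module 𝕜 E] [TopologicalSpace E] [IsTopologicalAddGroup E]
  [Ring A] [Algebra 𝕜 A] [UniformSpace A] [IsUniformAddGroup A] [ContinuousSMul 𝕜 A]
  (gE : FinGrading 𝕜 E) {X : Type*} [Fintype X] [LinearOrder X]

theorem attachSym_mkQ (n : ℕ) (f : MultiFun 𝕜 E A (Fin n)) :
    attachSym gE n ((symRel gE A n).mkQ f) = ∑ φ : Fin n ≃ X, transport gE φ f := by
  simp [attachSym, LinearMap.sum_apply]

open scoped Classical in
theorem attachCyc_mkQ (cX : Perm X) (k l : ℕ) (f : CycDecomp k l → MultiFun 𝕜 E A (Fin l)) :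
    attachCyc gE cX k l ((cycRel gE A k l).mkQ f) =
      ∑ c : CycDecomp k l, ∑ φ : Fin l ≃ X,
        if φ.permCongr c.1 = cX then transport gE φ (f c) else 0 := by
  simp only [attachCyc, Submodule.mkQ_apply, Submodule.liftQ_apply, LinearMap.sum_apply]
  refine Finset.sum_congr rfl fun c _ => Finset.sum_congr rfl fun φ _ => ?_
  split_ifs <;> rfl

/-- The symmetrization of a product of cyclic words is attached to `X` by summing over all cyclic
decompositions of `X` with the right number of cycles. -/
theorem attachSym_cycToSym (k n : ℕ) (w : CycFun gE A k n) :
    attachSym gE n (cycToSym gE k n w) =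
      ∑ c : Perm X, if numCycles c = k then attachCyc gE c k n w else 0 := by
  classical
  obtain ⟨f, rfl⟩ := Submodule.mkQ_surjective _ w
  have h1 : cycToSym gE k n ((cycRel gE A k n).mkQ f) = (symRel gE A n).mkQ (∑ c, f c) := by
    simp [cycToSym]
  -- A bijection carries `d` to exactly one decomposition of `X`, and that has `k` cycles. The
  -- condition on `numCycles c` is thus absorbed into `c = φ.permCongr d`, and the sum over `c`
  -- collapses.
  have h2 : ∀ c : Perm X, (if numCycles c = k then attachCyc gE c k n ((cycRel gE A k n).mkQ f)
      else 0) = ∑ d : CycDecomp k n, ∑ φ : Fin n ≃ X,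
        if c = φ.permCongr d.1 then transport gE φ (f d) else 0 := by
    intro c
    split_ifs with hc
    · rw [attachCyc_mkQ]
      exact Finset.sum_congr rfl fun d _ => Finset.sum_congr rfl fun φ _ => if_congr eq_comm rfl rfl
    · refine (Finset.sum_eq_zero fun d _ => Finset.sum_eq_zero fun φ _ => if_neg ?_).symm
      rintro rfl
      exact hc ((numCycles_permCongr φ d.1).trans d.2)
  rw [h1, attachSym_mkQ, Finset.sum_congr rfl fun c _ => h2 c, Finset.sum_comm]
  simp only [map_sum]
  rw [Finset.sum_comm]
  refine Finset.sum_congr rfl fun d _ => ?_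
  rw [Finset.sum_comm]
  refine Finset.sum_congr rfl fun φ _ => ?_
  rw [Finset.sum_ite_eq' Finset.univ (φ.permCongr d.1) fun _ => transport gE φ (f d),
    if_pos (Finset.mem_univ _)]

theorem attachCyc_transport {Y : Type*} [Fintype Y] [LinearOrder Y] (e : X ≃ Y) (cX : Perm X)
    (k l : ℕ) (w : CycFun gE A k l) :
    attachCyc gE (e.permCongr cX) k l w = transport gE e (attachCyc gE cX k l w) := by
  classical
  obtain ⟨f, rfl⟩ := Submodule.mkQ_surjective _ w
  rw [attachCyc_mkQ, attachCyc_mkQ, map_sum]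
  refine Finset.sum_congr rfl fun c _ => ?_
  rw [map_sum, ← (Equiv.equivCongr (Equiv.refl (Fin l)) e).sum_comp]
  refine Finset.sum_congr rfl fun φ _ => ?_
  have h1 : Equiv.equivCongr (Equiv.refl (Fin l)) e φ = φ.trans e := by
    ext x
    simp [Equiv.equivCongr]
  have h2 : (φ.trans e).permCongr c.1 = e.permCongr (φ.permCongr c.1) := by
    ext x
    simp [Equiv.permCongr_apply]
  rw [h1, h2, transport_trans, apply_ite (transport gE e), map_zero]
  exact if_congr e.permCongr.apply_eq_iff_eq rfl rfl

end Attach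

/-! ### The map `σ_{γ,ν}` on monomials, interactions and vertices -/

section Sigma

open Equiv

/-- Natural solutions of `2i + j + k = p + 1` have all entries below `p + 2`, so the finite ranges
lose nothing. -/
theorem sum_range_triple {M : Type*} [AddCommMonoid M] (p i₀ j₀ k₀ : ℕ) (y : M) :
    (∑ i ∈ Finset.range (p + 2), ∑ j ∈ Finset.range (p + 2), ∑ k ∈ Finset.range (p + 2),
      if 2 * i + j + k = p + 1 then (if i = i₀ ∧ j = j₀ ∧ k = k₀ then y else 0) else 0) =
      if 2 * i₀ + j₀ + k₀ = p + 1 then y else 0 := by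
  split_ifs with h
  · rw [Finset.sum_eq_single_of_mem i₀ (Finset.mem_range.mpr (by omega)),
      Finset.sum_eq_single_of_mem j₀ (Finset.mem_range.mpr (by omega)),
      Finset.sum_eq_single_of_mem k₀ (Finset.mem_range.mpr (by omega)), if_pos h,
      if_pos ⟨rfl, rfl, rfl⟩]
    · intro k _ hk
      simp [hk]
    · intro j _ hj
      exact Finset.sum_eq_zero fun k _ => by simp [hj]
    · intro i _ hi
      exact Finset.sum_eq_zero fun j _ => Finset.sum_eq_zero fun k _ => by simp [hi]
  · refine Finset.sum_eq_zero fun i _ => Finset.sum_eq_zero fun j _ =>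
      Finset.sum_eq_zero fun k _ => ?_
    split_ifs with h1 h2
    · obtain ⟨rfl, rfl, rfl⟩ := h2
      exact absurd h1 h
    · rfl
    · rfl

variable {𝕜 E A : Type*} [RCLike 𝕜]
  [AddCommGroup E] [Module 𝕜 E] [TopologicalSpace E] [IsTopologicalAddGroup E]
  [ContinuousSMul 𝕜 E] [FirstCountableTopology E]
  [Ring A] [Algebra 𝕜 A] [UniformSpace A] [IsUniformAddGroup A] [ContinuousSMul 𝕜 A]
  (gE : FinGrading 𝕜 E) {gA : FinGrading 𝕜 A}

theorem sigmaMap_apply (I : NCFunctional gE A) (p q : ℕ) :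
    sigmaMap gE I p q = ∑ i ∈ Finset.range (p + 2), ∑ j ∈ Finset.range (p + 2),
      ∑ k ∈ Finset.range (p + 2),
        if 2 * i + j + k = p + 1 then cycToSym gE k q (I i j k q) else 0 := rfl

theorem cycToSym_single {K L : ℕ} (w : CycFun gE A K L) (k l : ℕ) :
    cycToSym gE k l ((Pi.single K (Pi.single L w) : ∀ k l, CycFun gE A k l) k l) =
      if k = K then (Pi.single L (cycToSym gE K L w) : ∀ l, SymFun gE A l) l else 0 := by
  split_ifs with hk
  · subst hk
    rcases eq_or_ne l L with rfl | hl
    · simp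
    · simp [Pi.single_eq_of_ne hl]
  · simp [Pi.single_eq_of_ne hk]

theorem sigmaMap_ncMonomial (i j : ℕ) {l : ℕ} (c : Perm (Fin l)) (f : MultiFun 𝕜 E A (Fin l))
    (h : 1 ≤ j + numCycles c) :
    sigmaMap gE (ncMonomial gE i j (cycClass gE c f)) =
      commMonomial gE (2 * i + j + numCycles c - 1) (symClass gE f) := by
  funext p q
  have h1 : ∀ i' j' k', cycToSym gE k' q (ncMonomial gE i j (cycClass gE c f) i' j' k' q) =
      if i' = i ∧ j' = j ∧ k' = numCycles c then
        (Pi.single l (symClass gE f) : ∀ l, SymFun gE A l) q else 0 := by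
    intro i' j' k'
    rw [ncMonomial]
    by_cases hi : i' = i
    · subst hi
      by_cases hj : j' = j
      · subst hj
        rw [Pi.single_eq_same, Pi.single_eq_same, cycToSym_single, cycToSym_cycClass]
        simp
      · rw [Pi.single_eq_same, Pi.single_eq_of_ne hj, if_neg fun h => hj h.2.1]
        exact map_zero _
    · rw [Pi.single_eq_of_ne hi, if_neg fun h => hi h.1]
      exact map_zero _
  simp only [sigmaMap_apply, h1]
  rw [sum_range_triple, commMonomial]
  split_ifs with hp
  · obtain rfl : p = 2 * i + j + numCycles c - 1 := by omega
    rw [Pi.single_eq_same]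
  · rw [Pi.single_eq_of_ne (by omega)]
    rfl

theorem IsNCInteraction.sigmaMap {I : NCFunctional gE A} (hI : IsNCInteraction gE gA I) :
    IsCommInteraction gE gA (sigmaMap gE I) where
  degZero p q := by
    rw [sigmaMap_apply]
    refine Submodule.sum_mem (symDegZeroSubmodule gE gA q) fun i _ => Submodule.sum_mem _ fun j _ =>
      Submodule.sum_mem _ fun k _ => ?_
    split_ifs
    · exact symDegZero_cycToSym (hI.degZero i j k q)
    · exact Submodule.zero_mem _
  eq_zero p q h := by
    rw [sigmaMap_apply]
    refine Finset.sum_eq_zero fun i _ => Finset.sum_eq_zero fun j _ =>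
      Finset.sum_eq_zero fun k _ => ?_
    split_ifs with hp
    -- Since `2i + j + k - 1 = p`, the two vanishing conditions coincide.
    · rw [hI.eq_zero i j k q (by zify at hp h; linarith), map_zero]
    · rfl

/-- The exponent rule of `σ` matches the loop number of a ribbon vertex, and symmetrization sums
over cyclic decompositions of `X`; together they enumerate the possible ribbon vertices. -/
theorem attachSym_sigmaMap {X : Type*} [Fintype X] [LinearOrder X] {I : NCFunctional gE A}
    (hI : ∀ i l, I i 0 0 l = 0) (p n : ℕ) :
    attachSym gE n (sigmaMap gE I p n) = ∑ x : VertexStr p X,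
      attachCyc gE x.1.2.2 (numCycles x.1.2.2) n (I x.1.1 x.1.2.1 (numCycles x.1.2.2) n) := by
  classical
  rw [← Finset.sum_subtype (Finset.univ.filter fun x : Fin (p + 2) × Fin (p + 2) × Perm X =>
      2 * (x.1 : ℕ) + (x.2.1 : ℕ) + numCycles x.2.2 = p + 1 ∧
        0 < numCycles x.2.2 + (x.2.1 : ℕ)) (by simp)
    fun x => attachCyc gE x.2.2 (numCycles x.2.2) n (I x.1 x.2.1 (numCycles x.2.2) n),
    Finset.sum_filter, Fintype.sum_prod_type, sigmaMap_apply, map_sum,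
    ← Fin.sum_univ_eq_sum_range (n := p + 2)]
  refine Finset.sum_congr rfl fun i _ => ?_
  rw [Fintype.sum_prod_type, map_sum, ← Fin.sum_univ_eq_sum_range (n := p + 2)]
  refine Finset.sum_congr rfl fun j _ => ?_
  rw [map_sum]
  simp only [apply_ite (attachSym gE n), map_zero, attachSym_cycToSym]
  have h1 : ∀ k, (if 2 * (i : ℕ) + j + k = p + 1 then ∑ c : Perm X, (if numCycles c = k then
      attachCyc gE c k n (I i j k n) else 0) else 0) = ∑ c : Perm X, if k = numCycles c then
        (if 2 * (i : ℕ) + j + numCycles c = p + 1 then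
          attachCyc gE c (numCycles c) n (I i j (numCycles c) n) else 0) else 0 := by
    intro k
    split_ifs with hk
    · refine Finset.sum_congr rfl fun c _ => ?_
      by_cases hc : numCycles c = k
      · subst hc
        rw [if_pos rfl, if_pos rfl, if_pos hk]
      · rw [if_neg hc, if_neg (Ne.symm hc)]
    · refine (Finset.sum_eq_zero fun c _ => ?_).symm
      split_ifs with hc hc'
      · subst hc
        exact absurd hc' hk
      · rfl
      · rfl
  rw [Finset.sum_congr rfl fun k _ => h1 k, Finset.sum_comm]
  refine Finset.sum_congr rfl fun c _ => ?_
  rw [Finset.sum_ite_eq']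
  by_cases hc : 2 * (i : ℕ) + j + numCycles c = p + 1
  · rw [if_pos (Finset.mem_range.mpr (by omega)), if_pos hc]
    split_ifs with h
    · rfl
    -- These are the terms that positivity excludes from `VertexStr`, with neither cycles nor
    -- boundary; the hypothesis on `I` removes them.
    · have hj : (j : ℕ) = 0 := by omega
      have h0 : numCycles c = 0 := by omega
      have : I i j (numCycles c) n = 0 := by
        rw [hj, h0]
        exact hI i n
      rw [this, map_zero]
  · rw [if_neg hc, ite_self, if_neg fun h => hc h.1]

end Sigma

/-! ### Comparison of the two flows -/

section Flow

open Equiv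

variable {𝕜 E A : Type*} [RCLike 𝕜]
  [AddCommGroup E] [Module 𝕜 E] [TopologicalSpace E] [IsTopologicalAddGroup E]
  [ContinuousSMul 𝕜 E] [FirstCountableTopology E]
  [Ring A] [Algebra 𝕜 A] [UniformSpace A] [IsUniformAddGroup A] [ContinuousSMul 𝕜 A]
  [ContinuousMul A] [PolynormableSpace 𝕜 A] [T2Space A] [CompleteSpace A]
  (gE : FinGrading 𝕜 E) {gA : FinGrading 𝕜 A}

theorem commFlow_apply (J : CommFunctional gE A) (P : CTensor 𝕜 E E A) (p q : ℕ) :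
    commFlow gE J P p q = ∑ Q ∈ (finite_stable p q).toFinset, (Q.out.numAut : 𝕜)⁻¹ •
      (Pi.single Q.out.numLegs (commWeight gE Q.out J P) : ∀ q, SymFun gE A q) q := by
  rw [commFlow, finsum_eq_sum_of_support_subset]
  · refine Finset.sum_congr rfl fun Q hQ => if_pos ?_
    rw [Set.Finite.mem_toFinset] at hQ
    exact ⟨hQ.1, hQ.2.1⟩
  · intro Q hQ
    rw [Function.mem_support] at hQ
    rw [Set.Finite.coe_toFinset]
    by_contra h
    refine hQ ?_
    split_ifs with h'
    · rw [Pi.single_eq_of_ne fun h'' => h ⟨h'.1, h'.2, h''.symm⟩, smul_zero]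
    · rfl

-- Graphs that contribute to this component have loop number `p`. One finite index set therefore
-- serves all triples `i`, `j`, `k` at once, and the sums can be exchanged.
open scoped Classical in
theorem ncFlow_apply (I : NCFunctional gE A) (P : CTensor 𝕜 E E A) {p i j k q : ℕ}
    (h : 2 * i + j + k = p + 1) :
    ncFlow gE I P i j k q = ∑ Q ∈ (finite_ribbon p q).toFinset,
      if Q.out.Connected ∧ Q.out.genus = i ∧ Q.out.freeBoundary = j then
        (Q.out.numAut : 𝕜)⁻¹ • (Pi.single _ (Pi.single _ (ncWeight gE Q.out I P)) :
          ∀ k l, CycFun gE A k l) k q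
      else 0 := by
  rw [ncFlow, finsum_eq_sum_of_support_subset]
  intro Q hQ
  rw [Function.mem_support] at hQ
  rw [Set.Finite.coe_toFinset]
  by_contra h1
  refine hQ ?_
  split_ifs with h'
  · obtain ⟨hc, hi, hj⟩ := h'
    by_cases hk : k = numCycles (Q.out.legNumbering.symm.permCongr Q.out.legPerm)
    · have hp : Q.out.toStable.loopNumber = p := by
        rw [RibbonGraph.loopNumber_eq hc hi hj, ← h, hk, numCycles_permCongr]
      subst hk
      rw [Pi.single_eq_same, Pi.single_eq_of_ne fun hq => h1 ⟨hc, hp, hq.symm⟩, smul_zero]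
    · rw [Pi.single_eq_of_ne hk, Pi.zero_apply, smul_zero]
  · rfl

/-- The functional attached to a vertex of a stable ribbon graph. -/
def ribbonVertex (I : NCFunctional gE A) (Γ : RibbonGraph) (v : Fin Γ.m) :
    MultiFun 𝕜 E A (Γ.Fiber v) :=
  attachCyc gE (Γ.cyc v) (numCycles (Γ.cyc v)) (Γ.valency v)
    (I (Γ.gen v) (Γ.bdry v) (numCycles (Γ.cyc v)) (Γ.valency v))

/-- The symmetrized Feynman weight of a stable ribbon graph, placed in order `|L|`. -/
def symWeight (I : NCFunctional gE A) (P : CTensor 𝕜 E E A) (Γ : RibbonGraph) :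
    ∀ q, SymFun gE A q :=
  Pi.single Γ.numLegs (symClass gE (amplitude gE Γ.toHalfEdgeGraph (ribbonVertex gE I Γ) P))

theorem cycToSym_ncWeight (I : NCFunctional gE A) (P : CTensor 𝕜 E E A) (Γ : RibbonGraph)
    (k q : ℕ) :
    cycToSym gE k q ((Pi.single _ (Pi.single _ (ncWeight gE Γ I P)) : ∀ k l, CycFun gE A k l) k q) =
      if k = numCycles Γ.legPerm then symWeight gE I P Γ q else 0 := by
  rw [cycToSym_single, ncWeight, cycToSym_cycClass, numCycles_permCongr]
  rfl

/-- A connected ribbon graph contributes to exactly one triple: its genus, its free boundary and its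
number of leg cycles. The first two are natural numbers, and `RibbonGraph.loopNumber_eq` shows that
the triple has exponent `p`. -/
theorem sigmaMap_ncFlow (I : NCFunctional gE A) (P : CTensor 𝕜 E E A) (p q : ℕ) :
    sigmaMap gE (ncFlow gE I P) p q = ∑ Q ∈ (finite_ribbon p q).toFinset,
      (Q.out.numAut : 𝕜)⁻¹ • symWeight gE I P Q.out q := by
  classical
  have h1 : ∀ i j k : ℕ, (if 2 * i + j + k = p + 1 then
      cycToSym gE k q (ncFlow gE I P i j k q) else 0) = ∑ Q ∈ (finite_ribbon p q).toFinset,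
        if 2 * i + j + k = p + 1 then
          (if Q.out.genus = i ∧ Q.out.freeBoundary = j ∧ k = numCycles Q.out.legPerm then
            (Q.out.numAut : 𝕜)⁻¹ • symWeight gE I P Q.out q else 0) else 0 := by
    intro i j k
    split_ifs with h
    · rw [ncFlow_apply gE I P h, map_sum]
      refine Finset.sum_congr rfl fun Q hQ => ?_
      rw [Set.Finite.mem_toFinset] at hQ
      by_cases h' : Q.out.genus = i ∧ Q.out.freeBoundary = j
      · rw [if_pos ⟨hQ.1, h'⟩, map_smul, cycToSym_ncWeight, smul_ite, smul_zero]
        simp only [h', true_and]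
      · rw [if_neg fun h'' => h' h''.2, map_zero, if_neg fun h'' => h' ⟨h''.1, h''.2.1⟩]
    · rw [Finset.sum_const_zero]
  simp only [sigmaMap_apply, h1]
  rw [Finset.sum_congr rfl fun i _ => Finset.sum_congr rfl fun j _ => Finset.sum_comm,
    Finset.sum_congr rfl fun i _ => Finset.sum_comm, Finset.sum_comm]
  refine Finset.sum_congr rfl fun Q hQ => ?_
  rw [Set.Finite.mem_toFinset] at hQ
  obtain ⟨i₀, hi⟩ := Q.out.exists_genus hQ.1
  obtain ⟨j₀, hj⟩ := Q.out.exists_freeBoundary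
  have h2 := (RibbonGraph.loopNumber_eq hQ.1 hi hj).mp hQ.2.1
  simp only [hi, hj, Nat.cast_inj, @eq_comm ℕ i₀, @eq_comm ℕ j₀]
  rw [sum_range_triple, if_pos h2]

variable {gE}

theorem isDegZero_ribbonVertex {I : NCFunctional gE A} (hI : ∀ i j k l, CycDegZero gE gA (I i j k l))
    (Γ : RibbonGraph) (v : Fin Γ.m) : IsDegZero gE gA (ribbonVertex gE I Γ v) :=
  isDegZero_attachCyc _ (hI _ _ _ _)

theorem symWeight_eq_of_iso (hA : gA.IsGradedCommAlgebra) {P : CTensor 𝕜 E E A}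
    (hP : IsPropagator gE gA P) {I : NCFunctional gE A}
    (hI : ∀ i j k l, CycDegZero gE gA (I i j k l)) {Γ Γ' : RibbonGraph}
    (f : RibbonGraph.Iso Γ Γ') : symWeight gE I P Γ = symWeight gE I P Γ' := by
  refine (symClass_amplitude_congr hA hP f.half f.vert f.map_ρ f.map_κ
    (isDegZero_ribbonVertex hI Γ) fun v => ?_).symm
  have hv : Γ'.valency (f.vert v) = Γ.valency v :=
    (Fintype.card_congr (fiberCongr f.half f.vert f.map_ρ v)).symm
  rw [ribbonVertex, ribbonVertex, ← attachCyc_transport, ← f.permCongr_cyc, f.map_gen, f.map_bdry,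
    numCycles_permCongr, hv]

/-- The amplitude is multilinear in the vertex functionals, and choosing one term at every vertex is
the same as choosing a ribbon structure on `G`. -/
theorem single_commWeight {I : NCFunctional gE A} (hI : ∀ i l, I i 0 0 l = 0)
    (P : CTensor 𝕜 E E A) (G : StableGraph) :
    (Pi.single G.numLegs (commWeight gE G (sigmaMap gE I) P) : ∀ q, SymFun gE A q) =
      ∑ s : RibbonStr G, symWeight gE I P s.toRibbon := by
  have h1 : (fun v => attachSym gE (G.valency v) (sigmaMap gE I (G.loop v) (G.valency v))) =
      fun v => ∑ x : VertexStr (G.loop v) (G.Fiber v), attachCyc gE x.1.2.2 (numCycles x.1.2.2)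
        (G.valency v) (I x.1.1 x.1.2.1 (numCycles x.1.2.2) (G.valency v)) :=
    funext fun v => attachSym_sigmaMap gE hI _ _
  have h2 : ∀ s : RibbonStr G, (fun v => attachCyc gE (s v).1.2.2 (numCycles (s v).1.2.2)
      (G.valency v) (I (s v).1.1 (s v).1.2.1 (numCycles (s v).1.2.2) (G.valency v))) =
        ribbonVertex gE I s.toRibbon := fun s => funext fun v =>
    congrArg (fun c => attachCyc gE c (numCycles c) (G.valency v)
      (I (s v).1.1 (s v).1.2.1 (numCycles c) (G.valency v))) (s.toRibbon_cyc v).symm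
  rw [commWeight, h1, amplitude_sum]
  refine (map_sum (LinearMap.single 𝕜 (fun q => SymFun gE A q) G.numLegs ∘ₗ
    (symRel gE A G.numLegs).mkQ) _ _).trans (Finset.sum_congr rfl fun s _ => ?_)
  exact congrArg (fun F => (Pi.single G.numLegs (symClass gE (amplitude gE G.toHalfEdgeGraph F P)) :
    ∀ q, SymFun gE A q)) (h2 s)

/-- Ribbon classes are grouped by the class of their underlying stable graph. Each group is compared
with its stable graph by `RibbonStr.inv_numAut_smul_sum`, applied to the isomorphism-invariant
symmetrized weight. -/
theorem sigmaMap_ncFlow_eq (hA : gA.IsGradedCommAlgebra) {P : CTensor 𝕜 E E A}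
    (hP : IsPropagator gE gA P) {I : NCFunctional gE A} (hI : IsNCInteraction gE gA I) :
    sigmaMap gE (ncFlow gE I P) = commFlow gE (sigmaMap gE I) P := by
  classical
  funext p q
  have h1 : ∀ Q ∈ (finite_ribbon p q).toFinset,
      Quotient.mk StableGraph.setoid Q.out.toStable ∈ (finite_stable p q).toFinset := by
    intro Q hQ
    rw [Set.Finite.mem_toFinset] at hQ ⊢
    obtain ⟨f⟩ := Quotient.mk_out (s := StableGraph.setoid) Q.out.toStable
    exact ⟨f.connected_iff.mpr hQ.1, f.loopNumber_eq.trans hQ.2.1, f.numLegs_eq.trans hQ.2.2⟩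
  rw [sigmaMap_ncFlow, commFlow_apply, ← Finset.sum_fiberwise_of_maps_to h1]
  refine Finset.sum_congr rfl fun S hS => ?_
  rw [Set.Finite.mem_toFinset] at hS
  rw [single_commWeight hI.const_eq_zero, Finset.sum_apply]
  refine (RibbonStr.inv_numAut_smul_sum (fun Γ => symWeight gE I P Γ q) (fun R R' ⟨f⟩ => by
    rw [symWeight_eq_of_iso hA hP hI.degZero f]) S.out _ fun Q => ?_).symm
  rw [Finset.mem_filter, Set.Finite.mem_toFinset]
  constructor
  · rintro ⟨-, rfl⟩
    exact (Quotient.mk_out (s := StableGraph.setoid) Q.out.toStable).elim fun f => ⟨f.symm⟩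
  · rintro ⟨f⟩
    refine ⟨⟨f.connected_iff.mpr hS.1, f.loopNumber_eq.trans hS.2.1,
      f.numLegs_eq.trans hS.2.2⟩, ?_⟩
    rw [← Quotient.out_eq S]
    exact Quotient.sound (s := StableGraph.setoid) ⟨f⟩

theorem cycDegZero_single {K L : ℕ} {w : CycFun gE A K L} (hw : CycDegZero gE gA w) (k l : ℕ) :
    CycDegZero gE gA ((Pi.single K (Pi.single L w) : ∀ k l, CycFun gE A k l) k l) := by
  rcases eq_or_ne k K with rfl | hk
  · rcases eq_or_ne l L with rfl | hl
    · simpa using hw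
    · rw [Pi.single_eq_same, Pi.single_eq_of_ne hl]
      exact Submodule.zero_mem (cycDegZeroSubmodule gE gA _ _)
  · rw [Pi.single_eq_of_ne hk]
    exact Submodule.zero_mem (cycDegZeroSubmodule gE gA _ _)

theorem symDegZero_single {L : ℕ} {w : SymFun gE A L} (hw : SymDegZero gE gA w) (l : ℕ) :
    SymDegZero gE gA ((Pi.single L w : ∀ l, SymFun gE A l) l) := by
  rcases eq_or_ne l L with rfl | hl
  · simpa using hw
  · rw [Pi.single_eq_of_ne hl]
    exact Submodule.zero_mem (symDegZeroSubmodule gE gA _)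

theorem isNCInteraction_ncFlow (hA : gA.IsGradedCommAlgebra) {P : CTensor 𝕜 E E A}
    (hP : IsPropagator gE gA P) {I : NCFunctional gE A} (hI : IsNCInteraction gE gA I) :
    IsNCInteraction gE gA (ncFlow gE I P) where
  degZero i j k l := by
    refine finsum_induction (CycDegZero gE gA) (Submodule.zero_mem (cycDegZeroSubmodule gE gA k l))
      (fun _ _ => Submodule.add_mem (cycDegZeroSubmodule gE gA k l)) fun Q => ?_
    split_ifs
    · exact Submodule.smul_mem (cycDegZeroSubmodule gE gA k l) _ (cycDegZero_single
        (cycDegZero_cycClass _ (isDegZero_amplitude hA hP _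
          (isDegZero_ribbonVertex hI.degZero Q.out))) k l)
    · exact Submodule.zero_mem (cycDegZeroSubmodule gE gA k l)
  const_eq_zero i l := by
    refine finsum_eq_zero_of_forall_eq_zero fun Q => ?_
    split_ifs with h
    -- With `j = 0` there is at least one cycle of legs, so the component with `k = 0` is not
    -- reached.
    · have h1 := RibbonGraph.one_le h.1 h.2.2
      rw [Pi.single_eq_of_ne (by rw [numCycles_permCongr]; omega), Pi.zero_apply, smul_zero]
    · rfl
  eq_zero i j k l hl := by
    refine finsum_eq_zero_of_forall_eq_zero fun Q => ?_
    split_ifs with h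
    · have h1 := RibbonGraph.three_le h.1 h.2.1 h.2.2
      by_cases hk : k = numCycles (Q.out.legNumbering.symm.permCongr Q.out.legPerm)
      · have hk' := hk.trans (numCycles_permCongr _ _)
        subst hk
        rw [Pi.single_eq_same, Pi.single_eq_of_ne, smul_zero]
        rintro rfl
        rw [hk'] at hl
        omega
      · rw [Pi.single_eq_of_ne hk, Pi.zero_apply, smul_zero]
    · rfl

theorem isCommInteraction_commFlow (hA : gA.IsGradedCommAlgebra) {P : CTensor 𝕜 E E A}
    (hP : IsPropagator gE gA P) {J : CommFunctional gE A} (hJ : IsCommInteraction gE gA J) :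
    IsCommInteraction gE gA (commFlow gE J P) where
  degZero p q := by
    rw [commFlow_apply]
    exact Submodule.sum_mem (symDegZeroSubmodule gE gA q) fun Q _ => Submodule.smul_mem _ _
      (symDegZero_single (symDegZero_symClass (isDegZero_amplitude hA hP _ fun v =>
        isDegZero_attachSym (hJ.degZero _ _))) q)
  eq_zero p q h := by
    rw [commFlow_apply]
    refine Finset.sum_eq_zero fun Q hQ => ?_
    rw [Set.Finite.mem_toFinset] at hQ
    have h1 := StableGraph.three_le hQ.1 hQ.2.1
    rw [hQ.2.2] at h1
    omega

end Flow
end NCFlow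

end

theorem mainTheorem4 {𝕜 E A : Type*} [RCLike 𝕜]
    [AddCommGroup E] [Module 𝕜 E] [TopologicalSpace E] [IsTopologicalAddGroup E]
    [ContinuousSMul 𝕜 E] [FirstCountableTopology E]
    [Ring A] [Algebra 𝕜 A] [UniformSpace A] [IsUniformAddGroup A] [ContinuousSMul 𝕜 A]
    [ContinuousMul A] [PolynormableSpace 𝕜 A] [T2Space A] [CompleteSpace A]
    (gE : NCFlow.FinGrading 𝕜 E) (gA : NCFlow.FinGrading 𝕜 A) (hA : gA.IsGradedCommAlgebra) :
    (∀ (i j l : ℕ) (c : Equiv.Perm (Fin l)) (f : NCFlow.MultiFun 𝕜 E A (Fin l)),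
      1 ≤ j + NCFlow.numCycles c →
      NCFlow.sigmaMap gE (NCFlow.ncMonomial gE i j (NCFlow.cycClass gE c f)) =
        NCFlow.commMonomial gE (2 * i + j + NCFlow.numCycles c - 1) (NCFlow.symClass gE f)) ∧
    (∀ p q : ℕ, {Γ : Quotient NCFlow.StableGraph.setoid |
      Γ.out.Connected ∧ Γ.out.loopNumber = p ∧ Γ.out.numLegs = q}.Finite) ∧
    (∀ i j k l : ℕ, {Γ : Quotient NCFlow.RibbonGraph.setoid |
      Γ.out.Connected ∧ Γ.out.genus = i ∧ Γ.out.freeBoundary = j ∧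
        NCFlow.numCycles Γ.out.legPerm = k ∧ Γ.out.numLegs = l}.Finite) ∧
    (∀ I : NCFlow.NCFunctional gE A, NCFlow.IsNCInteraction gE gA I →
      NCFlow.IsCommInteraction gE gA (NCFlow.sigmaMap gE I)) ∧
    ∀ P : NCFlow.CTensor 𝕜 E E A, NCFlow.IsPropagator gE gA P →
      (∀ I : NCFlow.NCFunctional gE A, NCFlow.IsNCInteraction gE gA I →
        NCFlow.IsNCInteraction gE gA (NCFlow.ncFlow gE I P)) ∧
      (∀ J : NCFlow.CommFunctional gE A, NCFlow.IsCommInteraction gE gA J →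
        NCFlow.IsCommInteraction gE gA (NCFlow.commFlow gE J P)) ∧
      ∀ I : NCFlow.NCFunctional gE A, NCFlow.IsNCInteraction gE gA I →
        NCFlow.sigmaMap gE (NCFlow.ncFlow gE I P) =
          NCFlow.commFlow gE (NCFlow.sigmaMap gE I) P :=
  ⟨fun i j _ c f h => NCFlow.sigmaMap_ncMonomial gE i j c f h, NCFlow.finite_stable,
    NCFlow.finite_ribbon', fun _ hI => hI.sigmaMap, fun _ hP =>
      ⟨fun _ hI => NCFlow.isNCInteraction_ncFlow hA hP hI,
        fun _ hJ => NCFlow.isCommInteraction_commFlow hA hP hJ,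
        fun _ hI => NCFlow.sigmaMap_ncFlow_eq hA hP hI⟩⟩
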